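/- Let $N\ge 1$ and $\alpha=\frac2N$. Let $k,m,n$ be integers with $$k>\frac N2,\qquad n>\max\Bigl\{\frac N2+1,\frac N{2\alpha}\Bigr\},\qquad 2m\ge k+n+1,$$ put $J=2m+2+k+n$ and $\langle x\rangle=(1+|x|^2)^{1/2}$. Let $X$ be the space of all $u\in H^J(\mathbb R^N)$ (complex-valued) such that $\langle x\rangle^nD^\beta u\in L^\infty(\mathbb R^N)$ for $0\le|\beta|\le 2m$, $\langle x\rangle^nD^\beta u\in L^2(\mathbb R^N)$ for $2m+1\le|\beta|\le 2m+2+k$, and $\langle x\rangle^{J-|\beta|}D^\beta u\in L^2(\mathbb R^N)$ for $2m+2+k<|\beta|\le J$, with the norm $$\|u\|_X=\sum_{j=0}^{2m}\ \sup_{|\beta|=j}\|\langle\cdot\rangle^nD^\beta u\|_{L^\infty}+\sum_{\nu=0}^{k+1}\sum_{\mu=0}^{n}\ \sup_{|\beta|=\nu+\mu+2m+1}\|\langle\cdot\rangle^{n-\mu}D^\beta u\|_{L^2}.$$ (Elements of $X$ have a continuous representative, which is used in all infima over $x$ below.) Let $\lambda\in\mathbb C$, $b\ge0$ (with $\frac1b=\infty$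 if $b=0$), and let $\varphi\in X$ satisfy $\inf_{x\in\mathbb R^N}\langle x\rangle^n|\varphi(x)|>0$. Consider the Cauchy problem $$i v_t+\Delta v=\lambda(1-bt)^{-1}|v|^\alpha v,\qquad v(0)=\varphi,\tag{1}$$ where, for $v\in C(I,X)$ on an interval $I\ni 0$ of $[0,\frac1b)$, the equation is understood in $L^2(\mathbb R^N)$ for every $t\in I$. Consider also the condition $$\inf_{0\le t\le T}\ \inf_{x\in\mathbb R^N}\bigl(\langle x\rangle^n|v(t,x)|\bigr)>0.\tag{2}$$ 1. There exist $0<T<\frac1b$ and a unique solution $v\in C([0,T],X)$ of (1) satisfying (2). 2. Moreover, $v$ can be extended on a maximal existence interval $[0,T_{\max})$ with $0<T_{\max}\le\frac1b$ to a solution $v\in C([0,T_{\max}),X)$ of (1) satisfying (2) for all $0<T<T_{\max}$. Maximality means: if $0<T<\frac1b$ and $w\in C([0,T],X)$ is a solution of (1) satisfying (2), then $T<T_{\max}$ and $w=v$ on $[0,T]$. 3. If $T_{\max}<\frac1b$, then $$\|v(t)\|_X+\Bigl(\inf_{x\in\mathbb R^N}\langle x\rangle^n|v(t,x)|\Bigr)^{-1}\longrightarrow\infty\qquad\text{as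 }t\uparrow T_{\max}.$$ -/

import Mathlib

open MeasureTheory TemperedDistribution Filter Topology
open scoped ENNReal SchwartzMap LineDeriv Laplacian

noncomputable section

namespace NLS

/-- Euclidean space `ℝ^N`. -/
abbrev Space (N : ℕ) : Type := EuclideanSpace ℝ (Fin N)

/-- The Hilbert space `L²(ℝ^N; ℂ)`. -/
abbrev L2 (N : ℕ) : Type := Lp ℂ 2 (volume : Measure (Space N))

/-- The Japanese bracket `⟨x⟩ = (1 + |x|²)^{1/2}`. -/
def bracket {N : ℕ} (x : Space N) : ℝ := Real.sqrt (1 + ‖x‖ ^ 2)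

/-- The partial derivative `∂_{s 0} ∂_{s 1} ⋯ ∂_{s (j-1)} u` of order `j` of `u ∈ L²(ℝ^N)`, taken in
the sense of (tempered) distributions. Partial derivatives commute, so when `s` runs over all words
of length `j` in the coordinate indices, this runs over all `D^β u`, `β` a multi-index with
`|β| = j`. -/
def D {N j : ℕ} (s : Fin j → Fin N) (u : L2 N) : 𝓢'(Space N, ℂ) :=
  ∂^{fun i => EuclideanSpace.single (s i) (1 : ℝ)} (u : 𝓢'(Space N, ℂ))

/-- `‖⟨·⟩^a f‖_{L^p}` for a distribution `f` which is a function in `L²(ℝ^N)` (the function `g`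
below is then unique); by convention it is `∞` if `f` is not such a function. -/
def weightedNorm {N : ℕ} (p : ℝ≥0∞) (a : ℕ) (f : 𝓢'(Space N, ℂ)) : ℝ≥0∞ :=
  ⨅ (g : L2 N) (_ : (g : 𝓢'(Space N, ℂ)) = f),
    eLpNorm (fun x => ((bracket x ^ a : ℝ) : ℂ) * g x) p volume

/-- The integer `J = 2m + 2 + k + n`. -/
def J (k m n : ℕ) : ℕ := 2 * m + 2 + k + n

/-- Membership in the space `X`. -/
structure MemX {N : ℕ} (k m n : ℕ) (u : L2 N) : Prop where
  sobolev : MemSobolev (J k m n : ℝ) 2 (u : 𝓢'(Space N, ℂ))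
  low : ∀ j : ℕ, j ≤ 2 * m → ∀ s : Fin j → Fin N, weightedNorm ∞ n (D s u) < ∞
  mid : ∀ j : ℕ, 2 * m + 1 ≤ j → j ≤ 2 * m + 2 + k →
    ∀ s : Fin j → Fin N, weightedNorm 2 n (D s u) < ∞
  high : ∀ j : ℕ, 2 * m + 2 + k < j → j ≤ J k m n →
    ∀ s : Fin j → Fin N, weightedNorm 2 (J k m n - j) (D s u) < ∞

/-- The norm of `X`, with values in `[0, ∞]`. -/
def normX {N : ℕ} (k m n : ℕ) (u : L2 N) : ℝ≥0∞ :=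
  (∑ j ∈ Finset.range (2 * m + 1), ⨆ s : Fin j → Fin N, weightedNorm ∞ n (D s u)) +
    ∑ ν ∈ Finset.range (k + 2), ∑ μ ∈ Finset.range (n + 1),
      ⨆ s : Fin (ν + μ + 2 * m + 1) → Fin N, weightedNorm 2 (n - μ) (D s u)

/-- `v` is continuous on `I` with values in the normed space `X`. -/
def ContinuousOnX {N : ℕ} (k m n : ℕ) (I : Set ℝ) (v : ℝ → L2 N) : Prop :=
  (∀ t ∈ I, MemX k m n (v t)) ∧
    ∀ t ∈ I, Tendsto (fun s => normX k m n (v s - v t)) (𝓝[I] t) (𝓝 0)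

/-- `inf_x ⟨x⟩^n |u(x)|`. As `u` is a class modulo null sets, this is written as an essential
infimum; for the elements of `X`, which have a (unique) continuous representative, it is the pointwise
infimum for this representative, see `weightedInf_eq_iInf`. -/
def weightedInf {N : ℕ} (n : ℕ) (u : L2 N) : ℝ≥0∞ :=
  essInf (fun x => ENNReal.ofReal (bracket x ^ n * ‖u x‖)) volume

theorem weightedInf_eq_iInf {N : ℕ} (n : ℕ) (u : L2 N) (f : Space N → ℂ) (hf : Continuous f)
    (hfu : u =ᵐ[volume] f) :
    weightedInf n u = ⨅ x, ENNReal.ofReal (bracket x ^ n * ‖f x‖) := by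
  have hc : Continuous (fun x : Space N => ENNReal.ofReal (bracket x ^ n * ‖f x‖)) := by
    unfold bracket
    exact ENNReal.continuous_ofReal.comp (by fun_prop)
  have h1 : weightedInf n u =
      essInf (fun x : Space N => ENNReal.ofReal (bracket x ^ n * ‖f x‖)) volume := by
    refine essInf_congr_ae ?_
    filter_upwards [hfu] with x hx
    simp only [hx]
  rw [h1]
  apply le_antisymm
  · refine le_iInf fun x => ?_
    by_contra hlt
    rw [not_le] at hlt
    have hopen := hc.isOpen_preimage _ (isOpen_Iio (a := essInf (fun x : Space N =>
      ENNReal.ofReal (bracket x ^ n * ‖f x‖)) volume))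
    exact (hopen.measure_pos volume ⟨x, hlt⟩).ne'
      (meas_lt_essInf (f := fun x : Space N => ENNReal.ofReal (bracket x ^ n * ‖f x‖)))
  · exact le_essInf_of_ae_le _ (Eventually.of_forall fun x => iInf_le _ x)

/-- The Cauchy problem `i v_t + Δ v = λ (1 - bt)^{-1} |v|^α v`, `v(0) = φ`, with `α = 2/N`, for
`v ∈ C(I, X)`, where `I` is a time interval starting at `0`.
Since `X ⊂ H²(ℝ^N)`, the equation is understood in the strong sense, as an equality in `L²(ℝ^N)` for
every `t ∈ I`, `v_t` being the (one-sided at the end points) derivative of `v : I → L²(ℝ^N)`. -/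
structure IsSolution {N : ℕ} (k m n : ℕ) (lam : ℂ) (b : ℝ) (φ : L2 N) (I : Set ℝ) (v : ℝ → L2 N) :
    Prop where
  cont : ContinuousOnX k m n I v
  init : v 0 = φ
  eqn : ∀ t ∈ I, ∃ vt Δv Nv : L2 N,
    HasDerivWithinAt v vt I t ∧
    (Δv : 𝓢'(Space N, ℂ)) = Δ (v t : 𝓢'(Space N, ℂ)) ∧
    (Nv =ᵐ[volume] fun x => ((‖v t x‖ ^ (2 / (N : ℝ)) : ℝ) : ℂ) * v t x) ∧
    Complex.I • vt + Δv = (lam * ((1 - b * t : ℝ) : ℂ)⁻¹) • Nv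

/-- Solutions on `[0, T]` that satisfy the lower bound
`inf_{0 ≤ t ≤ T} inf_x ⟨x⟩^n |v(t, x)| > 0`. -/
def IsPosSolution {N : ℕ} (k m n : ℕ) (lam : ℂ) (b : ℝ) (φ : L2 N) (T : ℝ) (v : ℝ → L2 N) : Prop :=
  IsSolution k m n lam b φ (Set.Icc 0 T) v ∧ 0 < ⨅ t ∈ Set.Icc 0 T, weightedInf n (v t)

end NLS

end

/-! Write `U t` for the free group e^{itΔ}, and c(t) = λ/(1-bt). With v(t) = U(t)z(t) the equation
becomes z(t) = φ + ∫₀ᵗ -i c(s) U(-s)(|U(s)z|^α U(s)z) ds. The contraction argument takes place in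
the metric of L² alone, where |u|^α u is Lipschitz on sets bounded in L^∞ (`norm_powerL2_sub_le`).
The space X enters only through a priori bounds `XBound`, and sets of functions obeying such a bound
are closed in L² (`XBound.of_tendsto`): the weighted norms are convex and lower semicontinuous, even
under convergence of distributions (`weightedNorm_le_of_tendsto`). Convexity also gives Minkowski's
inequality for L²-valued integrals. Hence no estimate of differences in X of the nonlinearity is
needed.

Two facts make the scheme work. First, the group is bounded on X for short times
(`exists_xBound_U`). By `Xc_UV`, moving a coordinate through `U t` costs one derivative and a factor
2t. For orders above 2m this fits the norm of X, whose weight drops by at most one per extra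
derivative (`JointBound`). Orders 2m+1 and 2m+2 are then controlled in weighted L^∞ by Sobolev
embedding, since k > N/2 and the full weight n is present up to order 2m+2+k. Lower orders follow by
descending induction from U(t)f - f = i∫₀ᵗ U(s)Δf ds, which asks for two more derivatives. The same
formula shows that u moves at Lipschitz speed in weighted L^∞, so a lower bound |u| ≥ η⟨x⟩^{-n}
persists for a short time.

Second, the nonlinearity is bounded on functions of X with such a lower bound
(`exists_xBound_power`). After division by r = ⟨x⟩^{-n} the values of u lie in a fixed annulus, on
which z ↦ |z|^α z is smooth with bounded derivatives. In Faà di Bruno's formula at most one factor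
has order above 2m, because J ≤ 4m+1; all other factors are pointwise of size r. The terms without a
high factor decay like ⟨x⟩^{-nα} after weighting, and this is in L² since nα > N/2. The chain rule
is legitimate for mollifications of u, which keep half of the lower bound when the radius is small;
the bound passes to the limit by lower semicontinuity.

Continuity in X of the fixed point is free: z is an integral of a function bounded in X, hence
Lipschitz into X, and U is strongly continuous on X. Uniqueness is Gronwall's inequality in L². The
existence time depends only on bounds for the norm of the data, for the inverse of the lower bound
and for c, so gluing produces the maximal solution and the blowup alternative (`exists_maximal`). -/

noncomputable section

namespace NLS

open LineDeriv FourierTransform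

variable {N : ℕ}

/-! ### Distributional derivatives indexed by lists -/

/-- The `i`-th standard basis vector. -/
abbrev e (i : Fin N) : Space N := EuclideanSpace.single i (1 : ℝ)

/-- The iterated partial derivative along a list of coordinates. -/
def dl : List (Fin N) → 𝓢'(Space N, ℂ) →L[ℂ] 𝓢'(Space N, ℂ)
  | [] => ContinuousLinearMap.id ℂ _
  | i :: l => (lineDerivOpCLM ℂ 𝓢'(Space N, ℂ) (e i)) ∘L dl l

@[simp] theorem dl_nil (f : 𝓢'(Space N, ℂ)) : dl [] f = f := rfl

theorem dl_cons (i : Fin N) (l : List (Fin N)) (f : 𝓢'(Space N, ℂ)) :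
    dl (i :: l) f = ∂_{e i} (dl l f) := rfl

theorem dl_append (l l' : List (Fin N)) (f : 𝓢'(Space N, ℂ)) :
    dl (l ++ l') f = dl l (dl l' f) := by
  induction l with
  | nil => rfl
  | cons i l ih => simp [dl_cons, ih]

/-- Lists can be appended and shortened at either end without casts between `Fin` types; the
inductions on the order of a derivative run over them. -/
theorem D_eq_dl {j : ℕ} (s : Fin j → Fin N) (u : L2 N) :
    D s u = dl (List.ofFn s) (u : 𝓢'(Space N, ℂ)) := by
  unfold D
  generalize (u : 𝓢'(Space N, ℂ)) = f
  induction j with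
  | zero => simp
  | succ j ih =>
    rw [iteratedLineDerivOp_succ_left, List.ofFn_succ, dl_cons, ← ih (fun i => s i.succ)]
    rfl

/-- Multiplication of a distribution by the `i`-th coordinate. -/
def Xc (i : Fin N) : 𝓢'(Space N, ℂ) →L[ℂ] 𝓢'(Space N, ℂ) :=
  smulLeftCLM ℂ fun x => ((inner ℝ x (e i) : ℝ) : ℂ)

theorem inner_e (x : Space N) (i : Fin N) : inner ℝ x (e i) = x i := by
  simp [EuclideanSpace.inner_single_right]

theorem coord_hasTemperateGrowth (i : Fin N) :
    (fun x : Space N => ((inner ℝ x (e i) : ℝ) : ℂ)).HasTemperateGrowth := by fun_prop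

theorem Xc_iterate (i : Fin N) (a : ℕ) (f : 𝓢'(Space N, ℂ)) :
    (Xc i)^[a] f = smulLeftCLM ℂ (fun x => ((inner ℝ x (e i) : ℝ) : ℂ) ^ a) f := by
  induction a with
  | zero => simp
  | succ a ih =>
    rw [Function.iterate_succ_apply', ih, Xc,
      smulLeftCLM_smulLeftCLM_apply (by fun_prop) (by fun_prop)]
    congr 2

/-! ### Commutation relations -/

theorem schwartz_lineDeriv_smulLeft {g : Space N → ℂ} (hg : g.HasTemperateGrowth) {v : Space N}
    (hg' : (fun x => fderiv ℝ g x v).HasTemperateGrowth) (ψ : 𝓢(Space N, ℂ)) :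
    ∂_{v} (SchwartzMap.smulLeftCLM ℂ g ψ) =
      SchwartzMap.smulLeftCLM ℂ (fun x => fderiv ℝ g x v) ψ +
        SchwartzMap.smulLeftCLM ℂ g (∂_{v} ψ) := by
  ext x
  rw [SchwartzMap.lineDerivOp_apply_eq_fderiv, SchwartzMap.smulLeftCLM_apply hg,
    fderiv_fun_smul (hg.1.differentiable (by simp) x) (ψ.differentiable x)]
  simp [hg, hg', SchwartzMap.lineDerivOp_apply_eq_fderiv, add_comm]

theorem lineDeriv_smulLeft {g : Space N → ℂ} (hg : g.HasTemperateGrowth) {v : Space N}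
    (hg' : (fun x => fderiv ℝ g x v).HasTemperateGrowth) (f : 𝓢'(Space N, ℂ)) :
    ∂_{v} (smulLeftCLM ℂ g f) =
      smulLeftCLM ℂ (fun x => fderiv ℝ g x v) f + smulLeftCLM ℂ g (∂_{v} f) := by
  ext ψ
  have := schwartz_lineDeriv_smulLeft hg hg' ψ
  have h2 : SchwartzMap.smulLeftCLM ℂ g (∂_{v} ψ) = ∂_{v} (SchwartzMap.smulLeftCLM ℂ g ψ) -
    SchwartzMap.smulLeftCLM ℂ (fun x => fderiv ℝ g x v) ψ := by rw [this]; abel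
  simp only [lineDerivOp_apply_apply, smulLeftCLM_apply_apply, map_neg, _root_.add_apply]
  rw [h2, map_sub]
  ring

theorem fderiv_coord (i : Fin N) (x v : Space N) :
    fderiv ℝ (fun x : Space N => ((inner ℝ x (e i) : ℝ) : ℂ)) x v = (inner ℝ v (e i) : ℝ) := by
  have : (fun x : Space N => ((inner ℝ x (e i) : ℝ) : ℂ)) =
      (Complex.ofRealCLM ∘L ((innerSL ℝ).flip (e i))) := by
    ext y
    rfl
  rw [this, ContinuousLinearMap.fderiv]
  rfl

theorem lineDeriv_Xc (i j : Fin N) (f : 𝓢'(Space N, ℂ)) :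
    ∂_{e i} (Xc j f) = Xc j (∂_{e i} f) + (if i = j then (1 : ℂ) else 0) • f := by
  have h : (fun x => fderiv ℝ (fun x : Space N => ((inner ℝ x (e j) : ℝ) : ℂ)) x (e i)) =
      fun _ => (if i = j then (1 : ℂ) else 0) := by
    ext x
    rw [fderiv_coord, inner_e]
    by_cases hij : i = j
    · simp [hij]
    · simp [hij, Ne.symm hij]
  rw [Xc, lineDeriv_smulLeft (by fun_prop) (by rw [h]; fun_prop), h, smulLeftCLM_const, add_comm]

theorem laplacian_eq_sum_e (f : 𝓢'(Space N, ℂ)) :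
    Δ f = ∑ i : Fin N, (∂_{e i} (∂_{e i} f) : 𝓢'(Space N, ℂ)) := by
  simpa using TemperedDistribution.laplacian_eq_sum (EuclideanSpace.basisFun (Fin N) ℝ) f

/-! ### `L²` functions as distributions -/

theorem toTD_injective : Function.Injective
    (fun u : L2 N => (u : 𝓢'(Space N, ℂ))) := by
  have h := Lp.ker_toTemperedDistributionCLM_eq_bot (E := Space N) (F := ℂ) (μ := volume) (p := 2)
  exact LinearMap.ker_eq_bot.mp h

theorem toTD_inj {u v : L2 N} (h : (u : 𝓢'(Space N, ℂ)) = v) : u = v := toTD_injective h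

theorem toTD_add (u v : L2 N) : ((u + v : L2 N) : 𝓢'(Space N, ℂ)) = (u : 𝓢'(Space N, ℂ)) + v :=
  map_add (Lp.toTemperedDistributionCLM ℂ volume 2) u v

theorem toTD_sub (u v : L2 N) : ((u - v : L2 N) : 𝓢'(Space N, ℂ)) = (u : 𝓢'(Space N, ℂ)) - v :=
  map_sub (Lp.toTemperedDistributionCLM ℂ volume 2) u v

theorem toTD_smul (c : ℂ) (u : L2 N) : ((c • u : L2 N) : 𝓢'(Space N, ℂ)) = c • (u : 𝓢'(Space N, ℂ)) :=
  map_smul (Lp.toTemperedDistributionCLM ℂ volume 2) c u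

theorem toTD_zero : ((0 : L2 N) : 𝓢'(Space N, ℂ)) = 0 :=
  map_zero (Lp.toTemperedDistributionCLM ℂ volume 2)

theorem toTD_continuous : Continuous (fun u : L2 N => (u : 𝓢'(Space N, ℂ))) :=
  (Lp.toTemperedDistributionCLM ℂ volume 2).continuous

theorem toTD_apply_toLp {g : Space N → ℂ} (hg : MemLp g 2 volume) (ψ : 𝓢(Space N, ℂ)) :
    ((hg.toLp g : L2 N) : 𝓢'(Space N, ℂ)) ψ = ∫ x, ψ x • g x := by
  rw [Lp.toTemperedDistribution_apply]
  refine integral_congr_ae ?_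
  filter_upwards [hg.coeFn_toLp] with x hx
  rw [hx]

/-- If an `L²` function represents a temperate multiple of an `L²` function, it is the pointwise
product. -/
theorem ae_eq_of_smulLeft {w : Space N → ℂ} (hw : w.HasTemperateGrowth) {g h : L2 N}
    (hgh : smulLeftCLM ℂ w (g : 𝓢'(Space N, ℂ)) = h) : h =ᵐ[volume] fun x => w x * g x := by
  have hloc : LocallyIntegrable (fun x => w x * g x) volume := by
    have h1 : LocallyIntegrable g volume := (Lp.memLp g).locallyIntegrable (by norm_num)
    rw [locallyIntegrable_iff] at h1 ⊢
    intro k hk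
    exact (h1 k hk).continuousOn_mul hw.1.continuous.continuousOn hk
  refine ae_eq_of_integral_contDiff_smul_eq ((Lp.memLp h).locallyIntegrable (by norm_num)) hloc ?_
  intro φ hφ hφc
  have hg₁ : HasCompactSupport (Complex.ofRealCLM ∘ φ) := hφc.comp_left rfl
  have hg₂ : ContDiff ℝ ((⊤ : ℕ∞) : WithTop ℕ∞) (Complex.ofRealCLM ∘ φ) := by fun_prop
  have := DFunLike.congr_fun hgh (hg₁.toSchwartzMap hg₂)
  simp only [smulLeftCLM_apply_apply, Lp.toTemperedDistribution_apply,
    SchwartzMap.smulLeftCLM_apply_apply hw] at this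
  simp only [HasCompactSupport.toSchwartzMap_toFun, Function.comp, Complex.ofRealCLM_apply] at this
  simp only [Complex.real_smul]
  simp only [smul_eq_mul] at this
  rw [← this]
  refine integral_congr_ae (Eventually.of_forall fun x => ?_)
  dsimp only
  ring

theorem smulLeft_toTD {w : Space N → ℂ} (hw : w.HasTemperateGrowth) {g : L2 N}
    (h : MemLp (fun x => w x * g x) 2 volume) :
    smulLeftCLM ℂ w (g : 𝓢'(Space N, ℂ)) = (h.toLp _ : L2 N) := by
  ext ψ
  rw [toTD_apply_toLp, smulLeftCLM_apply_apply, Lp.toTemperedDistribution_apply]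
  refine integral_congr_ae (Eventually.of_forall fun x => ?_)
  simp only [SchwartzMap.smulLeftCLM_apply_apply hw, smul_eq_mul]
  ring

/-! ### The bracket -/

theorem one_le_bracket (x : Space N) : 1 ≤ bracket x := by
  unfold bracket
  rw [Real.one_le_sqrt]
  nlinarith [sq_nonneg ‖x‖]

theorem bracket_pos (x : Space N) : 0 < bracket x := lt_of_lt_of_le one_pos (one_le_bracket x)

theorem bracket_sq (x : Space N) : bracket x ^ 2 = 1 + ‖x‖ ^ 2 :=
  Real.sq_sqrt (by positivity)

@[fun_prop] theorem continuous_bracket : Continuous (bracket : Space N → ℝ) := by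
  unfold bracket; fun_prop

theorem abs_coord_le_bracket (x : Space N) (i : Fin N) : |x i| ≤ bracket x := by
  have h1 : |x i| ≤ ‖x‖ := by simpa using PiLp.norm_apply_le x i
  have := bracket_sq x
  nlinarith [bracket_pos x, norm_nonneg x]

theorem bracket_le_sum (x : Space N) : bracket x ≤ 1 + ∑ i, |x i| := by
  have h0 : ‖x‖ ≤ ∑ i, |x i| := by
    have h : x = ∑ i, (x i) • e i := by
      ext j; simp [Finset.sum_apply, Pi.single_apply]
    conv_lhs => rw [h]
    refine (norm_sum_le _ _).trans (le_of_eq ?_)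
    simp [norm_smul]
  have := bracket_sq x
  nlinarith [bracket_pos x, norm_nonneg x]

/-- Coordinates have explicit commutation relations with derivatives and with the Schrödinger group,
so weights are reduced to pure powers of single coordinates. -/
theorem bracket_pow_le_sum (a : ℕ) (x : Space N) :
    bracket x ^ a ≤ ((N : ℝ) + 1) ^ a * (1 + ∑ i, |x i| ^ a) := by
  -- the bracket is at most `(N + 1)` times the largest of `1, |x i|`
  rcases Nat.eq_zero_or_pos N with hN | hN
  · subst hN
    have hb : bracket x = 1 := by
      simp [bracket, Subsingleton.elim x 0]
    simp [hb]
  · have : Nonempty (Fin N) := ⟨⟨0, hN⟩⟩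
    obtain ⟨i, hi⟩ := Finite.exists_max (fun i : Fin N => |x i|)
    have h1 : bracket x ≤ ((N : ℝ) + 1) * max 1 |x i| := by
      refine (bracket_le_sum x).trans ?_
      have : ∑ j, |x j| ≤ ∑ _j : Fin N, max 1 |x i| :=
        Finset.sum_le_sum fun j _ => (hi j).trans (le_max_right _ _)
      simp only [Finset.sum_const, Finset.card_univ, Fintype.card_fin, nsmul_eq_mul] at this
      nlinarith [le_max_left 1 |x i|]
    refine (pow_le_pow_left₀ (bracket_pos x).le h1 a).trans ?_
    rw [mul_pow]
    gcongr
    have h3 : (0 : ℝ) ≤ ∑ i, |x i| ^ a := Finset.sum_nonneg fun _ _ => by positivity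
    have h4 : |x i| ^ a ≤ ∑ i, |x i| ^ a :=
      Finset.single_le_sum (f := fun i => |x i| ^ a) (fun _ _ => by positivity) (Finset.mem_univ i)
    rcases max_cases 1 |x i| with ⟨h, _⟩ | ⟨h, _⟩ <;> rw [h]
    · simp; linarith
    · linarith

/-! ### Weighted norms -/

theorem weightedNorm_coe (p : ℝ≥0∞) (a : ℕ) (g : L2 N) :
    weightedNorm p a (g : 𝓢'(Space N, ℂ)) =
      eLpNorm (fun x => ((bracket x ^ a : ℝ) : ℂ) * g x) p volume := by
  unfold weightedNorm
  refine le_antisymm (iInf₂_le_of_le g rfl le_rfl) (le_iInf₂ fun h hh => ?_)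
  rw [toTD_inj hh]

theorem exists_of_weightedNorm_lt_top {p : ℝ≥0∞} {a : ℕ} {f : 𝓢'(Space N, ℂ)}
    (h : weightedNorm p a f < ∞) : ∃ g : L2 N, (g : 𝓢'(Space N, ℂ)) = f := by
  unfold weightedNorm at h
  rw [iInf_lt_iff] at h
  obtain ⟨g, hg⟩ := h
  rw [iInf_lt_iff] at hg
  exact ⟨g, hg.1⟩

/-- Reduces upper bounds by a weighted norm to genuine L² functions: when the norm on the right is
infinite there is nothing to prove. -/
theorem weightedNorm_cases (p : ℝ≥0∞) (a : ℕ) (f : 𝓢'(Space N, ℂ)) :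
    weightedNorm p a f = ∞ ∨ ∃ g : L2 N, (g : 𝓢'(Space N, ℂ)) = f := by
  by_cases h : weightedNorm p a f = ∞
  · exact Or.inl h
  · exact Or.inr (exists_of_weightedNorm_lt_top (lt_top_iff_ne_top.mpr h))

theorem aesm_weight (a : ℕ) (g : L2 N) :
    AEStronglyMeasurable (fun x => ((bracket x ^ a : ℝ) : ℂ) * g x) volume := by
  refine AEStronglyMeasurable.mul ?_ (Lp.aestronglyMeasurable g)
  exact Continuous.aestronglyMeasurable (by fun_prop)

theorem weightedNorm_two_zero (g : L2 N) :
    weightedNorm 2 0 (g : 𝓢'(Space N, ℂ)) = ‖g‖ₑ := by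
  rw [weightedNorm_coe]
  simp [Lp.enorm_def]

theorem weightedNorm_zero (p : ℝ≥0∞) (a : ℕ) : weightedNorm p a (0 : 𝓢'(Space N, ℂ)) = 0 := by
  rw [← toTD_zero, weightedNorm_coe, ← eLpNorm_zero (ε := ℂ) (p := p) (μ := (volume : Measure (Space N)))]
  refine eLpNorm_congr_ae ?_
  filter_upwards [Lp.coeFn_zero ℂ 2 (volume : Measure (Space N))] with x hx
  simp

theorem weightedNorm_add_le {p : ℝ≥0∞} (hp : 1 ≤ p) (a : ℕ) (f g : 𝓢'(Space N, ℂ)) :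
    weightedNorm p a (f + g) ≤ weightedNorm p a f + weightedNorm p a g := by
  rcases weightedNorm_cases p a f with h | ⟨f, rfl⟩
  · simp [h]
  rcases weightedNorm_cases p a g with h | ⟨g, rfl⟩
  · simp [h]
  rw [← toTD_add, weightedNorm_coe, weightedNorm_coe, weightedNorm_coe]
  refine le_trans (le_of_eq (eLpNorm_congr_ae ?_)) (eLpNorm_add_le (aesm_weight a f) (aesm_weight a g) hp)
  filter_upwards [Lp.coeFn_add f g] with x hx
  rw [hx]
  simp only [Pi.add_apply, mul_add]

theorem td_zero_smul (f : 𝓢'(Space N, ℂ)) : (0 : ℂ) • f = 0 := by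
  ext ψ; simp

theorem td_neg_one_smul (f : 𝓢'(Space N, ℂ)) : (-1 : ℂ) • f = -f := by
  ext ψ; simp

theorem weightedNorm_smul_le (p : ℝ≥0∞) (a : ℕ) (c : ℂ) (f : 𝓢'(Space N, ℂ)) :
    weightedNorm p a (c • f) ≤ ‖c‖ₑ * weightedNorm p a f := by
  by_cases hc : c = 0
  · rw [hc, td_zero_smul, weightedNorm_zero]
    simp
  rcases weightedNorm_cases p a f with h | ⟨f, rfl⟩
  · simp [h, ENNReal.mul_top, hc]
  rw [← toTD_smul, weightedNorm_coe, weightedNorm_coe, ← eLpNorm_const_smul]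
  refine le_of_eq (eLpNorm_congr_ae ?_)
  filter_upwards [Lp.coeFn_smul c f] with x hx
  simp [hx]; ring

theorem weightedNorm_neg (p : ℝ≥0∞) (a : ℕ) (f : 𝓢'(Space N, ℂ)) :
    weightedNorm p a (-f) = weightedNorm p a f := by
  have h : ∀ f : 𝓢'(Space N, ℂ), weightedNorm p a (-f) ≤ weightedNorm p a f := fun f => by
    have h := weightedNorm_smul_le p a (-1) f
    rw [td_neg_one_smul] at h
    simpa using h
  exact le_antisymm (h f) (by simpa using h (-f))

theorem weightedNorm_sub_le {p : ℝ≥0∞} (hp : 1 ≤ p) (a : ℕ) (f g : 𝓢'(Space N, ℂ)) :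
    weightedNorm p a (f - g) ≤ weightedNorm p a f + weightedNorm p a g := by
  rw [sub_eq_add_neg, ← weightedNorm_neg p a g]
  exact weightedNorm_add_le hp a f (-g)

theorem weightedNorm_sum_le {ι : Type*} {p : ℝ≥0∞} (hp : 1 ≤ p) (a : ℕ) (s : Finset ι)
    (f : ι → 𝓢'(Space N, ℂ)) :
    weightedNorm p a (∑ i ∈ s, f i) ≤ ∑ i ∈ s, weightedNorm p a (f i) := by
  classical
  induction s using Finset.induction_on with
  | empty => simp [weightedNorm_zero]
  | insert i s hi ih =>
    rw [Finset.sum_insert hi, Finset.sum_insert hi]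
    exact (weightedNorm_add_le hp a _ _).trans (add_le_add le_rfl ih)

theorem weightedNorm_mono (p : ℝ≥0∞) {a b : ℕ} (hab : a ≤ b) (f : 𝓢'(Space N, ℂ)) :
    weightedNorm p a f ≤ weightedNorm p b f := by
  rcases weightedNorm_cases p b f with h | ⟨f, rfl⟩
  · simp [h]
  rw [weightedNorm_coe, weightedNorm_coe]
  refine eLpNorm_mono_enorm fun x => ?_
  rw [enorm_mul, enorm_mul]
  gcongr
  rw [enorm_le_iff_norm_le, Complex.norm_real, Complex.norm_real, Real.norm_of_nonneg
    (by have := bracket_pos x; positivity), Real.norm_of_nonneg (by have := bracket_pos x; positivity)]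
  exact pow_le_pow_right₀ (one_le_bracket x) hab

theorem weightedNorm_Xc_le (a : ℕ) (i : Fin N) (f : 𝓢'(Space N, ℂ)) :
    weightedNorm 2 a (Xc i f) ≤ weightedNorm 2 (a + 1) f := by
  by_cases h : weightedNorm 2 (a + 1) f = ∞
  · simp [h]
  obtain ⟨g, rfl⟩ := exists_of_weightedNorm_lt_top (lt_top_iff_ne_top.mpr h)
  have hle : ∀ x, ‖((bracket x ^ a : ℝ) : ℂ) * (((inner ℝ x (e i) : ℝ) : ℂ) * g x)‖ ≤
      ‖((bracket x ^ (a + 1) : ℝ) : ℂ) * g x‖ := fun x => by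
    have h1 := bracket_pos x
    have h2 := abs_coord_le_bracket x i
    rw [inner_e]
    simp only [norm_mul, Complex.norm_real, Real.norm_eq_abs, abs_pow, abs_of_pos h1]
    rw [pow_succ, ← mul_assoc]
    gcongr
  have hle0 : ∀ x, ‖((inner ℝ x (e i) : ℝ) : ℂ) * g x‖ ≤
      ‖((bracket x ^ (a + 1) : ℝ) : ℂ) * g x‖ := fun x => by
    refine le_trans ?_ (hle x)
    rw [norm_mul ((bracket x ^ a : ℝ) : ℂ)]
    refine le_mul_of_one_le_left (norm_nonneg _) ?_
    rw [Complex.norm_real, Real.norm_of_nonneg (by have := bracket_pos x; positivity)]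
    exact one_le_pow₀ (one_le_bracket x)
  rw [weightedNorm_coe] at h ⊢
  have hm : MemLp (fun x => ((inner ℝ x (e i) : ℝ) : ℂ) * g x) 2 volume :=
    MemLp.mono (⟨aesm_weight (a + 1) g, lt_top_iff_ne_top.mpr h⟩)
      ((Continuous.aestronglyMeasurable (by fun_prop)).mul (Lp.aestronglyMeasurable g))
      (Eventually.of_forall hle0)
  rw [Xc, smulLeft_toTD (by fun_prop) hm, weightedNorm_coe]
  refine eLpNorm_mono_ae ?_
  filter_upwards [hm.coeFn_toLp] with x hx
  rw [hx]
  exact hle x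

/-- When the right side is finite, each distribution `(Xc i)^[a] f` is an L² function and must be
the pointwise product, so `bracket_pow_le_sum` applies under the norm. This is the passage from
brackets to coordinates used throughout. -/
theorem weightedNorm_le_coord (p : ℝ≥0∞) (hp : 1 ≤ p) (a : ℕ) (f : 𝓢'(Space N, ℂ)) :
    weightedNorm p a f ≤ ENNReal.ofReal (((N : ℝ) + 1) ^ a) *
      (weightedNorm p 0 f + ∑ i, weightedNorm p 0 ((Xc i)^[a] f)) := by
  have hC : ENNReal.ofReal (((N : ℝ) + 1) ^ a) ≠ 0 := by
    simp only [ne_eq, ENNReal.ofReal_eq_zero, not_le]; positivity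
  rcases weightedNorm_cases p 0 f with h | ⟨f, rfl⟩
  · simp [h, ENNReal.mul_top hC]
  by_cases hi : ∃ i, weightedNorm p 0 ((Xc i)^[a] (f : 𝓢'(Space N, ℂ))) = ∞
  · obtain ⟨i, hi⟩ := hi
    have : ∑ i, weightedNorm p 0 ((Xc i)^[a] (f : 𝓢'(Space N, ℂ))) = ∞ :=
      ENNReal.sum_eq_top.mpr ⟨i, Finset.mem_univ _, hi⟩
    rw [this, add_top, ENNReal.mul_top hC]
    exact le_top
  push Not at hi
  have hex : ∀ i, ∃ h : L2 N, (h : 𝓢'(Space N, ℂ)) = (Xc i)^[a] (f : 𝓢'(Space N, ℂ)) := fun i =>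
    exists_of_weightedNorm_lt_top (lt_top_iff_ne_top.mpr (hi i))
  choose h hh using hex
  have hae : ∀ i, h i =ᵐ[volume] fun x => ((inner ℝ x (e i) : ℝ) : ℂ) ^ a * f x := fun i =>
    ae_eq_of_smulLeft (by fun_prop) (by rw [← Xc_iterate, hh])
  simp only [← hh, weightedNorm_coe, pow_zero, Complex.ofReal_one, one_mul]
  have hm : ∀ i ∈ Finset.univ, AEStronglyMeasurable (fun x => ‖h i x‖) volume := fun i _ =>
    (Lp.aestronglyMeasurable (h i)).norm
  calc eLpNorm (fun x => ((bracket x ^ a : ℝ) : ℂ) * f x) p volume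
      ≤ ENNReal.ofReal (((N : ℝ) + 1) ^ a) *
        eLpNorm ((fun x => ‖f x‖) + ∑ i, fun x => ‖h i x‖) p volume := by
        refine eLpNorm_le_mul_eLpNorm_of_ae_le_mul ?_ p
        filter_upwards [ae_all_iff.mpr hae] with x hx
        rw [Real.norm_of_nonneg (by simp only [Pi.add_apply, Finset.sum_apply]; positivity)]
        simp only [Pi.add_apply, Finset.sum_apply, hx, norm_mul, norm_pow, Complex.norm_real,
          Real.norm_eq_abs, inner_e, abs_of_pos (bracket_pos x)]
        rw [← Finset.sum_mul]
        have := bracket_pow_le_sum a x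
        calc bracket x ^ a * ‖f x‖ ≤ ((N : ℝ) + 1) ^ a * (1 + ∑ i, |x i| ^ a) * ‖f x‖ := by gcongr
          _ = _ := by ring
    _ ≤ _ := by
        gcongr
        refine (eLpNorm_add_le (Lp.aestronglyMeasurable f).norm
          (Finset.aestronglyMeasurable_sum _ hm) hp).trans ?_
        refine add_le_add (le_of_eq (eLpNorm_norm _)) ((eLpNorm_sum_le hm hp).trans (le_of_eq ?_))
        simp only [eLpNorm_norm]

end NLS

end

noncomputable section

namespace NLS

open LineDeriv FourierTransform

variable {N : ℕ}

/-! ### The free Schrödinger group -/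

theorem hasTemperateGrowth_cexp_I_mul :
    (fun s : ℝ => Complex.exp (Complex.I * s)).HasTemperateGrowth := by
  have hd : ∀ n : ℕ, iteratedDeriv n (fun s : ℝ => Complex.exp (Complex.I * s)) =
      fun s : ℝ => Complex.I ^ n * Complex.exp (Complex.I * s) := by
    intro n
    induction n with
    | zero => simp
    | succ n ih =>
      rw [iteratedDeriv_succ, ih]
      ext s
      have h1 : HasDerivAt (fun s : ℝ => Complex.I * (s : ℂ)) Complex.I s := by
        simpa using (Complex.ofRealCLM.hasDerivAt (x := s)).const_mul Complex.I
      have h2 := (h1.cexp.const_mul (Complex.I ^ n)).deriv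
      rw [h2]; ring
  refine ⟨?_, fun n => ⟨0, 1, fun s => ?_⟩⟩
  · exact Complex.contDiff_exp.comp (contDiff_const.mul Complex.ofRealCLM.contDiff)
  · rw [norm_iteratedFDeriv_eq_norm_iteratedDeriv, hd]
    simp [mul_comm Complex.I, Complex.norm_exp_ofReal_mul_I]

/-- The symbol of the Schrödinger group `e^{itΔ}`. -/
def symb (t : ℝ) (ξ : Space N) : ℂ :=
  Complex.exp (Complex.I * ((-(t * ((2 * Real.pi) ^ 2 * ‖ξ‖ ^ 2)) : ℝ) : ℂ))

theorem symb_hasTemperateGrowth (t : ℝ) : (symb t : Space N → ℂ).HasTemperateGrowth := by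
  have h : (fun ξ : Space N => -(t * ((2 * Real.pi) ^ 2 * ‖ξ‖ ^ 2))).HasTemperateGrowth := by
    have h1 := (Function.HasTemperateGrowth.const (E := Space N) (-(t * (2 * Real.pi) ^ 2))).mul
      (Function.hasTemperateGrowth_norm_sq (Space N))
    have h2 : (fun ξ : Space N => -(t * ((2 * Real.pi) ^ 2 * ‖ξ‖ ^ 2))) =
        (fun _ => -(t * (2 * Real.pi) ^ 2)) * fun ξ : Space N => ‖ξ‖ ^ 2 := by
      ext ξ
      simp only [Pi.mul_apply]
      ring
    rw [h2]
    exact h1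
  exact hasTemperateGrowth_cexp_I_mul.comp h

theorem norm_symb (t : ℝ) (ξ : Space N) : ‖symb t ξ‖ = 1 := by
  rw [symb, mul_comm, Complex.norm_exp_ofReal_mul_I]

theorem symb_mul (s t : ℝ) : (symb s * symb t : Space N → ℂ) = symb (s + t) := by
  ext ξ
  simp only [symb, Pi.mul_apply, ← Complex.exp_add]
  congr 1
  push_cast
  ring

theorem symb_zero : (symb 0 : Space N → ℂ) = fun _ => 1 := by
  ext ξ; simp [symb]

/-- The Schrödinger group on tempered distributions. -/
def UV (t : ℝ) : 𝓢'(Space N, ℂ) →L[ℂ] 𝓢'(Space N, ℂ) := fourierMultiplierCLM ℂ (symb t)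

theorem UV_UV (s t : ℝ) (f : 𝓢'(Space N, ℂ)) : UV s (UV t f) = UV (s + t) f := by
  rw [UV, UV, fourierMultiplierCLM_fourierMultiplierCLM_apply (symb_hasTemperateGrowth _)
    (symb_hasTemperateGrowth _), symb_mul, add_comm, UV]

theorem UV_zero (f : 𝓢'(Space N, ℂ)) : UV 0 f = f := by
  rw [UV, symb_zero, fourierMultiplierCLM_const, one_smul, ContinuousLinearMap.id_apply]

theorem UV_lineDeriv (t : ℝ) (v : Space N) (f : 𝓢'(Space N, ℂ)) :
    UV t (∂_{v} f) = ∂_{v} (UV t f) := by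
  simp only [lineDeriv_eq_fourierMultiplierCLM, map_smul, UV]
  rw [fourierMultiplierCLM_fourierMultiplierCLM_apply (by fun_prop) (symb_hasTemperateGrowth _),
    fourierMultiplierCLM_fourierMultiplierCLM_apply (symb_hasTemperateGrowth _) (by fun_prop),
    mul_comm (symb t)]

theorem UV_dl (t : ℝ) (l : List (Fin N)) (f : 𝓢'(Space N, ℂ)) : UV t (dl l f) = dl l (UV t f) := by
  induction l with
  | nil => rfl
  | cons i l ih => rw [dl_cons, dl_cons, UV_lineDeriv, ih]

theorem UV_laplacian (t : ℝ) (f : 𝓢'(Space N, ℂ)) : UV t (Δ f) = Δ (UV t f) := by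
  simp only [laplacian_eq_sum_e, map_sum, UV_lineDeriv]

theorem fderiv_symb (t : ℝ) (i : Fin N) (ξ : Space N) :
    fderiv ℝ (symb t) ξ (e i) =
      (-(2 * Complex.I * t * (2 * Real.pi) ^ 2)) * (((inner ℝ ξ (e i) : ℝ) : ℂ) * symb t ξ) := by
  have h1 : HasFDerivAt (fun ξ : Space N => ‖ξ‖ ^ 2) (2 • innerSL ℝ ξ) ξ :=
    (hasStrictFDerivAt_norm_sq ξ).hasFDerivAt
  have h2 := (Complex.ofRealCLM.hasFDerivAt (x := -(t * ((2 * Real.pi) ^ 2 * ‖ξ‖ ^ 2)))).comp ξ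
    ((h1.const_mul ((2 * Real.pi) ^ 2)).const_mul t).neg
  have h3 := (h2.const_mul Complex.I).cexp
  have h4 : HasFDerivAt (symb t) _ ξ := h3
  rw [h4.fderiv]
  have : innerSL ℝ ξ (e i) = inner ℝ ξ (e i) := rfl
  simp only [_root_.smul_apply, ContinuousLinearMap.comp_apply, neg_apply, this, Function.comp,
    Complex.ofRealCLM_apply, smul_eq_mul, symb, Pi.neg_apply]
  push_cast
  simp only [nsmul_eq_mul]
  push_cast
  ring

/-- On the Fourier side a coordinate acts as a derivative; falling on the symbol it brings down a
multiple of tξ_i, that is, t times a derivative of `f`. This is the commutation of the group with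
the Galilean operators. -/
theorem Xc_UV (t : ℝ) (i : Fin N) (f : 𝓢'(Space N, ℂ)) :
    Xc i (UV t f) = UV t (Xc i f) - (2 * Complex.I * t) • UV t (∂_{e i} f) := by
  have hpi : (2 * Real.pi * Complex.I : ℂ) ≠ 0 := Complex.two_pi_I_ne_zero
  have hd : (fun ξ : Space N => fderiv ℝ (symb t) ξ (e i)) =
      (-(2 * Complex.I * t * (2 * Real.pi) ^ 2)) •
        ((fun ξ : Space N => ((inner ℝ ξ (e i) : ℝ) : ℂ)) * symb t) := by
    ext ξ
    rw [fderiv_symb]; simp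
  have hs := symb_hasTemperateGrowth (N := N) t
  have hX := coord_hasTemperateGrowth i
  have hXs := hX.mul hs
  have hd' : (fun ξ : Space N => fderiv ℝ (symb t) ξ (e i)).HasTemperateGrowth := by
    rw [hd]; exact (Function.HasTemperateGrowth.const _).mul hXs
  -- The factor -2πi is the one in the inverse Fourier transform of a derivative; it is cancelled at
  -- the end.
  have key : -(2 * Real.pi * Complex.I : ℂ) • Xc i (UV t f) =
      -(2 * Real.pi * Complex.I : ℂ) • (UV t (Xc i f) - (2 * Complex.I * t) • UV t (∂_{e i} f)) := by
    have h1 := fourierInv_lineDerivOp_eq (smulLeftCLM ℂ (symb t) (𝓕 f)) (e i)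
    rw [Xc, UV, fourierMultiplierCLM_apply, ← h1, lineDeriv_smulLeft hs hd', hd,
      smulLeftCLM_smul hXs, _root_.smul_apply, ← smulLeftCLM_smulLeftCLM_apply hX hs]
    have h2 := fourier_lineDerivOp_eq f (e i)
    have h3 : smulLeftCLM ℂ (fun ξ : Space N => ((inner ℝ ξ (e i) : ℝ) : ℂ)) (𝓕 f) =
        (2 * Real.pi * Complex.I : ℂ)⁻¹ • 𝓕 (∂_{e i} f) := by
      rw [h2, smul_smul, inv_mul_cancel₀ hpi, one_smul]
    rw [h3, lineDerivOp_fourier_eq, FourierTransform.fourierInv_add,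
      FourierTransform.fourierInv_smul, map_smul, FourierTransform.fourierInv_smul,
      FourierTransform.fourier_smul, map_smul, FourierTransform.fourierInv_smul, smul_sub,
      smul_smul, smul_smul, ← fourierMultiplierCLM_apply, ← fourierMultiplierCLM_apply,
      add_comm, sub_eq_add_neg]
    congr 1
    rw [← neg_smul]
    congr 1
    field_simp
    ring_nf
    simp
  exact smul_right_injective _ (neg_ne_zero.mpr hpi) key

/-! ### Fourier multipliers on `L²` -/

theorem fourierMultiplier_toTD {w : Space N → ℂ} (hw : w.HasTemperateGrowth) {u : L2 N}
    (h : MemLp (fun ξ => w ξ * (𝓕 u : L2 N) ξ) 2 volume) :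
    fourierMultiplierCLM ℂ w (u : 𝓢'(Space N, ℂ)) = (𝓕⁻ (h.toLp _ : L2 N) : L2 N) := by
  rw [fourierMultiplierCLM_apply, Lp.fourier_toTemperedDistribution_eq, smulLeft_toTD hw h,
    Lp.fourierInv_toTemperedDistribution_eq]

theorem norm_fourierInv_eq (u : L2 N) : ‖(𝓕⁻ u : L2 N)‖ = ‖u‖ :=
  (Lp.fourierTransformₗᵢ (Space N) ℂ).symm.norm_map u

theorem weightedNorm_fourierMultiplier {w : Space N → ℂ} (hw : w.HasTemperateGrowth) {u : L2 N}
    (h : MemLp (fun ξ => w ξ * (𝓕 u : L2 N) ξ) 2 volume) :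
    weightedNorm 2 0 (fourierMultiplierCLM ℂ w (u : 𝓢'(Space N, ℂ))) =
      eLpNorm (fun ξ => w ξ * (𝓕 u : L2 N) ξ) 2 volume := by
  rw [fourierMultiplier_toTD hw h, weightedNorm_two_zero, ← ofReal_norm, norm_fourierInv_eq,
    ofReal_norm, Lp.enorm_def]
  exact eLpNorm_congr_ae h.coeFn_toLp

theorem memLp_symb_mul (t : ℝ) (u : L2 N) :
    MemLp (fun ξ => symb t ξ * u ξ) 2 volume := by
  refine (Lp.memLp u).of_le ?_ (Eventually.of_forall fun ξ => ?_)
  · exact (symb_hasTemperateGrowth t).1.continuous.aestronglyMeasurable.mul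
      (Lp.aestronglyMeasurable u)
  · simp [norm_symb]

/-- Plancherel, as the symbol has modulus one. -/
theorem exists_UV_toTD (t : ℝ) (u : L2 N) :
    ∃ h : L2 N, (h : 𝓢'(Space N, ℂ)) = UV t u ∧ ‖h‖ = ‖u‖ := by
  refine ⟨_, (fourierMultiplier_toTD (symb_hasTemperateGrowth t)
    (memLp_symb_mul t (𝓕 u : L2 N))).symm, ?_⟩
  rw [norm_fourierInv_eq, ← Lp.norm_fourier_eq u, Lp.norm_toLp, Lp.norm_def]
  congr 1
  refine eLpNorm_congr_norm_ae (Eventually.of_forall fun ξ => ?_)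
  simp [norm_symb]

/-- The Schrödinger group on `L²`. -/
def U (t : ℝ) : L2 N →ₗᵢ[ℂ] L2 N where
  toFun u := (exists_UV_toTD t u).choose
  map_add' u v := by
    apply toTD_inj
    refine (exists_UV_toTD t (u + v)).choose_spec.1.trans ?_
    rw [toTD_add, toTD_add, (exists_UV_toTD t u).choose_spec.1,
      (exists_UV_toTD t v).choose_spec.1, map_add]
  map_smul' c u := by
    apply toTD_inj
    refine (exists_UV_toTD t (c • u)).choose_spec.1.trans ?_
    rw [RingHom.id_apply, toTD_smul, toTD_smul, (exists_UV_toTD t u).choose_spec.1, map_smul]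
  norm_map' u := (exists_UV_toTD t u).choose_spec.2

theorem U_toTD (t : ℝ) (u : L2 N) : ((U t u : L2 N) : 𝓢'(Space N, ℂ)) = UV t u :=
  (exists_UV_toTD t u).choose_spec.1

theorem L2_coe_smul (r : ℝ) (u : L2 N) : (r : ℂ) • u = r • u := by
  ext1
  filter_upwards [Lp.coeFn_smul (r : ℂ) u, Lp.coeFn_smul r u] with x h1 h2
  rw [h1, h2]
  simp

theorem U_real_smul (t r : ℝ) (u : L2 N) : U t (r • u) = r • U t u :=
  (U t).toLinearMap.map_smul_of_tower r u

theorem U_U (s t : ℝ) (u : L2 N) : U s (U t u) = U (s + t) u := by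
  apply toTD_inj
  simp only [U_toTD, UV_UV]

theorem U_zero (u : L2 N) : U 0 u = u := by
  apply toTD_inj
  rw [U_toTD, UV_zero]

/-- Dominated convergence for Fourier multipliers. -/
theorem tendsto_fourierMultiplier {l : Filter ℝ} [l.IsCountablyGenerated]
    {w : ℝ → Space N → ℂ} (hw : ∀ h, (w h).HasTemperateGrowth) {B : Space N → ℂ} {u : L2 N}
    (hB : MemLp (fun ξ => B ξ * (𝓕 u : L2 N) ξ) 2 volume)
    (hle : ∀ᶠ h in l, ∀ ξ, ‖w h ξ‖ ≤ ‖B ξ‖)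
    (hlim : ∀ ξ, Tendsto (fun h => w h ξ) l (𝓝 0)) :
    Tendsto (fun h => weightedNorm 2 0 (fourierMultiplierCLM ℂ (w h) (u : 𝓢'(Space N, ℂ)))) l
      (𝓝 0) := by
  have hm : ∀ h, AEStronglyMeasurable (fun ξ => w h ξ * (𝓕 u : L2 N) ξ) volume := fun h =>
    (hw h).1.continuous.aestronglyMeasurable.mul (Lp.aestronglyMeasurable _)
  have hle' : ∀ᶠ h in l, ∀ ξ, ‖w h ξ * (𝓕 u : L2 N) ξ‖ ≤ ‖B ξ * (𝓕 u : L2 N) ξ‖ := by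
    filter_upwards [hle] with h hh ξ
    rw [norm_mul, norm_mul]
    gcongr
    exact hh ξ
  have hev : ∀ᶠ h in l, weightedNorm 2 0 (fourierMultiplierCLM ℂ (w h) (u : 𝓢'(Space N, ℂ))) =
      (∫⁻ ξ, ‖w h ξ * (𝓕 u : L2 N) ξ‖ₑ ^ (2 : ℝ)) ^ (1 / 2 : ℝ) := by
    filter_upwards [hle'] with h hh
    rw [weightedNorm_fourierMultiplier (hw h) (hB.of_le (hm h) (Eventually.of_forall hh)),
      eLpNorm_eq_lintegral_rpow_enorm_toReal (by norm_num) (by norm_num)]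
    simp
  rw [tendsto_congr' hev]
  have h0 : Tendsto (fun h => ∫⁻ ξ, ‖w h ξ * (𝓕 u : L2 N) ξ‖ₑ ^ (2 : ℝ)) l
      (𝓝 (∫⁻ _ξ : Space N, 0)) := by
    refine tendsto_lintegral_filter_of_dominated_convergence'
      (fun ξ => ‖B ξ * (𝓕 u : L2 N) ξ‖ₑ ^ (2 : ℝ)) (Eventually.of_forall fun h => ?_) ?_ ?_ ?_
    · exact (hm h).enorm.pow_const _
    · filter_upwards [hle'] with h hh
      refine Eventually.of_forall fun ξ => ?_
      gcongr
      rw [enorm_le_iff_norm_le]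
      exact hh ξ
    · have := hB.2
      rw [eLpNorm_lt_top_iff_lintegral_rpow_enorm_lt_top (by norm_num) (by norm_num)] at this
      simpa using this.ne
    · refine Eventually.of_forall fun ξ => ?_
      have h1 : Tendsto (fun h => w h ξ * (𝓕 u : L2 N) ξ) l (𝓝 0) := by
        simpa using (hlim ξ).mul_const ((𝓕 u : L2 N) ξ)
      have h2 := (ENNReal.continuous_rpow_const (y := 2)).tendsto _ |>.comp h1.enorm
      simpa [Function.comp_def] using h2
  have := (ENNReal.continuous_rpow_const (y := 1 / 2)).tendsto _ |>.comp h0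
  simpa [Function.comp_def] using this

theorem tendsto_of_weightedNorm {ι : Type*} {l : Filter ι} {f : ι → L2 N} {g : L2 N}
    (h : Tendsto (fun i => weightedNorm 2 0 ((f i : 𝓢'(Space N, ℂ)) - (g : 𝓢'(Space N, ℂ)))) l (𝓝 0)) :
    Tendsto f l (𝓝 g) := by
  rw [tendsto_iff_edist_tendsto_0]
  refine h.congr fun i => ?_
  rw [← toTD_sub, weightedNorm_two_zero, edist_eq_enorm_sub]

theorem fourierMultiplier_sub {g₁ g₂ : Space N → ℂ} (h₁ : g₁.HasTemperateGrowth)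
    (h₂ : g₂.HasTemperateGrowth) (f : 𝓢'(Space N, ℂ)) :
    fourierMultiplierCLM ℂ (fun ξ => g₁ ξ - g₂ ξ) f =
      fourierMultiplierCLM ℂ g₁ f - fourierMultiplierCLM ℂ g₂ f := by
  have : (fun ξ => g₁ ξ - g₂ ξ) = g₁ - g₂ := rfl
  simp only [fourierMultiplierCLM_apply, this, smulLeftCLM_sub h₁ h₂, _root_.sub_apply]
  exact map_sub (FourierTransform.fourierInvCLM ℂ 𝓢'(Space N, ℂ)) _ _

theorem continuousAt_symb (ξ : Space N) : Continuous (fun t => symb t ξ) := by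
  unfold symb; fun_prop

theorem tendsto_UV_sub (u : L2 N) :
    Tendsto (fun h => weightedNorm 2 0 (UV h (u : 𝓢'(Space N, ℂ)) - (u : 𝓢'(Space N, ℂ)))) (𝓝 0) (𝓝 0) := by
  have := tendsto_fourierMultiplier (l := 𝓝 (0 : ℝ)) (w := fun h ξ => symb h ξ - 1)
    (fun h => (symb_hasTemperateGrowth h).sub (Function.HasTemperateGrowth.const 1))
    (B := fun _ => 2) (u := u) ((Lp.memLp _).const_mul 2)
    (Eventually.of_forall fun h ξ => by
      refine (norm_sub_le _ _).trans ?_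
      rw [norm_symb]; norm_num)
    (fun ξ => by
      have := ((continuousAt_symb ξ).tendsto 0).sub_const 1
      simpa [symb_zero] using this)
  refine this.congr fun h => ?_
  rw [fourierMultiplier_sub (symb_hasTemperateGrowth h) (Function.HasTemperateGrowth.const 1),
    fourierMultiplierCLM_const, one_smul]
  rfl

theorem continuous_U (u : L2 N) : Continuous (fun t => U t u) := by
  have h0 : Tendsto (fun h => U h u) (𝓝 0) (𝓝 u) := by
    refine tendsto_of_weightedNorm ?_
    simpa only [U_toTD] using tendsto_UV_sub u
  rw [continuous_iff_continuousAt]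
  intro t
  have h1 : Tendsto (fun s => U t (U (s - t) u)) (𝓝 t) (𝓝 (U t u)) := by
    refine ((U t).continuous.tendsto u).comp (h0.comp ?_)
    exact tendsto_sub_nhds_zero_iff.mpr tendsto_id
  refine h1.congr fun s => ?_
  rw [U_U]; congr 2; ring

/-- Strong continuity upgrades to joint continuity because the operators are isometries: replacing
`y i` by `y₀` costs exactly the norm of the difference, whatever `τ i` is. -/
theorem tendsto_U_apply {ι : Type*} {l : Filter ι} {τ : ι → ℝ} {y : ι → L2 N} {t : ℝ} {y₀ : L2 N}
    (hτ : Tendsto τ l (𝓝 t)) (hy : Tendsto y l (𝓝 y₀)) :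
    Tendsto (fun i => U (τ i) (y i)) l (𝓝 (U t y₀)) := by
  have h1 : Tendsto (fun i => U (τ i) (y i - y₀)) l (𝓝 0) := by
    rw [tendsto_zero_iff_norm_tendsto_zero]
    simpa only [LinearIsometry.norm_map] using
      tendsto_zero_iff_norm_tendsto_zero.mp (tendsto_sub_nhds_zero_iff.mpr hy)
  have h2 := h1.add (((continuous_U y₀).tendsto t).comp hτ)
  rw [zero_add] at h2
  refine h2.congr fun i => ?_
  simp [map_sub]

theorem continuous_U_apply {X : Type*} [TopologicalSpace X] {τ : X → ℝ} {y : X → L2 N}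
    (hτ : Continuous τ) (hy : Continuous y) : Continuous (fun x => U (τ x) (y x)) :=
  continuous_iff_continuousAt.mpr fun x => tendsto_U_apply (hτ.tendsto x) (hy.tendsto x)

theorem norm_sq_hasTemperateGrowth :
    (fun ξ : Space N => ((‖ξ‖ ^ 2 : ℝ) : ℂ)).HasTemperateGrowth := by fun_prop

/-- Dominated convergence for the symbol of the difference quotient minus its limit. The majorant is
twice 4π²|ξ|², admissible because |ξ|² times the transform of `u` is in L² when the Laplacian of `u`
is. -/
theorem hasDerivAt_U_zero {u lap : L2 N} (hlap : (lap : 𝓢'(Space N, ℂ)) = Δ (u : 𝓢'(Space N, ℂ))) :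
    HasDerivAt (fun t => U t u) (Complex.I • lap) 0 := by
  rw [hasDerivAt_iff_tendsto_slope_zero]
  set c : ℂ := (((2 * Real.pi) ^ 2 : ℝ) : ℂ) with hc
  have hq := norm_sq_hasTemperateGrowth (N := N)
  have hlap' : (lap : 𝓢'(Space N, ℂ)) = fourierMultiplierCLM ℂ
      (fun ξ : Space N => -c * ((‖ξ‖ ^ 2 : ℝ) : ℂ)) (u : 𝓢'(Space N, ℂ)) := by
    rw [hlap, laplacian_eq_fourierMultiplierCLM]
    have : (fun ξ : Space N => -c * ((‖ξ‖ ^ 2 : ℝ) : ℂ)) = (-c) • fun ξ : Space N =>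
      ((‖ξ‖ ^ 2 : ℝ) : ℂ) := rfl
    rw [this, fourierMultiplierCLM_smul hq, _root_.smul_apply, hc]
    ext ψ
    simp
  have hcq : (fun ξ : Space N => -c * ((‖ξ‖ ^ 2 : ℝ) : ℂ)).HasTemperateGrowth :=
    (Function.HasTemperateGrowth.const _).mul hq
  have hae : (𝓕 lap : L2 N) =ᵐ[volume] fun ξ => -c * ((‖ξ‖ ^ 2 : ℝ) : ℂ) * (𝓕 u : L2 N) ξ := by
    refine ae_eq_of_smulLeft hcq ?_
    rw [← Lp.fourier_toTemperedDistribution_eq, ← Lp.fourier_toTemperedDistribution_eq, hlap',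
      fourierMultiplierCLM_apply, FourierTransform.fourier_fourierInv_eq]
  have hB : MemLp (fun ξ : Space N => 2 * (c * ((‖ξ‖ ^ 2 : ℝ) : ℂ)) * (𝓕 u : L2 N) ξ) 2 volume := by
    have h1 : MemLp (fun ξ : Space N => -c * ((‖ξ‖ ^ 2 : ℝ) : ℂ) * (𝓕 u : L2 N) ξ) 2 volume :=
      (memLp_congr_ae hae).mp (Lp.memLp _)
    convert h1.const_mul (-2) using 1
    ext ξ
    ring
  have hw : ∀ h : ℝ, (fun ξ : Space N => (h : ℂ)⁻¹ * (symb h ξ - 1) -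
      Complex.I * (-c * ((‖ξ‖ ^ 2 : ℝ) : ℂ))).HasTemperateGrowth := fun h =>
    ((Function.HasTemperateGrowth.const _).mul ((symb_hasTemperateGrowth h).sub
      (Function.HasTemperateGrowth.const 1))).sub ((Function.HasTemperateGrowth.const _).mul hcq)
  have key := tendsto_fourierMultiplier (l := 𝓝[≠] (0 : ℝ)) hw hB
    (eventually_mem_nhdsWithin.mono fun h hh ξ => by
      have hh0 : h ≠ 0 := hh
      refine (norm_sub_le _ _).trans ?_
      -- From |e^{iθ} - 1| ≤ |θ|, hence uniformly in `h`.
      have h1 : ‖(h : ℂ)⁻¹ * (symb h ξ - 1)‖ ≤ ‖c * ((‖ξ‖ ^ 2 : ℝ) : ℂ)‖ := by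
        rw [norm_mul, norm_inv, inv_mul_le_iff₀ (by simpa using hh0), symb]
        refine Real.norm_exp_I_mul_ofReal_sub_one_le.trans (le_of_eq ?_)
        rw [hc, norm_neg, norm_mul, ← Complex.ofReal_mul, Complex.norm_real, Complex.norm_real]
      have h2 : ‖Complex.I * (-c * ((‖ξ‖ ^ 2 : ℝ) : ℂ))‖ = ‖c * ((‖ξ‖ ^ 2 : ℝ) : ℂ)‖ := by simp
      rw [h2, norm_mul 2]
      norm_num at h1 ⊢
      linarith)
    (fun ξ => by
      have hd : HasDerivAt (fun t : ℝ => symb t ξ) (Complex.I * (-c * ((‖ξ‖ ^ 2 : ℝ) : ℂ))) 0 := by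
        have h1 : HasDerivAt (fun t : ℝ => Complex.I * ((-(t * ((2 * Real.pi) ^ 2 * ‖ξ‖ ^ 2)) : ℝ) : ℂ))
            (Complex.I * ((-(1 * ((2 * Real.pi) ^ 2 * ‖ξ‖ ^ 2)) : ℝ) : ℂ)) 0 :=
          (((hasDerivAt_id (0 : ℝ)).mul_const _).neg.ofReal_comp).const_mul _
        have h2 : HasDerivAt (fun t : ℝ => symb t ξ) _ 0 := h1.cexp
        convert h2 using 1
        simp [hc]
      rw [hasDerivAt_iff_tendsto_slope_zero] at hd
      have h3 := hd.sub_const (Complex.I * (-c * ((‖ξ‖ ^ 2 : ℝ) : ℂ)))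
      rw [sub_self] at h3
      refine h3.congr fun h => ?_
      simp [symb_zero])
  refine tendsto_of_weightedNorm (key.congr fun h => ?_)
  congr 1
  have hA : (fun ξ : Space N => (h : ℂ)⁻¹ * (symb h ξ - 1)).HasTemperateGrowth :=
    (Function.HasTemperateGrowth.const _).mul ((symb_hasTemperateGrowth h).sub
      (Function.HasTemperateGrowth.const 1))
  have hA' : (fun ξ : Space N => symb h ξ - 1).HasTemperateGrowth :=
    (symb_hasTemperateGrowth h).sub (Function.HasTemperateGrowth.const 1)
  have hB' : (fun ξ : Space N => Complex.I * (-c * ((‖ξ‖ ^ 2 : ℝ) : ℂ))).HasTemperateGrowth :=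
    (Function.HasTemperateGrowth.const _).mul hcq
  rw [fourierMultiplier_sub hA hB']
  have e1 : (fun ξ : Space N => (h : ℂ)⁻¹ * (symb h ξ - 1)) = (h : ℂ)⁻¹ • fun ξ : Space N =>
    (symb h ξ - 1) := rfl
  have e2 : (fun ξ : Space N => Complex.I * (-c * ((‖ξ‖ ^ 2 : ℝ) : ℂ))) = Complex.I •
    fun ξ : Space N => (-c * ((‖ξ‖ ^ 2 : ℝ) : ℂ)) := rfl
  rw [e1, e2, fourierMultiplierCLM_smul hA', fourierMultiplierCLM_smul hcq, _root_.smul_apply,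
    _root_.smul_apply, ← hlap', toTD_smul, zero_add, U_zero,
    fourierMultiplier_sub (symb_hasTemperateGrowth h) (Function.HasTemperateGrowth.const 1),
    fourierMultiplierCLM_const, one_smul]
  have e3 : (h⁻¹ • (U h u - u) : L2 N) = ((h : ℂ)⁻¹ : ℂ) • (U h u - u) := by
    rw [← Complex.ofReal_inv, L2_coe_smul]
  rw [e3, toTD_smul, toTD_sub, U_toTD]
  rfl

theorem hasDerivAt_U {u lap : L2 N} (hlap : (lap : 𝓢'(Space N, ℂ)) = Δ (u : 𝓢'(Space N, ℂ)))
    (t : ℝ) : HasDerivAt (fun t => U t u) (Complex.I • U t lap) t := by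
  have h1 : HasDerivAt (fun s => U (s - t) u) (Complex.I • lap) t := by
    have := hasDerivAt_U_zero hlap
    rw [← sub_self t] at this
    simpa using this.comp_sub_const t t
  have h2 := ((U t).toContinuousLinearMap.restrictScalars ℝ).hasFDerivAt.comp_hasDerivAt t h1
  have h3 : (⇑((U t : L2 N →ₗᵢ[ℂ] L2 N).toContinuousLinearMap.restrictScalars ℝ) ∘ fun s => U (s - t) u)
      = fun s => U s u := by
    ext1 s
    have : U t (U (s - t) u) = U s u := by rw [U_U]; congr 2; ring
    exact this
  rw [h3] at h2
  rw [← (U t).map_smul]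
  exact h2

/-- Product rule for a group that is only strongly continuous: the slope splits into `U τ` applied
to the slope of `z`, which converges by `tendsto_U_apply`, plus the slope of the group at the fixed
vector `z t`. -/
theorem HasDerivWithinAt.U_apply {z : ℝ → L2 N} {z' lap : L2 N} {s : Set ℝ} {t : ℝ}
    (hz : HasDerivWithinAt z z' s t)
    (hlap : (lap : 𝓢'(Space N, ℂ)) = Δ (z t : 𝓢'(Space N, ℂ))) :
    HasDerivWithinAt (fun τ => U τ (z τ)) (U t z' + Complex.I • U t lap) s t := by
  have h1 := (hasDerivAt_U hlap t).hasDerivWithinAt (s := s)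
  rw [hasDerivWithinAt_iff_tendsto_slope] at hz h1 ⊢
  have hid : Tendsto (fun τ : ℝ => τ) (𝓝[s \ {t}] t) (𝓝 t) := tendsto_nhdsWithin_of_tendsto_nhds tendsto_id
  have h2 := (tendsto_U_apply hid hz).add h1
  refine h2.congr fun τ => ?_
  simp only [slope, vsub_eq_sub]
  have : (U τ ((τ - t)⁻¹ • (z τ - z t)) : L2 N) = (τ - t)⁻¹ • (U τ (z τ) - U τ (z t)) := by
    rw [← map_sub, U_real_smul]
  rw [this, ← smul_add]
  congr 1
  abel

end NLS

end

noncomputable section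

namespace NLS

open LineDeriv FourierTransform

variable {N : ℕ}

/-! ### Lower semicontinuity of the weighted norms -/

/-- A bounded family in `L²` has a weak limit along every ultrafilter. -/
theorem exists_weak_limit {ι : Type*} (F : Ultrafilter ι) (g : ι → L2 N) {C : ℝ}
    (hC : ∀ᶠ i in F, ‖g i‖ ≤ C) :
    ∃ g₀ : L2 N, ∀ ℓ : L2 N →L[ℂ] ℂ, Tendsto (fun i => ℓ (g i)) F (𝓝 (ℓ g₀)) := by
  let T := InnerProductSpace.toDual ℂ (L2 N)
  let G : ι → WeakDual ℂ (L2 N) := fun i => StrongDual.toWeakDual (T (g i))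
  -- Banach–Alaoglu in the dual, transported by the Riesz map; this map is conjugate linear, whence
  -- the conjugations below.
  have hc := WeakDual.isCompact_closedBall (𝕜 := ℂ) (E := L2 N) 0 C
  obtain ⟨L, -, hL⟩ := hc.ultrafilter_le_nhds (F.map G) (by
    rw [le_principal_iff]
    refine Eventually.mono (p := fun i => ‖g i‖ ≤ C) hC fun i hi => ?_
    simpa [G] using hi)
  refine ⟨T.symm (WeakDual.toStrongDual L), fun ℓ => ?_⟩
  obtain ⟨w, rfl⟩ := T.surjective ℓ
  have h1 : Tendsto (fun i => G i w) F (𝓝 (L w)) :=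
    ((WeakDual.eval_continuous w).tendsto L).comp hL
  have h2 : ∀ u : L2 N, T w u = starRingEnd ℂ (T u w) := fun u => by
    simp only [T, InnerProductSpace.toDual_apply_apply]
    exact (inner_conj_symm _ _).symm
  have h3 : T w (T.symm (WeakDual.toStrongDual L)) = starRingEnd ℂ (L w) := by
    rw [h2, LinearIsometryEquiv.apply_symm_apply]
    rfl
  rw [h3]
  simp only [h2]
  exact (Complex.continuous_conj.tendsto _).comp h1

/-- The weighted norm with exponent `p` and weight `a` controls the `L²` norm. -/
def Controls (N : ℕ) (p : ℝ≥0∞) (a : ℕ) : Prop :=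
  ∃ C : ℝ≥0∞, C < ∞ ∧ ∀ f : 𝓢'(Space N, ℂ), weightedNorm 2 0 f ≤ C * weightedNorm p a f

theorem controls_two (a : ℕ) : Controls N 2 a :=
  ⟨1, by simp, fun f => by simpa using weightedNorm_mono 2 (Nat.zero_le a) f⟩

theorem memLp_bracket_rpow {r : ℝ} (hr : (N : ℝ) < 2 * r) :
    MemLp (fun x : Space N => bracket x ^ (-r)) 2 volume := by
  have hc : Continuous (fun x : Space N => bracket x ^ (-r)) :=
    continuous_bracket.rpow_const fun x => Or.inl (bracket_pos x).ne'
  rw [memLp_two_iff_integrable_sq hc.aestronglyMeasurable]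
  have h := integrable_rpow_neg_one_add_norm_sq (E := Space N) (μ := volume) (r := 2 * r)
    (by simpa using hr)
  refine h.congr (Eventually.of_forall fun x => ?_)
  have hb := bracket_pos x
  dsimp only
  rw [← bracket_sq, ← Real.rpow_natCast, ← Real.rpow_natCast, ← Real.rpow_mul hb.le,
    ← Real.rpow_mul hb.le]
  congr 1
  push_cast; ring

theorem bracket_rpow_neg_natCast (a : ℕ) (x : Space N) :
    bracket x ^ (-(a : ℝ)) = (bracket x ^ a)⁻¹ := by
  rw [Real.rpow_neg (bracket_pos x).le, Real.rpow_natCast]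

/-- Finite weighted sup norm as a pointwise bound. -/
theorem ae_le_of_weightedNorm_top {a : ℕ} {g : L2 N} {M : ℝ} (hM : 0 ≤ M)
    (h : weightedNorm ∞ a (g : 𝓢'(Space N, ℂ)) ≤ ENNReal.ofReal M) :
    ∀ᵐ x, bracket x ^ a * ‖g x‖ ≤ M := by
  rw [weightedNorm_coe, eLpNorm_exponent_top] at h
  filter_upwards [enorm_ae_le_eLpNormEssSup
    (fun x => ((bracket x ^ a : ℝ) : ℂ) * g x) (volume : Measure (Space N))] with x hx
  have h1 := hx.trans h
  rw [← ofReal_norm, ENNReal.ofReal_le_ofReal_iff hM, norm_mul, Complex.norm_real,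
    Real.norm_of_nonneg (by have := bracket_pos x; positivity)] at h1
  exact h1

theorem weightedNorm_top_le {a : ℕ} {g : L2 N} {M : ℝ}
    (h : ∀ᵐ x, bracket x ^ a * ‖g x‖ ≤ M) :
    weightedNorm ∞ a (g : 𝓢'(Space N, ℂ)) ≤ ENNReal.ofReal M := by
  rw [weightedNorm_coe, eLpNorm_exponent_top]
  refine eLpNormEssSup_le_of_ae_bound ?_
  filter_upwards [h] with x hx
  rwa [norm_mul, Complex.norm_real,
    Real.norm_of_nonneg (by have := bracket_pos x; positivity)]

/-- Because ⟨x⟩^{-a} is in L² exactly in this range. The added 1 in the constant keeps it nonzero,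
so that the case of an infinite right side is trivial. -/
theorem controls_top {a : ℕ} (ha : (N : ℝ) < 2 * a) : Controls N ∞ a := by
  refine ⟨eLpNorm (fun x : Space N => bracket x ^ (-(a : ℝ))) 2 volume + 1,
    ENNReal.add_lt_top.mpr ⟨(memLp_bracket_rpow ha).2, by simp⟩, fun f => ?_⟩
  by_cases h : weightedNorm ∞ a f = ∞
  · rw [h, ENNReal.mul_top (by simp)]; exact le_top
  obtain ⟨g, rfl⟩ := exists_of_weightedNorm_lt_top (lt_top_iff_ne_top.mpr h)
  have h1 := ae_le_of_weightedNorm_top (g := g) (a := a) ENNReal.toReal_nonneg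
    (ENNReal.ofReal_toReal h).ge
  rw [weightedNorm_two_zero, Lp.enorm_def]
  calc eLpNorm g 2 volume ≤ ENNReal.ofReal (weightedNorm ∞ a (g : 𝓢'(Space N, ℂ))).toReal *
        eLpNorm (fun x : Space N => bracket x ^ (-(a : ℝ))) 2 volume := by
        refine eLpNorm_le_mul_eLpNorm_of_ae_le_mul ?_ 2
        filter_upwards [h1] with x hx
        have hb := bracket_pos x
        rw [bracket_rpow_neg_natCast, Real.norm_of_nonneg (by positivity), ← div_eq_mul_inv,
          le_div_iff₀ (by positivity), mul_comm]
        exact hx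
    _ ≤ _ := by
        rw [ENNReal.ofReal_toReal h, mul_comm]
        gcongr
        exact le_self_add

/-- Convexity of sublevel sets serves twice: with closedness it gives weak closedness, and it keeps
averages inside the set. -/
theorem convex_weightedNorm_le {p : ℝ≥0∞} (hp : 1 ≤ p) (a : ℕ)
    (T : 𝓢'(Space N, ℂ) →L[ℂ] 𝓢'(Space N, ℂ)) (M : ℝ≥0∞) :
    Convex ℝ {u : L2 N | weightedNorm p a (T (u : 𝓢'(Space N, ℂ))) ≤ M} := by
  intro u hu v hv s t hs ht hst
  simp only [Set.mem_ofPred_eq] at hu hv ⊢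
  have h1 : ∀ (r : ℝ) (_ : 0 ≤ r) (u : L2 N), weightedNorm p a (T (u : 𝓢'(Space N, ℂ))) ≤ M →
      weightedNorm p a (T ((r • u : L2 N) : 𝓢'(Space N, ℂ))) ≤ ENNReal.ofReal r * M := by
    intro r hr u hu
    rw [← L2_coe_smul, toTD_smul, map_smul]
    refine (weightedNorm_smul_le _ _ _ _).trans ?_
    rw [← ofReal_norm, Complex.norm_real, Real.norm_of_nonneg hr]
    gcongr
  rw [toTD_add, map_add]
  refine (weightedNorm_add_le hp _ _ _).trans ((add_le_add (h1 s hs u hu) (h1 t ht v hv)).trans ?_)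
  rw [← add_mul, ← ENNReal.ofReal_add hs ht, hst]
  simp

/-- A subsequence converges almost everywhere, and Fatou's lemma applies. -/
theorem isClosed_weightedNorm_le {p : ℝ≥0∞} (a : ℕ) (M : ℝ≥0∞) :
    IsClosed {u : L2 N | weightedNorm p a (u : 𝓢'(Space N, ℂ)) ≤ M} := by
  refine IsSeqClosed.isClosed fun g g₀ hg hlim => ?_
  obtain ⟨ns, -, hns⟩ := (tendstoInMeasure_of_tendsto_Lp hlim).exists_seq_tendsto_ae
  simp only [Set.mem_ofPred_eq, weightedNorm_coe] at hg ⊢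
  refine Lp.eLpNorm_le_of_ae_tendsto (u := atTop)
    (f := fun i x => ((bracket x ^ a : ℝ) : ℂ) * g (ns i) x)
    (Eventually.of_forall fun i => hg (ns i)) (fun i => aesm_weight a _) ?_
  filter_upwards [hns] with x hx
  exact hx.const_mul _

/-- Lower semicontinuity of the weighted norms under convergence of distributions. -/
theorem weightedNorm_le_of_tendsto {p : ℝ≥0∞} (hp : 1 ≤ p) {a : ℕ} (hc : Controls N p a)
    {ι : Type*} {l : Filter ι} [l.NeBot] {f : ι → 𝓢'(Space N, ℂ)} {f₀ : 𝓢'(Space N, ℂ)}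
    (h : Tendsto f l (𝓝 f₀)) {M : ℝ≥0∞} (hb : ∀ᶠ i in l, weightedNorm p a (f i) ≤ M) :
    weightedNorm p a f₀ ≤ M := by
  by_cases hM : M = ∞
  · simp [hM]
  obtain ⟨C, hC, hCf⟩ := hc
  -- Along an ultrafilter weak compactness yields a limit of the whole family, with no extraction of
  -- subsequences for a general filter.
  set F := Ultrafilter.of l
  have hF : (F : Filter ι) ≤ l := Ultrafilter.of_le l
  have hex : ∀ i, ∃ g : L2 N, weightedNorm p a (f i) ≤ M → (g : 𝓢'(Space N, ℂ)) = f i := by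
    intro i
    by_cases hi : weightedNorm p a (f i) ≤ M
    · obtain ⟨g, hg⟩ := exists_of_weightedNorm_lt_top (hi.trans_lt (lt_top_iff_ne_top.mpr hM))
      exact ⟨g, fun _ => hg⟩
    · exact ⟨0, fun h => absurd h hi⟩
  choose g hg using hex
  have hbF := hF hb
  have hbound : ∀ᶠ i in F, ‖g i‖ ≤ (C * M).toReal := by
    filter_upwards [hbF] with i hi
    have h1 : weightedNorm p a (f i) ≤ M := hi
    have h2 := hCf (g i : 𝓢'(Space N, ℂ))
    rw [weightedNorm_two_zero, hg i h1] at h2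
    have h3 : ‖g i‖ₑ ≤ C * M := h2.trans (by gcongr)
    rw [← toReal_enorm]
    exact ENNReal.toReal_mono (ENNReal.mul_ne_top hC.ne hM) h3
  obtain ⟨g₀, hg₀⟩ := exists_weak_limit F g hbound
  have hf₀ : (g₀ : 𝓢'(Space N, ℂ)) = f₀ := by
    ext ψ
    let ℓ : L2 N →L[ℂ] ℂ := (PointwiseConvergenceCLM.evalCLM (RingHom.id ℂ) ℂ ψ) ∘L
      (Lp.toTemperedDistributionCLM ℂ volume 2)
    have h1 : Tendsto (fun i => (g i : 𝓢'(Space N, ℂ)) ψ) F (𝓝 ((g₀ : 𝓢'(Space N, ℂ)) ψ)) := hg₀ ℓ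
    have h2 : Tendsto (fun i => f i ψ) F (𝓝 (f₀ ψ)) :=
      (((PointwiseConvergenceCLM.evalCLM (RingHom.id ℂ) ℂ ψ).continuous.tendsto f₀).comp h).mono_left hF
    refine tendsto_nhds_unique h1 (h2.congr' ?_)
    filter_upwards [hbF] with i hi
    rw [hg i hi]
  rw [← hf₀]
  by_contra hcon
  -- A closed convex set is weakly closed: a functional separating `g₀` from the sublevel set would
  -- contradict the weak convergence.
  obtain ⟨ℓ, s, hs1, hs2⟩ := RCLike.geometric_hahn_banach_closed_point (𝕜 := ℂ)
    (convex_weightedNorm_le hp a (ContinuousLinearMap.id ℂ 𝓢'(Space N, ℂ)) M)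
    (isClosed_weightedNorm_le a M) hcon
  have h1 := (Complex.continuous_re.tendsto _).comp (hg₀ ℓ)
  have h2 : Complex.re (ℓ g₀) ≤ s := by
    refine le_of_tendsto h1 ?_
    filter_upwards [hbF] with i hi
    refine (hs1 (g i) ?_).le
    change weightedNorm p a (g i : 𝓢'(Space N, ℂ)) ≤ M
    rw [hg i hi]
    exact hi
  exact absurd hs2 (not_lt.mpr h2)

theorem isClosed_weightedNorm_apply_le {p : ℝ≥0∞} (hp : 1 ≤ p) {a : ℕ} (hc : Controls N p a)
    (T : 𝓢'(Space N, ℂ) →L[ℂ] 𝓢'(Space N, ℂ)) (M : ℝ≥0∞) :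
    IsClosed {u : L2 N | weightedNorm p a (T (u : 𝓢'(Space N, ℂ))) ≤ M} := by
  refine IsSeqClosed.isClosed fun g g₀ hg hlim => ?_
  exact weightedNorm_le_of_tendsto hp hc
    ((T.continuous.comp toTD_continuous).tendsto g₀ |>.comp hlim) (Eventually.of_forall hg)

/-- Minkowski's inequality for integrals of `L²`-valued functions. -/
theorem weightedNorm_integral_le {p : ℝ≥0∞} (hp : 1 ≤ p) {a : ℕ} (hc : Controls N p a)
    (T : 𝓢'(Space N, ℂ) →L[ℂ] 𝓢'(Space N, ℂ)) {F : ℝ → L2 N} (hF : Continuous F) {s t : ℝ}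
    {M : ℝ≥0∞} (hM : ∀ τ ∈ Set.uIcc s t, weightedNorm p a (T (F τ : 𝓢'(Space N, ℂ))) ≤ M) :
    weightedNorm p a (T ((∫ τ in s..t, F τ : L2 N) : 𝓢'(Space N, ℂ))) ≤
      ENNReal.ofReal |t - s| * M := by
  rcases eq_or_ne s t with rfl | hst
  · simp [toTD_zero, weightedNorm_zero]
  have hvol : volume (Set.uIoc s t) = ENNReal.ofReal |t - s| := Real.volume_uIoc
  have hpos : 0 < |t - s| := abs_pos.mpr (sub_ne_zero.mpr hst.symm)
  -- The mean of `F` stays in the closed convex sublevel set; the integral is the mean times the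
  -- signed length of the interval.
  have hmem := (convex_weightedNorm_le hp a T M).set_average_mem (μ := volume) (t := Set.uIoc s t)
    (f := F) (isClosed_weightedNorm_apply_le hp hc T M)
    (by rw [hvol]; simpa using hpos.ne') (by rw [hvol]; simp)
    ((ae_restrict_iff' measurableSet_uIoc).mpr
      (Eventually.of_forall fun τ hτ => hM τ (Set.uIoc_subset_uIcc hτ)))
    (hF.integrableOn_uIoc)
  rw [setAverage_eq] at hmem
  simp only [Set.mem_ofPred_eq] at hmem
  have hint : ∃ c : ℂ, ‖c‖ = |t - s| ∧ (∫ τ in s..t, F τ) =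
      c • ((volume.real (Set.uIoc s t))⁻¹ • ∫ τ in Set.uIoc s t, F τ) := by
    have hr : volume.real (Set.uIoc s t) = |t - s| := by
      rw [Measure.real, hvol, ENNReal.toReal_ofReal hpos.le]
    rw [intervalIntegral.intervalIntegral_eq_integral_uIoc, hr]
    refine ⟨(((if s ≤ t then 1 else -1) * |t - s| : ℝ) : ℂ), ?_, ?_⟩
    · rw [Complex.norm_real]
      split_ifs <;> simp
    · rw [L2_coe_smul, smul_smul, mul_assoc, mul_inv_cancel₀ hpos.ne', mul_one]
  obtain ⟨c, hc1, hc2⟩ := hint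
  rw [hc2, toTD_smul, map_smul]
  refine (weightedNorm_smul_le _ _ _ _).trans ?_
  rw [← ofReal_norm, hc1]
  gcongr

end NLS

end

noncomputable section

namespace NLS

open LineDeriv FourierTransform

variable {N : ℕ}

/-! ### Weighted `L²` estimates for the Schrödinger group -/

/-- Moving the coordinate out through the derivatives leaves one main term, where it is absorbed by
one more power of the weight, and for each letter at most one commutator term with that letter
removed. -/
theorem weightedNorm_dl_Xc_le (j : Fin N) (a : ℕ) (M : ℝ≥0∞) (l : List (Fin N)) :
    ∀ f : 𝓢'(Space N, ℂ), weightedNorm 2 (a + 1) (dl l f) ≤ M →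
      (∀ l' : List (Fin N), l'.length + 1 = l.length → weightedNorm 2 a (dl l' f) ≤ M) →
      weightedNorm 2 a (dl l (Xc j f)) ≤ (l.length + 1) * M := by
  induction l using List.reverseRecOn with
  | nil =>
    intro f h1 _
    simpa using (weightedNorm_Xc_le a j f).trans h1
  | append_singleton l i ih =>
    intro f h1 h2
    have e1 : dl (l ++ [i]) (Xc j f) =
        dl l (Xc j (∂_{e i} f)) + (if i = j then (1 : ℂ) else 0) • dl l f := by
      rw [dl_append]
      change dl l (∂_{e i} (Xc j f)) = _
      rw [lineDeriv_Xc, map_add, map_smul]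
    have h3 := ih (∂_{e i} f) (by rw [dl_append] at h1; exact h1) (fun l' hl' => by
      have := h2 (l' ++ [i]) (by simp [hl'])
      rw [dl_append] at this; exact this)
    have h4 := h2 l (by simp)
    rw [e1]
    refine (weightedNorm_add_le (by norm_num) _ _ _).trans ?_
    have h5 : weightedNorm 2 a ((if i = j then (1 : ℂ) else 0) • dl l f) ≤ M := by
      refine (weightedNorm_smul_le _ _ _ _).trans ?_
      split_ifs
      · simpa using h4
      · simp
    refine (add_le_add h3 h5).trans (le_of_eq ?_)
    simp only [List.length_append, List.length_singleton, Nat.cast_add, Nat.cast_one]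
    ring

/-- `⟨x⟩^a ∂^l f` is bounded in `L²` by `M` whenever `a + |l| ≤ p`. -/
def JointBound (p : ℕ) (M : ℝ≥0∞) (f : 𝓢'(Space N, ℂ)) : Prop :=
  ∀ a (l : List (Fin N)), a + l.length ≤ p → weightedNorm 2 a (dl l f) ≤ M

/-- A coordinate, like a derivative, uses one unit of the common budget for weights and derivatives.
-/
theorem JointBound.Xc {p : ℕ} {M : ℝ≥0∞} {f : 𝓢'(Space N, ℂ)} (h : JointBound (p + 1) M f)
    (j : Fin N) : JointBound p ((p + 1) * M) (Xc j f) := fun a l hal => by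
  refine (weightedNorm_dl_Xc_le j a M l f (h _ _ (by omega)) fun l' hl' => h _ _ (by omega)).trans ?_
  gcongr
  omega

theorem JointBound.lineDeriv {p : ℕ} {M : ℝ≥0∞} {f : 𝓢'(Space N, ℂ)} (h : JointBound (p + 1) M f)
    (j : Fin N) : JointBound p M (∂_{e j} f) := fun a l hal => by
  have := h a (l ++ [j]) (by simp; omega)
  rwa [dl_append] at this

theorem weightedNorm_UV_le (t : ℝ) (f : 𝓢'(Space N, ℂ)) :
    weightedNorm 2 0 (UV t f) ≤ weightedNorm 2 0 f := by
  rcases weightedNorm_cases 2 0 f with h | ⟨f, rfl⟩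
  · simp [h]
  rw [← U_toTD, weightedNorm_two_zero, weightedNorm_two_zero, LinearIsometry.enorm_map]

theorem enorm_two_I_mul_le {t : ℝ} (ht : |t| ≤ 1) : ‖2 * Complex.I * (t : ℂ)‖ₑ ≤ 2 := by
  rw [← ofReal_norm]
  have : ‖2 * Complex.I * (t : ℂ)‖ ≤ 2 := by
    simp only [norm_mul, Complex.norm_ofNat, Complex.norm_I, Complex.norm_real, Real.norm_eq_abs]
    linarith
  exact (ENNReal.ofReal_le_ofReal this).trans (by simp)

/-- By `Xc_UV`, one coordinate in front of the group becomes a coordinate or a derivative behind it.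
Either consumes one unit of the budget, so induction on the power closes, and the base case is the
L² isometry. -/
theorem Xc_iterate_UV_le (p : ℕ) : ∃ C : ℝ≥0∞, C < ∞ ∧ ∀ (f : 𝓢'(Space N, ℂ)) (M : ℝ≥0∞) (t : ℝ)
    (j : Fin N), |t| ≤ 1 → JointBound p M f → weightedNorm 2 0 ((Xc j)^[p] (UV t f)) ≤ C * M := by
  induction p with
  | zero =>
    refine ⟨1, by simp, fun f M t j _ h => ?_⟩
    rw [one_mul]
    exact (weightedNorm_UV_le t f).trans (h 0 [] (by simp))
  | succ p ih =>
    obtain ⟨C, hC, ih⟩ := ih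
    refine ⟨C * (p + 1) + 2 * C, ?_, fun f M t j ht h => ?_⟩
    · refine ENNReal.add_lt_top.mpr ⟨ENNReal.mul_lt_top hC ?_, ENNReal.mul_lt_top (by simp) hC⟩
      exact ENNReal.add_lt_top.mpr ⟨ENNReal.natCast_lt_top p, by simp⟩
    rw [Function.iterate_succ_apply, Xc_UV]
    have e1 : (Xc j)^[p] (UV t (Xc j f) - (2 * Complex.I * t) • UV t (∂_{e j} f)) =
        (Xc j)^[p] (UV t (Xc j f)) - (2 * Complex.I * (t : ℂ)) • (Xc j)^[p] (UV t (∂_{e j} f)) := by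
      simp only [Xc_iterate, map_sub, map_smul]
    rw [e1]
    refine (weightedNorm_sub_le (by norm_num) _ _ _).trans ?_
    have h1 := ih _ _ t j ht (h.Xc j)
    have h2 := ih _ _ t j ht (h.lineDeriv j)
    have h3 := (weightedNorm_smul_le 2 0 (2 * Complex.I * (t : ℂ))
      ((Xc j)^[p] (UV t (∂_{e j} f)))).trans (mul_le_mul' (enorm_two_I_mul_le ht) h2)
    refine (add_le_add h1 h3).trans (le_of_eq ?_)
    ring

theorem weightedNorm_UV_joint (p : ℕ) : ∃ C : ℝ≥0∞, C < ∞ ∧ ∀ (f : 𝓢'(Space N, ℂ)) (M : ℝ≥0∞)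
    (t : ℝ), |t| ≤ 1 → JointBound p M f → weightedNorm 2 p (UV t f) ≤ C * M := by
  obtain ⟨C, hC, h⟩ := Xc_iterate_UV_le (N := N) p
  refine ⟨ENNReal.ofReal (((N : ℝ) + 1) ^ p) * (1 + N * C), ?_, fun f M t ht hf => ?_⟩
  · refine ENNReal.mul_lt_top (by simp) (ENNReal.add_lt_top.mpr ⟨by simp, ENNReal.mul_lt_top ?_ hC⟩)
    exact ENNReal.natCast_lt_top N
  refine (weightedNorm_le_coord 2 (by norm_num) p _).trans ?_
  rw [mul_assoc]
  gcongr
  have h1 := (weightedNorm_UV_le t f).trans (hf 0 [] (by simp))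
  have h2 : ∑ i : Fin N, weightedNorm 2 0 ((Xc i)^[p] (UV t f)) ≤ ∑ _i : Fin N, C * M :=
    Finset.sum_le_sum fun i _ => h f M t i ht hf
  refine (add_le_add h1 h2).trans (le_of_eq ?_)
  simp only [Finset.sum_const, Finset.card_univ, Fintype.card_fin, nsmul_eq_mul]
  ring

theorem tendsto_UV_sub_zero {f : 𝓢'(Space N, ℂ)} (hf : weightedNorm 2 0 f < ∞) :
    Tendsto (fun h => weightedNorm 2 0 (UV h f - f)) (𝓝 0) (𝓝 0) := by
  obtain ⟨g, rfl⟩ := exists_of_weightedNorm_lt_top hf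
  exact tendsto_UV_sub g

/-- Same induction as for boundedness; the commutator term carries a factor `h` and disappears in
the limit. -/
theorem tendsto_Xc_iterate_UV_sub (p : ℕ) : ∀ (f : 𝓢'(Space N, ℂ)) (M : ℝ≥0∞) (j : Fin N), M < ∞ →
    JointBound p M f →
    Tendsto (fun h => weightedNorm 2 0 ((Xc j)^[p] (UV h f - f))) (𝓝 0) (𝓝 0) := by
  induction p with
  | zero =>
    intro f M j hM hf
    exact tendsto_UV_sub_zero ((hf 0 [] (by simp)).trans_lt hM)
  | succ p ih =>
    intro f M j hM hf
    have hM' : (p + 1) * M < ∞ :=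
      ENNReal.mul_lt_top (ENNReal.add_lt_top.mpr ⟨ENNReal.natCast_lt_top p, by simp⟩) hM
    obtain ⟨C, hC, hCb⟩ := Xc_iterate_UV_le (N := N) p
    have h1 := ih _ _ j hM' (hf.Xc j)
    have h2 : Tendsto (fun h : ℝ => ‖2 * Complex.I * (h : ℂ)‖ₑ * (C * M)) (𝓝 0) (𝓝 0) := by
      have h3 : Tendsto (fun h : ℝ => ‖2 * Complex.I * (h : ℂ)‖ₑ) (𝓝 0) (𝓝 0) := by
        have : Continuous (fun h : ℝ => ‖2 * Complex.I * (h : ℂ)‖ₑ) := by fun_prop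
        simpa using this.tendsto 0
      simpa using ENNReal.Tendsto.mul_const h3 (Or.inr (ENNReal.mul_lt_top hC hM).ne)
    have h4 := h1.add h2
    rw [add_zero] at h4
    refine tendsto_of_tendsto_of_tendsto_of_le_of_le' tendsto_const_nhds h4
      (Eventually.of_forall fun _ => zero_le) ?_
    have hev : ∀ᶠ h : ℝ in 𝓝 0, |h| ≤ 1 := by
      filter_upwards [Metric.closedBall_mem_nhds (0 : ℝ) one_pos] with h hh
      simpa using hh
    filter_upwards [hev] with h hh
    rw [Function.iterate_succ_apply, map_sub, Xc_UV]
    have e1 : (Xc j)^[p] (UV h (Xc j f) - (2 * Complex.I * h) • UV h (∂_{e j} f) - Xc j f) =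
        (Xc j)^[p] (UV h (Xc j f) - Xc j f) -
          (2 * Complex.I * (h : ℂ)) • (Xc j)^[p] (UV h (∂_{e j} f)) := by
      simp only [Xc_iterate, map_sub, map_smul]
      abel
    rw [e1]
    refine (weightedNorm_sub_le (by norm_num) _ _ _).trans (add_le_add le_rfl ?_)
    refine (weightedNorm_smul_le _ _ _ _).trans ?_
    gcongr
    exact hCb _ _ h j hh (hf.lineDeriv j)

theorem tendsto_weightedNorm_UV_sub {p : ℕ} {f : 𝓢'(Space N, ℂ)} {M : ℝ≥0∞} (hM : M < ∞)
    (hf : JointBound p M f) :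
    Tendsto (fun h => weightedNorm 2 p (UV h f - f)) (𝓝 0) (𝓝 0) := by
  have h1 := (tendsto_UV_sub_zero ((hf 0 [] (by simp)).trans_lt hM)).add
    (tendsto_finsetSum (Finset.univ : Finset (Fin N))
      fun j _ => tendsto_Xc_iterate_UV_sub p f M j hM hf)
  have h2 := ENNReal.Tendsto.const_mul (a := ENNReal.ofReal (((N : ℝ) + 1) ^ p)) h1
    (Or.inr (by simp))
  simp only [Finset.sum_const_zero, add_zero, mul_zero] at h2
  exact tendsto_of_tendsto_of_tendsto_of_le_of_le tendsto_const_nhds h2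
    (fun _ => zero_le) (fun h => weightedNorm_le_coord 2 (by norm_num) p _)

/-! ### Sobolev embedding -/

theorem dl_replicate (i : Fin N) (k : ℕ) (f : 𝓢'(Space N, ℂ)) :
    dl (List.replicate (k + 1) i) f = dl (List.replicate k i) (∂_{e i} f) := by
  rw [List.replicate_succ', dl_append]
  rfl

/-- Treats the Fourier transform and its inverse at once: only the L² bound and the exchange of
coordinates with derivatives are used. -/
theorem weightedNorm_transform_le {G : 𝓢'(Space N, ℂ) →L[ℂ] 𝓢'(Space N, ℂ)} {c : ℂ}
    (hc : ‖c‖ₑ ≤ 1) (hG : ∀ f, weightedNorm 2 0 (G f) ≤ weightedNorm 2 0 f)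
    (hX : ∀ i f, Xc i (G f) = c • G (∂_{e i} f)) (k : ℕ) (f : 𝓢'(Space N, ℂ)) :
    weightedNorm 2 k (G f) ≤ ENNReal.ofReal (((N : ℝ) + 1) ^ k) *
      (weightedNorm 2 0 f + ∑ i, weightedNorm 2 0 (dl (List.replicate k i) f)) := by
  have h : ∀ (i : Fin N) (k : ℕ) (f : 𝓢'(Space N, ℂ)),
      weightedNorm 2 0 ((Xc i)^[k] (G f)) ≤ weightedNorm 2 0 (dl (List.replicate k i) f) := by
    intro i k
    induction k with
    | zero => intro f; exact hG f
    | succ k ih =>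
      intro f
      have e1 : (Xc i)^[k] (c • G (∂_{e i} f)) = c • (Xc i)^[k] (G (∂_{e i} f)) := by
        simp only [Xc_iterate, map_smul]
      rw [Function.iterate_succ_apply, hX, dl_replicate, e1]
      refine (weightedNorm_smul_le _ _ _ _).trans ?_
      exact (mul_le_mul' hc (ih _)).trans (by rw [one_mul])
  refine (weightedNorm_le_coord 2 (by norm_num) k _).trans ?_
  gcongr
  · exact hG f
  · exact h _ _ _

theorem enorm_inv_two_pi_I_le : ‖(2 * Real.pi * Complex.I : ℂ)⁻¹‖ₑ ≤ 1 := by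
  rw [← ofReal_norm, ENNReal.ofReal_le_one, norm_inv]
  refine inv_le_one_of_one_le₀ ?_
  simp only [norm_mul, Complex.norm_ofNat, Complex.norm_I, Complex.norm_real, Real.norm_eq_abs,
    abs_of_pos Real.pi_pos]
  linarith [Real.pi_gt_three]

theorem weightedNorm_fourier_le (k : ℕ) (f : 𝓢'(Space N, ℂ)) :
    weightedNorm 2 k (𝓕 f) ≤ ENNReal.ofReal (((N : ℝ) + 1) ^ k) *
      (weightedNorm 2 0 f + ∑ i, weightedNorm 2 0 (dl (List.replicate k i) f)) := by
  refine weightedNorm_transform_le (G := FourierTransform.fourierCLM ℂ 𝓢'(Space N, ℂ))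
    (c := (2 * Real.pi * Complex.I : ℂ)⁻¹) enorm_inv_two_pi_I_le (fun f => ?_) (fun i f => ?_) k f
  · rcases weightedNorm_cases 2 0 f with h | ⟨f, rfl⟩
    · simp [h]
    · rw [FourierTransform.fourierCLM_apply, Lp.fourier_toTemperedDistribution_eq,
        weightedNorm_two_zero, weightedNorm_two_zero, ← ofReal_norm, Lp.norm_fourier_eq, ofReal_norm]
  · simp only [FourierTransform.fourierCLM_apply]
    rw [fourier_lineDerivOp_eq, smul_smul, inv_mul_cancel₀ Complex.two_pi_I_ne_zero, one_smul]
    rfl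

theorem weightedNorm_fourierInv_le (k : ℕ) (f : 𝓢'(Space N, ℂ)) :
    weightedNorm 2 k (𝓕⁻ f) ≤ ENNReal.ofReal (((N : ℝ) + 1) ^ k) *
      (weightedNorm 2 0 f + ∑ i, weightedNorm 2 0 (dl (List.replicate k i) f)) := by
  refine weightedNorm_transform_le (G := FourierTransform.fourierInvCLM ℂ 𝓢'(Space N, ℂ))
    (c := (-(2 * Real.pi * Complex.I : ℂ))⁻¹) (by rw [inv_neg, enorm_neg]; exact enorm_inv_two_pi_I_le)
    (fun f => ?_) (fun i f => ?_) k f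
  · rcases weightedNorm_cases 2 0 f with h | ⟨f, rfl⟩
    · simp [h]
    · rw [FourierTransform.fourierInvCLM_apply, Lp.fourierInv_toTemperedDistribution_eq,
        weightedNorm_two_zero, weightedNorm_two_zero, ← ofReal_norm, norm_fourierInv_eq, ofReal_norm]
  · simp only [FourierTransform.fourierInvCLM_apply]
    rw [fourierInv_lineDerivOp_eq, smul_smul,
      inv_mul_cancel₀ (neg_ne_zero.mpr Complex.two_pi_I_ne_zero), one_smul]
    rfl

/-- Pure derivatives in the coordinate directions suffice, since ⟨ξ⟩^j is bounded by a constant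
times 1 + Σ|ξ_i|^j. -/
theorem memSobolev_of_dl {j : ℕ} {f : 𝓢'(Space N, ℂ)} (h0 : weightedNorm 2 0 f < ∞)
    (h : ∀ i, weightedNorm 2 0 (dl (List.replicate j i) f) < ∞) : MemSobolev (j : ℝ) 2 f := by
  have h1 : weightedNorm 2 j (𝓕 f) < ∞ := (weightedNorm_fourier_le j f).trans_lt
    (ENNReal.mul_lt_top (by simp) (ENNReal.add_lt_top.mpr ⟨h0, ENNReal.sum_lt_top.mpr fun i _ => h i⟩))
  obtain ⟨g, hg⟩ := exists_of_weightedNorm_lt_top h1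
  rw [memSobolev_iff_exists_smulLeftCLM_fourier]
  rw [← hg, weightedNorm_coe] at h1
  have e1 : (fun x : Space N => (((1 + ‖x‖ ^ 2) ^ ((j : ℝ) / 2) : ℝ) : ℂ)) =
      fun x => ((bracket x ^ j : ℝ) : ℂ) := by
    ext x
    congr 1
    rw [← bracket_sq, ← Real.rpow_natCast, ← Real.rpow_natCast, ← Real.rpow_mul (bracket_pos x).le]
    congr 1
    push_cast; ring
  have hm : MemLp (fun x => ((bracket x ^ j : ℝ) : ℂ) * g x) 2 volume := ⟨aesm_weight j g, h1⟩
  refine ⟨hm.toLp _, ?_⟩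
  rw [← hg, e1, smulLeft_toTD _ hm]
  rw [← e1]
  fun_prop

/-- A distribution whose inverse Fourier transform has a large moment in `L²` is bounded. -/
theorem weightedNorm_top_le_fourierInv {k : ℕ} (hk : (N : ℝ) < 2 * k) :
    ∃ C : ℝ≥0∞, C < ∞ ∧ ∀ f : 𝓢'(Space N, ℂ), weightedNorm ∞ 0 f ≤ C * weightedNorm 2 k (𝓕⁻ f) := by
  set B := eLpNorm (fun x : Space N => bracket x ^ (-(k : ℝ))) 2 volume with hB
  have hBtop : B < ∞ := (memLp_bracket_rpow hk).2
  refine ⟨B + 1, ENNReal.add_lt_top.mpr ⟨hBtop, by simp⟩, fun f => ?_⟩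
  by_cases hf : weightedNorm 2 k (𝓕⁻ f) = ∞
  · rw [hf, ENNReal.mul_top (by simp)]; exact le_top
  obtain ⟨w, hw⟩ := exists_of_weightedNorm_lt_top (lt_top_iff_ne_top.mpr hf)
  rw [← hw] at hf
  have hwm : MemLp (fun x => ((bracket x ^ k : ℝ) : ℂ) * w x) 2 volume :=
    ⟨aesm_weight k w, by rw [← weightedNorm_coe]; exact lt_top_iff_ne_top.mpr hf⟩
  have hf2 : f = ((𝓕 w : L2 N) : 𝓢'(Space N, ℂ)) := by
    rw [← Lp.fourier_toTemperedDistribution_eq, hw, FourierTransform.fourier_fourierInv_eq]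
  -- Cauchy–Schwarz after inserting ⟨x⟩^{-k}⟨x⟩^k.
  have hL1 : eLpNorm w 1 volume ≤ B * weightedNorm 2 k (w : 𝓢'(Space N, ℂ)) := by
    rw [weightedNorm_coe, hB]
    refine le_trans (le_of_eq ?_) (eLpNorm_smul_le_mul_eLpNorm (p := 2) (q := 2) (r := 1) hwm.1
      (memLp_bracket_rpow hk).1)
    refine eLpNorm_congr_ae (Eventually.of_forall fun x => ?_)
    have hb := bracket_pos x
    simp only [Pi.smul_apply', Complex.real_smul, bracket_rpow_neg_natCast]
    rw [← mul_assoc, ← Complex.ofReal_mul, inv_mul_cancel₀ (by positivity)]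
    simp
  have hint : Integrable w volume := by
    rw [← memLp_one_iff_integrable]
    exact ⟨Lp.aestronglyMeasurable w, hL1.trans_lt (ENNReal.mul_lt_top hBtop (lt_top_iff_ne_top.mpr hf))⟩
  set F : Space N → ℂ := VectorFourier.fourierIntegral Real.fourierChar volume (innerₗ (Space N)) w
    with hF
  have hFle : ∀ x, ‖F x‖ ≤ ∫ y, ‖w y‖ := fun x =>
    VectorFourier.norm_fourierIntegral_le_integral_norm _ _ _ _ _
  have hFc : Continuous F := VectorFourier.fourierIntegral_continuous Real.continuous_fourierChar
    continuous_inner hint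
  -- The L² Fourier transform agrees with the Fourier integral of the integrable function `w`: test
  -- both against compactly supported smooth functions and move the transform to the test function.
  have hae : (𝓕 w : L2 N) =ᵐ[volume] F := by
    refine ae_eq_of_integral_contDiff_smul_eq ((Lp.memLp _).locallyIntegrable (by norm_num))
      hFc.locallyIntegrable ?_
    intro φ hφ hφc
    have hg₁ : HasCompactSupport (Complex.ofRealCLM ∘ φ) := hφc.comp_left rfl
    have hg₂ : ContDiff ℝ ((⊤ : ℕ∞) : WithTop ℕ∞) (Complex.ofRealCLM ∘ φ) := by fun_prop
    set ψ := hg₁.toSchwartzMap hg₂ with hψ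
    have hψv : ∀ x, ψ x = (φ x : ℂ) := fun x => rfl
    have h1 : ((𝓕 w : L2 N) : 𝓢'(Space N, ℂ)) ψ = (w : 𝓢'(Space N, ℂ)) (𝓕 ψ) := by
      rw [← Lp.fourier_toTemperedDistribution_eq]; rfl
    rw [Lp.toTemperedDistribution_apply, Lp.toTemperedDistribution_apply] at h1
    have h2 := VectorFourier.integral_fourierIntegral_smul_eq_flip (L := innerₗ (Space N))
      (f := ψ) (g := w) (μ := volume) (ν := volume)
      Real.continuous_fourierChar continuous_inner ψ.integrable hint
    have h3 : ∀ x, VectorFourier.fourierIntegral Real.fourierChar volume (innerₗ (Space N)).flip w x =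
        F x := fun x => by rw [flip_innerₗ]
    simp only [h3] at h2
    have h4 : ∀ x, (𝓕 ψ : 𝓢(Space N, ℂ)) x =
      VectorFourier.fourierIntegral Real.fourierChar volume (innerₗ (Space N)) ψ x := fun x => rfl
    simp only [h4, hψv] at h1
    simp only [hψv] at h2
    simp only [Complex.real_smul]
    simp only [smul_eq_mul] at h1 h2
    rw [h1, ← h2]
  rw [← hw, hf2]
  have h5 : ∀ᵐ x, bracket x ^ 0 * ‖(𝓕 w : L2 N) x‖ ≤ ∫ y, ‖w y‖ := by
    filter_upwards [hae] with x hx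
    rw [hx, pow_zero, one_mul]
    exact hFle x
  refine (weightedNorm_top_le h5).trans ?_
  rw [ofReal_integral_norm_eq_lintegral_enorm hint, ← eLpNorm_one_eq_lintegral_enorm]
  refine hL1.trans ?_
  gcongr
  exact le_self_add

theorem weightedNorm_top_le_sobolev {k : ℕ} (hk : (N : ℝ) < 2 * k) :
    ∃ C : ℝ≥0∞, C < ∞ ∧ ∀ (f : 𝓢'(Space N, ℂ)) (M : ℝ≥0∞),
      (∀ l : List (Fin N), l.length ≤ k → weightedNorm 2 0 (dl l f) ≤ M) →
      weightedNorm ∞ 0 f ≤ C * M := by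
  obtain ⟨C, hC, h⟩ := weightedNorm_top_le_fourierInv hk
  refine ⟨C * (ENNReal.ofReal (((N : ℝ) + 1) ^ k) * (1 + N)), ?_, fun f M hM => ?_⟩
  · refine ENNReal.mul_lt_top hC (ENNReal.mul_lt_top (by simp) (ENNReal.add_lt_top.mpr ⟨by simp, ?_⟩))
    exact ENNReal.natCast_lt_top N
  refine (h f).trans ?_
  rw [mul_assoc, mul_assoc]
  gcongr
  refine (weightedNorm_fourierInv_le k f).trans ?_
  gcongr
  have h1 : ∑ i : Fin N, weightedNorm 2 0 (dl (List.replicate k i) f) ≤ ∑ _i : Fin N, M :=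
    Finset.sum_le_sum fun i _ => hM _ (by simp)
  refine (add_le_add (hM [] (by simp)) h1).trans (le_of_eq ?_)
  simp only [Finset.sum_const, Finset.card_univ, Fintype.card_fin, nsmul_eq_mul]
  ring

/-- Prepares the unweighted embedding for powers of a coordinate times `f`; commutators have lower
order and weight to spare. -/
theorem Xc_iterate_sobolev (q p : ℕ) : ∀ (f : 𝓢'(Space N, ℂ)) (M : ℝ≥0∞) (j : Fin N),
    (∀ l : List (Fin N), l.length ≤ q → weightedNorm 2 p (dl l f) ≤ M) →
    ∀ l : List (Fin N), l.length ≤ q →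
      weightedNorm 2 0 (dl l ((Xc j)^[p] f)) ≤ (q + 1) ^ p * M := by
  induction p with
  | zero =>
    intro f M j h l hl
    simpa using h l hl
  | succ p ih =>
    intro f M j h l hl
    rw [Function.iterate_succ_apply, pow_succ, mul_assoc]
    refine ih (Xc j f) _ j (fun l hl => ?_) l hl
    refine (weightedNorm_dl_Xc_le j p M l f (h l hl) fun l' hl' =>
      (weightedNorm_mono 2 (Nat.le_succ p) _).trans (h l' (by omega))).trans ?_
    gcongr

/-- Weighted Sobolev embedding. -/
theorem weightedNorm_top_le_weighted_sobolev {k : ℕ} (hk : (N : ℝ) < 2 * k) (n : ℕ) :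
    ∃ C : ℝ≥0∞, C < ∞ ∧ ∀ (f : 𝓢'(Space N, ℂ)) (M : ℝ≥0∞),
      (∀ l : List (Fin N), l.length ≤ k → weightedNorm 2 n (dl l f) ≤ M) →
      weightedNorm ∞ n f ≤ C * M := by
  obtain ⟨C, hC, h⟩ := weightedNorm_top_le_sobolev (N := N) hk
  refine ⟨ENNReal.ofReal (((N : ℝ) + 1) ^ n) * (C + N * (C * (k + 1) ^ n)), ?_, fun f M hM => ?_⟩
  · refine ENNReal.mul_lt_top (by simp) (ENNReal.add_lt_top.mpr ⟨hC, ENNReal.mul_lt_top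
      (ENNReal.natCast_lt_top N) (ENNReal.mul_lt_top hC (ENNReal.pow_lt_top ?_))⟩)
    exact ENNReal.add_lt_top.mpr ⟨ENNReal.natCast_lt_top k, by simp⟩
  refine (weightedNorm_le_coord ∞ (by simp) n f).trans ?_
  rw [mul_assoc]
  gcongr
  have h0 := h f M fun l hl => (weightedNorm_mono 2 (Nat.zero_le n) _).trans (hM l hl)
  have h1 : ∑ i : Fin N, weightedNorm ∞ 0 ((Xc i)^[n] f) ≤
      ∑ _i : Fin N, C * ((k + 1) ^ n * M) :=
    Finset.sum_le_sum fun i _ => h _ _ (Xc_iterate_sobolev k n f M i hM)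
  refine (add_le_add h0 h1).trans (le_of_eq ?_)
  simp only [Finset.sum_const, Finset.card_univ, Fintype.card_fin, nsmul_eq_mul]
  ring

end NLS

end

noncomputable section

namespace NLS

open LineDeriv FourierTransform

variable {N : ℕ}

/-! ### Boundedness in `X` -/

/-- The weight attached to derivatives of order `j > 2m` in `X`. -/
def wt (k m n j : ℕ) : ℕ := min n (J k m n - j)

/-- All weighted norms entering the norm of `X` are at most `M`. -/
structure XBound (k m n : ℕ) (M : ℝ≥0∞) (u : L2 N) : Prop where
  low : ∀ l : List (Fin N), l.length ≤ 2 * m →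
    weightedNorm ∞ n (dl l (u : 𝓢'(Space N, ℂ))) ≤ M
  high : ∀ l : List (Fin N), 2 * m < l.length → l.length ≤ J k m n →
    weightedNorm 2 (wt k m n l.length) (dl l (u : 𝓢'(Space N, ℂ))) ≤ M

variable {k m n : ℕ}

theorem XBound.mono {M M' : ℝ≥0∞} {u : L2 N} (h : XBound k m n M u) (hM : M ≤ M') :
    XBound k m n M' u := ⟨fun l hl => (h.low l hl).trans hM, fun l h1 h2 => (h.high l h1 h2).trans hM⟩

theorem XBound.add {M M' : ℝ≥0∞} {u v : L2 N} (hu : XBound k m n M u) (hv : XBound k m n M' v) :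
    XBound k m n (M + M') (u + v) where
  low l hl := by
    rw [toTD_add, map_add]
    exact (weightedNorm_add_le (by simp) _ _ _).trans (add_le_add (hu.low l hl) (hv.low l hl))
  high l h1 h2 := by
    rw [toTD_add, map_add]
    exact (weightedNorm_add_le (by norm_num) _ _ _).trans
      (add_le_add (hu.high l h1 h2) (hv.high l h1 h2))

theorem XBound.smul {M : ℝ≥0∞} {u : L2 N} (hu : XBound k m n M u) (c : ℂ) :
    XBound k m n (‖c‖ₑ * M) (c • u) where
  low l hl := by
    rw [toTD_smul, map_smul]
    exact (weightedNorm_smul_le _ _ _ _).trans (mul_le_mul' le_rfl (hu.low l hl))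
  high l h1 h2 := by
    rw [toTD_smul, map_smul]
    exact (weightedNorm_smul_le _ _ _ _).trans (mul_le_mul' le_rfl (hu.high l h1 h2))

/-- Makes balls of X complete for the L² metric, and lets bounds for mollifications pass to the
function itself. -/
theorem XBound.of_tendsto (hn : (N : ℝ) < 2 * n) {ι : Type*} {l : Filter ι} [l.NeBot]
    {f : ι → L2 N} {u : L2 N} (h : Tendsto f l (𝓝 u)) {M : ℝ≥0∞}
    (hM : ∀ᶠ i in l, XBound k m n M (f i)) : XBound k m n M u where
  low s hs := weightedNorm_le_of_tendsto (by simp) (controls_top hn)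
    (((dl s).continuous.comp toTD_continuous).tendsto u |>.comp h)
    (hM.mono fun _ hi => hi.low s hs)
  high s h1 h2 := weightedNorm_le_of_tendsto (by norm_num) (controls_two _)
    (((dl s).continuous.comp toTD_continuous).tendsto u |>.comp h)
    (hM.mono fun _ hi => hi.high s h1 h2)

theorem XBound.integral (hn : (N : ℝ) < 2 * n) {F : ℝ → L2 N} (hF : Continuous F) {s t : ℝ}
    {M : ℝ≥0∞} (hM : ∀ τ ∈ Set.uIcc s t, XBound k m n M (F τ)) :
    XBound k m n (ENNReal.ofReal |t - s| * M) (∫ τ in s..t, F τ) where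
  low l hl := weightedNorm_integral_le (by simp) (controls_top hn) (dl l) hF
    fun τ hτ => (hM τ hτ).low l hl
  high l h1 h2 := weightedNorm_integral_le (by norm_num) (controls_two _) (dl l) hF
    fun τ hτ => (hM τ hτ).high l h1 h2

theorem dl_eq_D (l : List (Fin N)) (u : L2 N) : dl l (u : 𝓢'(Space N, ℂ)) = D l.get u := by
  rw [D_eq_dl, List.ofFn_get]

theorem XBound.of_normX (u : L2 N) : XBound k m n (normX k m n u) u where
  low l hl := by
    unfold normX
    refine le_trans ?_ le_self_add
    refine le_trans ?_ (Finset.single_le_sum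
      (f := fun j => ⨆ s : Fin j → Fin N, weightedNorm ∞ n (D s u)) (fun _ _ => zero_le)
      (Finset.mem_range.mpr (Nat.lt_succ_of_le hl)))
    rw [dl_eq_D]
    exact le_iSup (fun s : Fin l.length → Fin N => weightedNorm ∞ n (D s u)) l.get
  high l h1 h2 := by
    unfold normX
    refine le_trans ?_ le_add_self
    have key : ∀ ν μ, ν < k + 2 → μ < n + 1 → ν + μ + 2 * m + 1 = l.length →
        wt k m n l.length = n - μ →
        weightedNorm 2 (wt k m n l.length) (dl l (u : 𝓢'(Space N, ℂ))) ≤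
        ∑ ν ∈ Finset.range (k + 2), ∑ μ ∈ Finset.range (n + 1),
          ⨆ s : Fin (ν + μ + 2 * m + 1) → Fin N, weightedNorm 2 (n - μ) (D s u) := by
      intro ν μ hν hμ hl hw
      refine le_trans ?_ (Finset.single_le_sum (f := fun ν => ∑ μ ∈ Finset.range (n + 1),
        ⨆ s : Fin (ν + μ + 2 * m + 1) → Fin N, weightedNorm 2 (n - μ) (D s u))
        (fun _ _ => zero_le) (Finset.mem_range.mpr hν))
      refine le_trans ?_ (Finset.single_le_sum (f := fun μ =>
        ⨆ s : Fin (ν + μ + 2 * m + 1) → Fin N, weightedNorm 2 (n - μ) (D s u))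
        (fun _ _ => zero_le) (Finset.mem_range.mpr hμ))
      have hx : ∀ j, j = l.length → ∃ s : Fin j → Fin N, List.ofFn s = l := by
        rintro j rfl
        exact ⟨l.get, List.ofFn_get l⟩
      obtain ⟨s, hs⟩ := hx _ hl
      refine le_trans (le_of_eq ?_) (le_iSup (fun s : Fin (ν + μ + 2 * m + 1) → Fin N =>
        weightedNorm 2 (n - μ) (D s u)) s)
      rw [D_eq_dl, hs, hw]
    unfold J at h2
    -- Each order occurs for several pairs (ν, μ) in `normX`. The pair with the largest weight is
    -- wanted: μ = 0 as long as ν ≤ k+1, then ν = k+1.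
    by_cases hl : l.length ≤ 2 * m + 2 + k
    · exact key (l.length - (2 * m + 1)) 0 (by omega) (by omega) (by omega)
        (by unfold wt J; omega)
    · exact key (k + 1) (l.length - (2 * m + 2 + k)) (by omega) (by omega) (by omega)
        (by unfold wt J; omega)

theorem XBound.normX_le {M : ℝ≥0∞} {u : L2 N} (h : XBound k m n M u) :
    normX k m n u ≤ ((2 * m + 1) + (k + 2) * (n + 1) : ℕ) * M := by
  unfold normX
  push_cast
  rw [add_mul]
  refine add_le_add ?_ ?_
  · refine (Finset.sum_le_sum (g := fun _ => M) fun j hj => iSup_le fun s => ?_).trans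
      (le_of_eq (by simp))
    rw [D_eq_dl]
    exact h.low _ (by simpa using Nat.lt_succ_iff.mp (Finset.mem_range.mp hj))
  · refine (Finset.sum_le_sum (g := fun _ => (n + 1 : ℝ≥0∞) * M) fun ν hν => ?_).trans
      (le_of_eq (by simp [mul_assoc]))
    refine (Finset.sum_le_sum (g := fun _ => M) fun μ hμ => iSup_le fun s => ?_).trans
      (le_of_eq (by simp))
    rw [Finset.mem_range] at hν hμ
    dsimp only
    rw [D_eq_dl]
    refine (weightedNorm_mono 2 ?_ _).trans (h.high (List.ofFn s) (by rw [List.length_ofFn]; omega)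
      (by simp; unfold J; omega))
    simp only [List.length_ofFn]
    unfold wt J
    omega

theorem XBound.memX (hn : (N : ℝ) < 2 * n) {M : ℝ≥0∞} {u : L2 N} (h : XBound k m n M u)
    (hM : M < ∞) : MemX k m n u where
  sobolev := by
    have key : ∀ l : List (Fin N), l.length ≤ J k m n →
        weightedNorm 2 0 (dl l (u : 𝓢'(Space N, ℂ))) < ∞ := by
      intro l hl
      by_cases hl2 : l.length ≤ 2 * m
      · obtain ⟨C, hC, hCf⟩ := controls_top (N := N) (a := n) hn
        exact (hCf _).trans_lt (ENNReal.mul_lt_top hC ((h.low l hl2).trans_lt hM))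
      · exact (weightedNorm_mono 2 (Nat.zero_le _) _).trans_lt
          ((h.high l (by omega) hl).trans_lt hM)
    exact memSobolev_of_dl (key [] (by simp)) fun i => key _ (by simp)
  low j hj s := by
    rw [D_eq_dl]
    exact (h.low _ (by simpa using hj)).trans_lt hM
  mid j h1 h2 s := by
    rw [D_eq_dl]
    have := h.high (List.ofFn s) (by simp; omega) (by simp; unfold J; omega)
    simp only [List.length_ofFn] at this
    have hw : wt k m n j = n := by unfold wt J; omega
    rw [hw] at this
    exact this.trans_lt hM
  high j h1 h2 s := by
    rw [D_eq_dl]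
    have := h.high (List.ofFn s) (by simp; omega) (by simp; omega)
    simp only [List.length_ofFn] at this
    have hw : wt k m n j = J k m n - j := by unfold wt J at *; omega
    rw [hw] at this
    exact this.trans_lt hM

theorem MemX.normX_lt_top {u : L2 N} (h : MemX k m n u) : normX k m n u < ∞ := by
  have key : ∀ {j : ℕ} {p : ℝ≥0∞} {a : ℕ}, (∀ s : Fin j → Fin N, weightedNorm p a (D s u) < ∞) →
      (⨆ s : Fin j → Fin N, weightedNorm p a (D s u)) < ∞ := by
    intro j p a hs
    rw [← Finset.sup_univ_eq_iSup, Finset.sup_lt_iff (by simp)]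
    exact fun s _ => hs s
  unfold normX
  refine ENNReal.add_lt_top.mpr ⟨ENNReal.sum_lt_top.mpr fun j hj => key fun s => ?_,
    ENNReal.sum_lt_top.mpr fun ν hν => ENNReal.sum_lt_top.mpr fun μ hμ => key fun s => ?_⟩
  · exact h.low j (Nat.lt_succ_iff.mp (Finset.mem_range.mp hj)) s
  · rw [Finset.mem_range] at hν hμ
    by_cases hj : ν + μ + 2 * m + 1 ≤ 2 * m + 2 + k
    · exact (weightedNorm_mono 2 (Nat.sub_le _ _) _).trans_lt (h.mid _ (by omega) hj s)
    · refine (weightedNorm_mono 2 ?_ _).trans_lt (h.high _ (by omega) (by unfold J; omega) s)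
      unfold J; omega

theorem MemX.xBound {u : L2 N} (h : MemX k m n u) :
    XBound k m n (ENNReal.ofReal (normX k m n u).toReal) u := by
  rw [ENNReal.ofReal_toReal h.normX_lt_top.ne]
  exact XBound.of_normX u

/-! ### The Schrödinger group on `X` -/

/-- The weight `wt` drops by at most one when the order grows by one. This is what lets X absorb the
derivatives lost in `Xc_UV`. -/
theorem XBound.jointBound {M : ℝ≥0∞} {u : L2 N} (h : XBound k m n M u) {l : List (Fin N)}
    (h1 : 2 * m < l.length) (h2 : l.length ≤ J k m n) :
    JointBound (wt k m n l.length) M (dl l (u : 𝓢'(Space N, ℂ))) := fun a l' hal => by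
  rw [← dl_append]
  have hw : wt k m n l.length ≤ J k m n - l.length := min_le_right _ _
  refine (weightedNorm_mono 2 ?_ _).trans (h.high (l' ++ l) (by simp; omega) (by simp; omega))
  simp only [List.length_append]
  unfold wt at *
  omega

theorem exists_toTD_of_xBound {M : ℝ≥0∞} {u : L2 N} (h : XBound k m n M u) (hM : M < ∞)
    {l : List (Fin N)} (hl : l.length ≤ J k m n) :
    ∃ g : L2 N, (g : 𝓢'(Space N, ℂ)) = dl l (u : 𝓢'(Space N, ℂ)) := by
  by_cases h2 : l.length ≤ 2 * m
  · exact exists_of_weightedNorm_lt_top ((h.low l h2).trans_lt hM)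
  · exact exists_of_weightedNorm_lt_top ((h.high l (by omega) hl).trans_lt hM)

theorem exists_laplacian_of_xBound {M : ℝ≥0∞} {u : L2 N} (h : XBound k m n M u) (hM : M < ∞)
    {l : List (Fin N)} (hl : l.length ≤ 2 * m) :
    ∃ g : L2 N, (g : 𝓢'(Space N, ℂ)) = Δ (dl l (u : 𝓢'(Space N, ℂ))) := by
  have hex : ∀ i : Fin N, ∃ g : L2 N, (g : 𝓢'(Space N, ℂ)) = dl (i :: i :: l) (u : 𝓢'(Space N, ℂ)) :=
    fun i => exists_toTD_of_xBound h hM (by simp; unfold J; omega)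
  choose g hg using hex
  refine ⟨∑ i, g i, ?_⟩
  rw [laplacian_eq_sum_e]
  have := map_sum (Lp.toTemperedDistributionCLM ℂ (volume : Measure (Space N)) 2) g Finset.univ
  simp only [Lp.toTemperedDistributionCLM_apply] at this
  rw [this]
  exact Finset.sum_congr rfl fun i _ => hg i

theorem dl_U (t : ℝ) (l : List (Fin N)) (u : L2 N) :
    dl l ((U t u : L2 N) : 𝓢'(Space N, ℂ)) = UV t (dl l (u : 𝓢'(Space N, ℂ))) := by
  rw [U_toTD, UV_dl]

theorem U_sub_eq_integral {g lap : L2 N} (hlap : (lap : 𝓢'(Space N, ℂ)) = Δ (g : 𝓢'(Space N, ℂ)))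
    (t : ℝ) : U t g - g = ∫ s in (0 : ℝ)..t, Complex.I • U s lap := by
  rw [intervalIntegral.integral_eq_sub_of_hasDerivAt (f := fun s => U s g)
    (fun s _ => hasDerivAt_U hlap s), U_zero]
  exact ((continuous_U lap).const_smul Complex.I).intervalIntegrable _ _

/-- Weighted sup norms are estimated through the time integral of the Laplacian, at the price of two
derivatives and with a gain of |t|. -/
theorem weightedNorm_top_U_sub_le (hn : (N : ℝ) < 2 * n) {M : ℝ≥0∞} {u : L2 N}
    (h : XBound k m n M u) (hM : M < ∞) {l : List (Fin N)} (hl : l.length ≤ 2 * m) {t : ℝ} {B : ℝ≥0∞}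
    (hB : ∀ s ∈ Set.uIcc 0 t, ∀ i : Fin N,
      weightedNorm ∞ n (dl (i :: i :: l) ((U s u : L2 N) : 𝓢'(Space N, ℂ))) ≤ B) :
    weightedNorm ∞ n (dl l ((U t u - u : L2 N) : 𝓢'(Space N, ℂ))) ≤ ENNReal.ofReal |t| * (N * B) := by
  obtain ⟨g, hg⟩ := exists_toTD_of_xBound h hM (l := l) (by unfold J; omega)
  obtain ⟨lap, hlap⟩ := exists_laplacian_of_xBound h hM hl
  have e1 : dl l ((U t u - u : L2 N) : 𝓢'(Space N, ℂ)) =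
      ((∫ s in (0 : ℝ)..t, Complex.I • U s lap : L2 N) : 𝓢'(Space N, ℂ)) := by
    have hUi := U_sub_eq_integral (g := g) (lap := lap) (by rw [hlap, hg]) t
    rw [← hUi, toTD_sub, toTD_sub, map_sub, dl_U, U_toTD, hg]
  rw [e1]
  have h1 := weightedNorm_integral_le (p := ∞) (by simp) (controls_top hn)
    (ContinuousLinearMap.id ℂ 𝓢'(Space N, ℂ)) (s := 0) (t := t)
    (F := fun s => Complex.I • U s lap) ((continuous_U lap).const_smul Complex.I)
    (M := N * B) (fun s hs => ?_)
  · simpa using h1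
  · rw [ContinuousLinearMap.id_apply, toTD_smul, U_toTD, hlap, laplacian_eq_sum_e, map_sum]
    refine (weightedNorm_smul_le _ _ _ _).trans ?_
    rw [show ‖Complex.I‖ₑ = 1 by simp [← ofReal_norm], one_mul]
    refine (weightedNorm_sum_le (by simp) n _ _).trans ?_
    refine (Finset.sum_le_sum (g := fun _ => B) fun i _ => ?_).trans (le_of_eq (by simp))
    rw [UV_lineDeriv, UV_lineDeriv, ← dl_U]
    exact hB s hs i

theorem exists_weightedNorm_UV_joint_uniform (N n : ℕ) : ∃ C : ℝ≥0∞, C < ∞ ∧ ∀ p ≤ n,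
    ∀ (f : 𝓢'(Space N, ℂ)) (M : ℝ≥0∞) (t : ℝ), |t| ≤ 1 → JointBound p M f →
      weightedNorm 2 p (UV t f) ≤ C * M := by
  choose C hC h using weightedNorm_UV_joint (N := N)
  refine ⟨∑ p ∈ Finset.range (n + 1), C p, ENNReal.sum_lt_top.mpr fun p _ => hC p,
    fun p hp f M t ht hf => (h p f M t ht hf).trans ?_⟩
  gcongr
  exact Finset.single_le_sum (f := C) (fun _ _ => zero_le) (Finset.mem_range.mpr (by omega))

theorem exists_high_U (N k m n : ℕ) : ∃ C : ℝ≥0∞, C < ∞ ∧ ∀ (M : ℝ≥0∞) (u : L2 N) (t : ℝ),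
    |t| ≤ 1 → XBound k m n M u → ∀ l : List (Fin N), 2 * m < l.length → l.length ≤ J k m n →
      weightedNorm 2 (wt k m n l.length) (dl l ((U t u : L2 N) : 𝓢'(Space N, ℂ))) ≤ C * M := by
  obtain ⟨C, hC, h⟩ := exists_weightedNorm_UV_joint_uniform N n
  refine ⟨C, hC, fun M u t ht hu l h1 h2 => ?_⟩
  rw [dl_U]
  exact h _ (min_le_left _ _) _ _ t ht (hu.jointBound h1 h2)

/-- Descending induction on the order, with `d` counting how far below 2m+1 one has gone. The
induction step uses `weightedNorm_top_U_sub_le`, whose two extra derivatives never lead beyond order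
2m+2. -/
theorem exists_top_U (hn : (N : ℝ) < 2 * n) (hk : (N : ℝ) < 2 * k) (d : ℕ) :
    ∃ B : ℝ≥0∞, B < ∞ ∧ ∀ (M : ℝ≥0∞) (u : L2 N) (t : ℝ), |t| ≤ 1 → M < ∞ → XBound k m n M u →
      ∀ l : List (Fin N), l.length ≤ 2 * m + 2 → 2 * m + 2 ≤ l.length + (d + 1) →
        weightedNorm ∞ n (dl l ((U t u : L2 N) : 𝓢'(Space N, ℂ))) ≤ B * M := by
  obtain ⟨C, hC, hhigh⟩ := exists_high_U N k m n
  obtain ⟨S, hS, hsob⟩ := weightedNorm_top_le_weighted_sobolev (N := N) hk n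
  -- For orders 2m+1 and 2m+2, the `k` further derivatives needed by the Sobolev embedding still
  -- carry the full weight `n`.
  have base : ∀ (M : ℝ≥0∞) (u : L2 N) (t : ℝ), |t| ≤ 1 → XBound k m n M u →
      ∀ l : List (Fin N), l.length ≤ 2 * m + 2 → 2 * m < l.length →
        weightedNorm ∞ n (dl l ((U t u : L2 N) : 𝓢'(Space N, ℂ))) ≤ S * C * M := by
    intro M u t ht hu l h1 h2
    rw [mul_assoc]
    refine hsob _ _ fun l' hl' => ?_
    rw [← dl_append]
    have := hhigh M u t ht hu (l' ++ l) (by simp; omega) (by simp; unfold J; omega)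
    rwa [show wt k m n (l' ++ l).length = n by simp; unfold wt J; omega] at this
  induction d with
  | zero =>
    exact ⟨S * C, ENNReal.mul_lt_top hS hC, fun M u t ht _ hu l h1 h2 =>
      base M u t ht hu l h1 (by omega)⟩
  | succ d ih =>
    obtain ⟨B, hB, ih⟩ := ih
    refine ⟨S * C + (1 + N * B), ?_, fun M u t ht hM hu l h1 h2 => ?_⟩
    · exact ENNReal.add_lt_top.mpr ⟨ENNReal.mul_lt_top hS hC, ENNReal.add_lt_top.mpr
        ⟨by simp, ENNReal.mul_lt_top (ENNReal.natCast_lt_top N) hB⟩⟩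
    by_cases hl : 2 * m < l.length
    · refine (base M u t ht hu l h1 hl).trans ?_
      gcongr
      exact le_self_add
    · have hdiff := weightedNorm_top_U_sub_le hn hu hM (l := l) (by omega) (t := t) (B := B * M)
        (fun s hs i => ih M u s ?_ hM hu _ (by simp; omega) (by simp; omega))
      · have e1 : dl l ((U t u : L2 N) : 𝓢'(Space N, ℂ)) =
            dl l (u : 𝓢'(Space N, ℂ)) + dl l ((U t u - u : L2 N) : 𝓢'(Space N, ℂ)) := by
          rw [toTD_sub, map_sub]; abel
        rw [e1]
        refine (weightedNorm_add_le (by simp) _ _ _).trans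
          ((add_le_add (hu.low l (by omega)) hdiff).trans ?_)
        have ht1 : ENNReal.ofReal |t| ≤ 1 := by simpa using ht
        calc M + ENNReal.ofReal |t| * (N * (B * M)) ≤ M + 1 * (N * (B * M)) := by gcongr
          _ = (1 + N * B) * M := by ring
          _ ≤ _ := mul_le_mul' le_add_self le_rfl
      · have h3 : |s - 0| ≤ |t - 0| := Set.abs_sub_left_of_mem_uIcc hs
        simp only [sub_zero] at h3
        exact h3.trans ht

/-- The Schrödinger group is bounded on `X`, and Lipschitz in time in the weighted sup norms. -/
theorem exists_xBound_U (hn : (N : ℝ) < 2 * n) (hk : (N : ℝ) < 2 * k) (m : ℕ) :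
    ∃ A : ℝ≥0∞, A < ∞ ∧ ∀ (M : ℝ≥0∞) (u : L2 N) (t : ℝ), |t| ≤ 1 → M < ∞ → XBound k m n M u →
      XBound k m n (A * M) (U t u) ∧
      ∀ l : List (Fin N), l.length ≤ 2 * m →
        weightedNorm ∞ n (dl l ((U t u - u : L2 N) : 𝓢'(Space N, ℂ))) ≤
          ENNReal.ofReal |t| * (A * M) := by
  obtain ⟨C, hC, hhigh⟩ := exists_high_U N k m n
  obtain ⟨B, hB, hlow⟩ := exists_top_U (m := m) hn hk (2 * m + 1)
  refine ⟨C + B + N * B, ?_, fun M u t ht hM hu => ⟨⟨fun l hl => ?_, fun l h1 h2 => ?_⟩, fun l hl => ?_⟩⟩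
  · exact ENNReal.add_lt_top.mpr ⟨ENNReal.add_lt_top.mpr ⟨hC, hB⟩,
      ENNReal.mul_lt_top (ENNReal.natCast_lt_top N) hB⟩
  · refine (hlow M u t ht hM hu l (by omega) (by omega)).trans ?_
    gcongr
    exact le_add_self.trans le_self_add
  · refine (hhigh M u t ht hu l h1 h2).trans ?_
    gcongr
    exact le_self_add.trans le_self_add
  · refine (weightedNorm_top_U_sub_le hn hu hM hl (B := B * M) fun s hs i => ?_).trans ?_
    · have h3 : |s - 0| ≤ |t - 0| := Set.abs_sub_left_of_mem_uIcc hs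
      simp only [sub_zero] at h3
      exact hlow M u s (h3.trans ht) hM hu _ (by simp only [List.length_cons]; omega) (by simp only [List.length_cons]; omega)
    · refine mul_le_mul' le_rfl ?_
      rw [← mul_assoc]
      exact mul_le_mul' le_add_self le_rfl

theorem tendsto_normX_of_words {ι : Type*} {F : Filter ι} {f : ι → L2 N}
    (hlow : ∀ l : List (Fin N), l.length ≤ 2 * m →
      Tendsto (fun i => weightedNorm ∞ n (dl l (f i : 𝓢'(Space N, ℂ)))) F (𝓝 0))
    (hhigh : ∀ l : List (Fin N), 2 * m < l.length → l.length ≤ J k m n →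
      Tendsto (fun i => weightedNorm 2 (wt k m n l.length) (dl l (f i : 𝓢'(Space N, ℂ)))) F (𝓝 0)) :
    Tendsto (fun i => normX k m n (f i)) F (𝓝 0) := by
  have key : ∀ {j : ℕ} {p : ℝ≥0∞} {a : ℕ},
      (∀ s : Fin j → Fin N, Tendsto (fun i => weightedNorm p a (D s (f i))) F (𝓝 0)) →
      Tendsto (fun i => ⨆ s : Fin j → Fin N, weightedNorm p a (D s (f i))) F (𝓝 0) := by
    intro j p a hs
    have h1 := tendsto_finsetSum (Finset.univ : Finset (Fin j → Fin N)) fun s _ => hs s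
    rw [Finset.sum_const_zero] at h1
    refine tendsto_of_tendsto_of_tendsto_of_le_of_le tendsto_const_nhds h1
      (fun _ => zero_le) (fun i => iSup_le fun s => ?_)
    exact Finset.single_le_sum (f := fun s => weightedNorm p a (D s (f i)))
      (fun _ _ => zero_le) (Finset.mem_univ s)
  have h0 : (0 : ℝ≥0∞) = (∑ _j ∈ Finset.range (2 * m + 1), 0) +
      ∑ _ν ∈ Finset.range (k + 2), ∑ _μ ∈ Finset.range (n + 1), 0 := by simp
  unfold normX
  rw [h0]
  refine Tendsto.add (tendsto_finsetSum _ fun j hj => key fun s => ?_)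
    (tendsto_finsetSum _ fun ν hν => tendsto_finsetSum _ fun μ hμ => key fun s => ?_)
  · simp only [D_eq_dl]
    exact hlow _ (by simpa using Nat.lt_succ_iff.mp (Finset.mem_range.mp hj))
  · simp only [D_eq_dl]
    rw [Finset.mem_range] at hν hμ
    refine tendsto_of_tendsto_of_tendsto_of_le_of_le tendsto_const_nhds
      (hhigh (List.ofFn s) (by rw [List.length_ofFn]; omega) (by simp; unfold J; omega)) (fun _ => zero_le)
      (fun i => weightedNorm_mono 2 ?_ _)
    simp only [List.length_ofFn]
    unfold wt J
    omega

/-- The Schrödinger group is strongly continuous on `X`. -/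
theorem tendsto_normX_U_sub (hn : (N : ℝ) < 2 * n) (hk : (N : ℝ) < 2 * k) {M : ℝ≥0∞} (hM : M < ∞)
    {u : L2 N} (hu : XBound k m n M u) :
    Tendsto (fun h => normX k m n (U h u - u)) (𝓝 0) (𝓝 0) := by
  obtain ⟨A, hA, hAU⟩ := exists_xBound_U hn hk m
  refine tendsto_normX_of_words (fun l hl => ?_) (fun l h1 h2 => ?_)
  · have h0 : Tendsto (fun h : ℝ => ENNReal.ofReal |h| * (A * M)) (𝓝 0) (𝓝 0) := by
      have h3 : Tendsto (fun h : ℝ => ENNReal.ofReal |h|) (𝓝 0) (𝓝 0) := by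
        have : Continuous (fun h : ℝ => ENNReal.ofReal |h|) :=
          ENNReal.continuous_ofReal.comp continuous_abs
        simpa using this.tendsto 0
      simpa using ENNReal.Tendsto.mul_const h3 (Or.inr (ENNReal.mul_lt_top hA hM).ne)
    refine tendsto_of_tendsto_of_tendsto_of_le_of_le' tendsto_const_nhds h0
      (Eventually.of_forall fun _ => zero_le) ?_
    filter_upwards [Metric.closedBall_mem_nhds (0 : ℝ) one_pos] with h hh
    exact (hAU M u h (by simpa using hh) hM hu).2 l hl
  · have := tendsto_weightedNorm_UV_sub hM (hu.jointBound h1 h2)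
    refine this.congr fun h => ?_
    rw [toTD_sub, map_sub, dl_U]

end NLS

end

noncomputable section

namespace NLS

open LineDeriv FourierTransform

variable {N : ℕ}

/-! ### The power nonlinearity -/

/-- The nonlinearity `|z|^α z`. -/
def power (α : ℝ) (z : ℂ) : ℂ := ((‖z‖ ^ α : ℝ) : ℂ) * z

theorem norm_power (α : ℝ) (z : ℂ) : ‖power α z‖ = ‖z‖ ^ α * ‖z‖ := by
  rw [power, norm_mul, Complex.norm_real, Real.norm_of_nonneg (by positivity)]

theorem power_real_smul (α : ℝ) {r : ℝ} (hr : 0 ≤ r) (z : ℂ) :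
    power α (r • z) = (r ^ α * r) • power α z := by
  rw [Complex.real_smul, Complex.real_smul, power, power, norm_mul, Complex.norm_real,
    Real.norm_of_nonneg hr, Real.mul_rpow hr (norm_nonneg z)]
  push_cast
  ring

/-- Bernoulli's inequality for α ≥ 1; for α ≤ 1 simply s ≤ s^α. -/
theorem one_sub_rpow_le {α s : ℝ} (hα : 0 < α) (hs : 0 ≤ s) (hs1 : s ≤ 1) :
    1 - s ^ α ≤ (1 + α) * (1 - s) := by
  rcases le_total α 1 with h | h
  · have h1 : s ≤ s ^ α := by
      rcases hs.eq_or_lt with rfl | hs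
      · rw [Real.zero_rpow hα.ne']
      · simpa using Real.rpow_le_rpow_of_exponent_ge hs hs1 h
    nlinarith
  · have h1 := one_add_mul_self_le_rpow_one_add (s := s - 1) (by linarith) h
    rw [add_sub_cancel] at h1
    nlinarith

/-- The difference of the powers is multiplied by the larger number `b`; homogeneity reduces this to
`one_sub_rpow_le` with s = |a|/|b|. No distance from zero is required, even for α < 1. -/
theorem norm_power_sub_le {α : ℝ} (hα : 0 < α) {M : ℝ} {a b : ℂ} (ha : ‖a‖ ≤ M) (hb : ‖b‖ ≤ M) :
    ‖power α a - power α b‖ ≤ (2 + α) * M ^ α * ‖a - b‖ := by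
  wlog hab : ‖a‖ ≤ ‖b‖ generalizing a b
  · rw [norm_sub_rev (power α a), norm_sub_rev a]
    exact this hb ha (le_of_not_ge hab)
  have hM : ‖b‖ ^ α ≤ M ^ α := Real.rpow_le_rpow (norm_nonneg b) hb hα.le
  have haM : ‖a‖ ^ α ≤ M ^ α := Real.rpow_le_rpow (norm_nonneg a) ha hα.le
  rcases (norm_nonneg b).eq_or_lt with h0 | h0
  · have hb0 : b = 0 := norm_eq_zero.mp h0.symm
    have ha0 : a = 0 := norm_eq_zero.mp (le_antisymm (by rwa [h0]) (norm_nonneg a))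
    simp [ha0, hb0]
  have e1 : power α a - power α b = ((‖a‖ ^ α : ℝ) : ℂ) * (a - b) +
      ((‖a‖ ^ α - ‖b‖ ^ α : ℝ) : ℂ) * b := by
    simp only [power]; push_cast; ring
  have hd : ‖b‖ - ‖a‖ ≤ ‖a - b‖ := by
    rw [norm_sub_rev]; exact norm_sub_norm_le b a
  have key : (‖b‖ ^ α - ‖a‖ ^ α) * ‖b‖ ≤ (1 + α) * ‖b‖ ^ α * ‖a - b‖ := by
    have h1 := one_sub_rpow_le hα (s := ‖a‖ / ‖b‖) (by positivity) (by rwa [div_le_one h0])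
    rw [Real.div_rpow (norm_nonneg a) h0.le] at h1
    have hbα : 0 < ‖b‖ ^ α := Real.rpow_pos_of_pos h0 α
    have h2 : (1 - ‖a‖ ^ α / ‖b‖ ^ α) * ‖b‖ ^ α * ‖b‖ ≤
        ((1 + α) * (1 - ‖a‖ / ‖b‖)) * ‖b‖ ^ α * ‖b‖ := by gcongr
    have h3 : (1 - ‖a‖ ^ α / ‖b‖ ^ α) * ‖b‖ ^ α * ‖b‖ = (‖b‖ ^ α - ‖a‖ ^ α) * ‖b‖ := by
      field_simp
    have h4 : ((1 + α) * (1 - ‖a‖ / ‖b‖)) * ‖b‖ ^ α * ‖b‖ =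
        (1 + α) * ‖b‖ ^ α * (‖b‖ - ‖a‖) := by
      field_simp
    rw [h3, h4] at h2
    refine h2.trans ?_
    gcongr
  have hle : ‖a‖ ^ α ≤ ‖b‖ ^ α := Real.rpow_le_rpow (norm_nonneg a) hab hα.le
  calc ‖power α a - power α b‖
      ≤ ‖((‖a‖ ^ α : ℝ) : ℂ) * (a - b)‖ + ‖((‖a‖ ^ α - ‖b‖ ^ α : ℝ) : ℂ) * b‖ := by
        rw [e1]; exact norm_add_le _ _
    _ = ‖a‖ ^ α * ‖a - b‖ + (‖b‖ ^ α - ‖a‖ ^ α) * ‖b‖ := by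
        rw [norm_mul, norm_mul, Complex.norm_real, Complex.norm_real,
          Real.norm_of_nonneg (by positivity), Real.norm_eq_abs, abs_sub_comm,
          abs_of_nonneg (by linarith)]
    _ ≤ M ^ α * ‖a - b‖ + (1 + α) * M ^ α * ‖a - b‖ := by
        refine add_le_add (by gcongr) (key.trans (by gcongr))
    _ = _ := by ring

theorem contDiffAt_power (α : ℝ) {z : ℂ} (hz : z ≠ 0) : ContDiffAt ℝ (⊤ : ℕ∞) (power α) z := by
  have h1 : ContDiffAt ℝ (⊤ : ℕ∞) (fun z : ℂ => ‖z‖ ^ α) z :=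
    (contDiffAt_norm ℝ hz).rpow_const_of_ne (norm_ne_zero_iff.mpr hz)
  exact (Complex.ofRealCLM.contDiff.contDiffAt.comp z h1).mul contDiffAt_id

/-- Compactness of the annulus, which avoids the origin, the only possible singularity. -/
theorem exists_norm_iteratedFDeriv_power_le (α : ℝ) {c : ℝ} (hc : 0 < c) (K : ℝ) (j : ℕ) :
    ∃ C : ℝ, 0 ≤ C ∧ ∀ i ≤ j, ∀ z : ℂ, c ≤ ‖z‖ → ‖z‖ ≤ K →
      ‖iteratedFDeriv ℝ i (power α) z‖ ≤ C := by
  have hcomp : IsCompact {z : ℂ | c ≤ ‖z‖ ∧ ‖z‖ ≤ K} := by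
    refine (isCompact_closedBall (0 : ℂ) K).of_isClosed_subset ?_ fun z hz => by simpa using hz.2
    exact (isClosed_le continuous_const continuous_norm).inter
      (isClosed_le continuous_norm continuous_const)
  have h1 : ∀ i : ℕ, ∃ C : ℝ, 0 ≤ C ∧ ∀ z : ℂ, c ≤ ‖z‖ → ‖z‖ ≤ K →
      ‖iteratedFDeriv ℝ i (power α) z‖ ≤ C := by
    intro i
    have hcont : ContinuousOn (iteratedFDeriv ℝ i (power α)) {z : ℂ | c ≤ ‖z‖ ∧ ‖z‖ ≤ K} := by
      intro z hz
      have hz0 : z ≠ 0 := norm_ne_zero_iff.mp (hc.trans_le hz.1).ne'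
      exact ((contDiffAt_power α hz0).continuousAt_iteratedFDeriv
        (by exact_mod_cast le_top)).continuousWithinAt
    obtain ⟨C, hC⟩ := hcomp.exists_bound_of_continuousOn hcont
    exact ⟨max C 0, le_max_right _ _, fun z h1 h2 => (hC z ⟨h1, h2⟩).trans (le_max_left _ _)⟩
  choose C hC0 hC using h1
  refine ⟨∑ i ∈ Finset.range (j + 1), C i, Finset.sum_nonneg fun i _ => hC0 i, fun i hi z h1 h2 => ?_⟩
  exact (hC i z h1 h2).trans (Finset.single_le_sum (f := C) (fun i _ => hC0 i)
    (Finset.mem_range.mpr (by omega)))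

/-! ### The nonlinearity on `L²` -/

open Classical in
/-- The map `u ↦ |u|^α u` on `L²`, with value `0` where it does not take values in `L²`. -/
def powerL2 (α : ℝ) (u : L2 N) : L2 N :=
  if h : MemLp (fun x => power α (u x)) 2 volume then h.toLp _ else 0

theorem continuous_power {α : ℝ} (hα : 0 < α) : Continuous (power α) := by
  unfold power
  have : Continuous fun z : ℂ => ‖z‖ ^ α := continuous_norm.rpow_const fun _ => Or.inr hα.le
  fun_prop

theorem memLp_power {α : ℝ} (hα : 0 < α) {M : ℝ} {u : L2 N} (hu : ∀ᵐ x, ‖u x‖ ≤ M) :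
    MemLp (fun x => power α (u x)) 2 volume := by
  refine MemLp.of_le_mul (g := u) (c := M ^ α) (Lp.memLp u)
    ((continuous_power hα).comp_aestronglyMeasurable (Lp.aestronglyMeasurable u)) ?_
  filter_upwards [hu] with x hx
  rw [norm_power]
  gcongr

theorem powerL2_coe {α : ℝ} (hα : 0 < α) {M : ℝ} {u : L2 N} (hu : ∀ᵐ x, ‖u x‖ ≤ M) :
    powerL2 α u =ᵐ[volume] fun x => power α (u x) := by
  rw [powerL2, dif_pos (memLp_power hα hu)]
  exact MemLp.coeFn_toLp _

theorem norm_powerL2_sub_le {α : ℝ} (hα : 0 < α) {M : ℝ} {u v : L2 N}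
    (hu : ∀ᵐ x, ‖u x‖ ≤ M) (hv : ∀ᵐ x, ‖v x‖ ≤ M) :
    ‖powerL2 α u - powerL2 α v‖ ≤ (2 + α) * M ^ α * ‖u - v‖ := by
  refine Lp.norm_le_mul_norm_of_ae_le_mul ?_
  filter_upwards [powerL2_coe hα hu, powerL2_coe hα hv, hu, hv, Lp.coeFn_sub u v,
    Lp.coeFn_sub (powerL2 α u) (powerL2 α v)] with x h1 h2 h3 h4 h5 h6
  rw [h5, h6, Pi.sub_apply, Pi.sub_apply, h1, h2]
  exact norm_power_sub_le hα h3 h4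

/-! ### Derivatives of smooth functions along words -/

/-- The classical derivative of `f` along the word `l`. -/
def cd (l : List (Fin N)) (f : Space N → ℂ) (x : Space N) : ℂ :=
  iteratedFDeriv ℝ l.length f x fun i => e (l.get i)

@[simp] theorem cd_nil (f : Space N → ℂ) : cd [] f = f := by
  ext x; simp [cd]

theorem differentiableAt_cd {f : Space N → ℂ} (hf : ContDiff ℝ (⊤ : ℕ∞) f) (l : List (Fin N)) (x : Space N) :
    DifferentiableAt ℝ (cd l f) x := by
  have h := (hf.differentiable_iteratedFDeriv (m := l.length) (by exact_mod_cast WithTop.coe_lt_top _)) x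
  exact (h.hasFDerivAt.continuousMultilinear_apply_const _).differentiableAt

theorem cd_cons {f : Space N → ℂ} (hf : ContDiff ℝ (⊤ : ℕ∞) f) (i : Fin N) (l : List (Fin N))
    (x : Space N) : cd (i :: l) f x = fderiv ℝ (cd l f) x (e i) := by
  have h := (hf.differentiable_iteratedFDeriv (m := l.length) (by exact_mod_cast WithTop.coe_lt_top _)) x
  unfold cd
  rw [fderiv_continuousMultilinear_apply_const_apply h]
  rfl

theorem contDiff_cd {f : Space N → ℂ} (hf : ContDiff ℝ (⊤ : ℕ∞) f) (l : List (Fin N)) :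
    ContDiff ℝ (⊤ : ℕ∞) (cd l f) := by
  have h : ContDiff ℝ (⊤ : ℕ∞) (iteratedFDeriv ℝ l.length f) :=
    hf.iteratedFDeriv_right (by exact_mod_cast le_top)
  exact (ContinuousMultilinearMap.apply ℝ (fun _ : Fin l.length => Space N) ℂ
    (fun i => e (l.get i))).contDiff.comp h

theorem norm_cd_le (l : List (Fin N)) (f : Space N → ℂ) (x : Space N) :
    ‖cd l f x‖ ≤ ‖iteratedFDeriv ℝ l.length f x‖ := by
  refine ((iteratedFDeriv ℝ l.length f x).le_opNorm _).trans (le_of_eq ?_)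
  simp

theorem norm_iteratedFDeriv_le_sum (j : ℕ) (f : Space N → ℂ) (x : Space N) :
    ‖iteratedFDeriv ℝ j f x‖ ≤ ∑ s : Fin j → Fin N, ‖cd (List.ofFn s) f x‖ := by
  refine ContinuousMultilinearMap.opNorm_le_bound (by positivity) fun v => ?_
  have hv : v = fun i => ∑ a : Fin N, (v i a) • e a := by
    ext i b; simp [Finset.sum_apply, Pi.single_apply, e]
  have hcd : ∀ s : Fin j → Fin N, cd (List.ofFn s) f x =
      iteratedFDeriv ℝ j f x fun i => e (s i) := by
    intro s
    -- The length of `List.ofFn s` is not definitionally `j`; generalizing it allows substitution.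
    have : ∀ (n : ℕ) (hn : n = j) (s : Fin j → Fin N) (s' : Fin n → Fin N)
        (_ : ∀ i : Fin n, s' i = s (Fin.cast hn i)),
        (iteratedFDeriv ℝ n f x fun i => e (s' i)) = iteratedFDeriv ℝ j f x fun i => e (s i) := by
      rintro n rfl s s' h
      simp only [h]
      rfl
    exact this _ List.length_ofFn s _ fun i => by simp; rfl
  conv_lhs => rw [hv]
  have h1 := (iteratedFDeriv ℝ j f x).toMultilinearMap.map_sum
    (fun (i : Fin j) (a : Fin N) => (v i a) • e a)
  simp only [ContinuousMultilinearMap.coe_coe] at h1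
  rw [h1]
  refine (norm_sum_le _ _).trans ?_
  rw [Finset.sum_mul]
  refine Finset.sum_le_sum fun s _ => ?_
  have h2 := (iteratedFDeriv ℝ j f x).toMultilinearMap.map_smul_univ
    (fun i => v i (s i)) (fun i => e (s i))
  simp only [ContinuousMultilinearMap.coe_coe] at h2
  rw [h2, norm_smul, norm_prod, mul_comm, hcd]
  gcongr with i
  exact PiLp.norm_apply_le (v i) (s i)

end NLS

end

noncomputable section

namespace NLS

open LineDeriv FourierTransform

variable {N : ℕ}

/-! ### The chain rule for the nonlinearity -/

theorem OrderedFinpartition.sum_partSize {n : ℕ} (c : OrderedFinpartition n) :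
    ∑ i, c.partSize i = n := by
  have := c.sum_sigma_eq_sum (fun _ => (1 : ℕ))
  simpa using this

/-- Two parts larger than 2m would have total size at least 4m+2. So at most one factor is large,
and the sum takes care of it. -/
theorem prod_partSize_le {m j : ℕ} (hj : j ≤ 4 * m + 1) (c : OrderedFinpartition j) {a : ℕ → ℝ}
    (ha : ∀ i, 0 ≤ a i) {K : ℝ} (hK : 1 ≤ K) (haK : ∀ i ≤ 2 * m, a i ≤ K) :
    ∏ i, a (c.partSize i) ≤ K ^ j * (1 + ∑ i ∈ Finset.Ioc (2 * m) j, a i) := by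
  have hsum := OrderedFinpartition.sum_partSize c
  have hnn : 0 ≤ ∑ i ∈ Finset.Ioc (2 * m) j, a i := Finset.sum_nonneg fun i _ => ha i
  have hlen := c.length_le
  by_cases h : ∃ i₀, 2 * m < c.partSize i₀
  · obtain ⟨i₀, hi₀⟩ := h
    have hsmall : ∀ i ∈ Finset.univ.erase i₀, a (c.partSize i) ≤ K := by
      intro i hi
      refine haK _ ?_
      have h1 : c.partSize i + c.partSize i₀ ≤ ∑ i, c.partSize i := by
        rw [← Finset.sum_pair (Finset.ne_of_mem_erase hi)]
        exact Finset.sum_le_sum_of_subset (Finset.subset_univ _)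
      omega
    rw [← Finset.mul_prod_erase Finset.univ _ (Finset.mem_univ i₀)]
    have h2 : ∏ i ∈ Finset.univ.erase i₀, a (c.partSize i) ≤ K ^ j := by
      refine (Finset.prod_le_prod (fun i _ => ha _) hsmall).trans ?_
      rw [Finset.prod_const]
      refine pow_le_pow_right₀ hK ?_
      rw [Finset.card_erase_of_mem (Finset.mem_univ _)]
      simp only [Finset.card_univ, Fintype.card_fin]
      omega
    have h3 : a (c.partSize i₀) ≤ ∑ i ∈ Finset.Ioc (2 * m) j, a i :=
      Finset.single_le_sum (f := a) (fun i _ => ha i)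
        (Finset.mem_Ioc.mpr ⟨hi₀, c.partSize_le i₀⟩)
    rw [mul_comm]
    refine mul_le_mul h2 (by linarith) (ha _) (by positivity)
  · push Not at h
    have h2 : ∏ i, a (c.partSize i) ≤ K ^ j := by
      refine (Finset.prod_le_prod (fun i _ => ha _) fun i _ => haK _ (h i)).trans ?_
      rw [Finset.prod_const]
      exact pow_le_pow_right₀ hK (by simpa using hlen)
    have h3 : 0 ≤ K ^ j := by positivity
    nlinarith

theorem norm_iteratedFDeriv_comp_le_sum {g : ℂ → ℂ} {f : Space N → ℂ} {x : Space N}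
    (hg : ContDiffAt ℝ (⊤ : ℕ∞) g (f x)) (hf : ContDiff ℝ (⊤ : ℕ∞) f) (j : ℕ) :
    ‖iteratedFDeriv ℝ j (g ∘ f) x‖ ≤ ∑ c : OrderedFinpartition j,
      ‖iteratedFDeriv ℝ c.length g (f x)‖ * ∏ i, ‖iteratedFDeriv ℝ (c.partSize i) f x‖ := by
  rw [iteratedFDeriv_comp hg hf.contDiffAt (by exact_mod_cast le_top)]
  refine (norm_sum_le _ _).trans (Finset.sum_le_sum fun c _ => ?_)
  exact c.norm_compAlongOrderedFinpartition_le _ _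

/-- Derivatives of `|f|^α f` where `|f|` is comparable with `r`: at most one factor can be a
derivative of order greater than `2m`. -/
theorem exists_norm_iteratedFDeriv_power_comp_le (N : ℕ) (α : ℝ) {c : ℝ} (hc : 0 < c) {K : ℝ} (hK : 1 ≤ K)
    (m : ℕ) : ∃ C : ℝ, 0 ≤ C ∧ ∀ (f : Space N → ℂ) (x : Space N) (r : ℝ), ContDiff ℝ (⊤ : ℕ∞) f →
      0 < r → c * r ≤ ‖f x‖ → (∀ i ≤ 2 * m, ‖iteratedFDeriv ℝ i f x‖ ≤ K * r) →
      ∀ j ≤ 4 * m + 1, ‖iteratedFDeriv ℝ j (fun y => power α (f y)) x‖ ≤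
        C * (r ^ α * (r + ∑ i ∈ Finset.Ioc (2 * m) j, ‖iteratedFDeriv ℝ i f x‖)) := by
  obtain ⟨A, hA0, hA⟩ := exists_norm_iteratedFDeriv_power_le α hc K (4 * m + 1)
  refine ⟨∑ j ∈ Finset.range (4 * m + 2), ∑ _c : OrderedFinpartition j, A * K ^ j,
    Finset.sum_nonneg fun j _ => Finset.sum_nonneg fun _ _ => by positivity,
    fun f x r hf hr hcf hfK j hj => ?_⟩
  -- Rescaling puts the value at `x` into the annulus between `c` and `K`, uniformly in `r`;
  -- homogeneity of degree α+1 restores the factor at the end.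
  have hg : ContDiff ℝ (⊤ : ℕ∞) (r⁻¹ • f) := hf.const_smul r⁻¹
  have hgd : ∀ i, ‖iteratedFDeriv ℝ i (r⁻¹ • f) x‖ = r⁻¹ * ‖iteratedFDeriv ℝ i f x‖ := fun i => by
    rw [iteratedFDeriv_const_smul_apply (hf.contDiffAt.of_le (by exact_mod_cast le_top)), norm_smul,
      Real.norm_of_nonneg (by positivity)]
  have hgx : ‖(r⁻¹ • f) x‖ = r⁻¹ * ‖f x‖ := by
    simpa using hgd 0
  have hgc : c ≤ ‖(r⁻¹ • f) x‖ := by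
    rw [hgx, inv_mul_eq_div, le_div_iff₀ hr]; exact hcf
  have hgK : ∀ i ≤ 2 * m, ‖iteratedFDeriv ℝ i (r⁻¹ • f) x‖ ≤ K := fun i hi => by
    rw [hgd, inv_mul_eq_div, div_le_iff₀ hr]; exact hfK i hi
  have hg0 : (r⁻¹ • f) x ≠ 0 := norm_ne_zero_iff.mp (hc.trans_le hgc).ne'
  have hscale : (fun y => power α (f y)) = (r ^ α * r) • (power α ∘ (r⁻¹ • f)) := by
    ext y
    simp only [Pi.smul_apply, Function.comp]
    rw [← power_real_smul α hr.le, smul_smul, mul_inv_cancel₀ hr.ne', one_smul]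
  have hpow := contDiffAt_power α hg0
  rw [hscale, iteratedFDeriv_const_smul_apply
    (((hpow.comp x hg.contDiffAt)).of_le (by exact_mod_cast le_top)), norm_smul,
    Real.norm_of_nonneg (by positivity)]
  have h1 : ‖iteratedFDeriv ℝ j (power α ∘ (r⁻¹ • f)) x‖ ≤ ∑ _c : OrderedFinpartition j,
      A * K ^ j * (1 + ∑ i ∈ Finset.Ioc (2 * m) j, ‖iteratedFDeriv ℝ i (r⁻¹ • f) x‖) := by
    refine (norm_iteratedFDeriv_comp_le_sum hpow hg j).trans (Finset.sum_le_sum fun p _ => ?_)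
    rw [mul_assoc]
    refine mul_le_mul (hA _ (p.length_le.trans hj) _ hgc ?_)
      (prod_partSize_le (a := fun i => ‖iteratedFDeriv ℝ i (r⁻¹ • f) x‖) hj p
        (fun _ => norm_nonneg _) hK hgK) (Finset.prod_nonneg fun _ _ => norm_nonneg _) hA0
    simpa using hgK 0 (by omega)
  rw [← Finset.sum_mul] at h1
  have h2 : ∑ _c : OrderedFinpartition j, A * K ^ j ≤
      ∑ j ∈ Finset.range (4 * m + 2), ∑ _c : OrderedFinpartition j, A * K ^ j :=
    Finset.single_le_sum (f := fun j => ∑ _c : OrderedFinpartition j, A * K ^ j)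
      (fun j _ => Finset.sum_nonneg fun _ _ => by positivity) (Finset.mem_range.mpr (by omega))
  have h3 : r * (1 + ∑ i ∈ Finset.Ioc (2 * m) j, ‖iteratedFDeriv ℝ i (r⁻¹ • f) x‖) =
      r + ∑ i ∈ Finset.Ioc (2 * m) j, ‖iteratedFDeriv ℝ i f x‖ := by
    simp only [hgd, ← Finset.mul_sum]
    rw [mul_add, mul_one, ← mul_assoc, mul_inv_cancel₀ hr.ne', one_mul]
  have h4 : 0 ≤ 1 + ∑ i ∈ Finset.Ioc (2 * m) j, ‖iteratedFDeriv ℝ i (r⁻¹ • f) x‖ :=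
    add_nonneg zero_le_one (Finset.sum_nonneg fun _ _ => norm_nonneg _)
  calc r ^ α * r * ‖iteratedFDeriv ℝ j (power α ∘ (r⁻¹ • f)) x‖ ≤ r ^ α * r *
        ((∑ j ∈ Finset.range (4 * m + 2), ∑ _c : OrderedFinpartition j, A * K ^ j) *
        (1 + ∑ i ∈ Finset.Ioc (2 * m) j, ‖iteratedFDeriv ℝ i (r⁻¹ • f) x‖)) := by
        gcongr
        exact h1.trans (mul_le_mul_of_nonneg_right h2 h4)
    _ = _ := by rw [← h3]; ring

/-! ### Classical and distributional derivatives -/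

/-- The distributional derivatives of a smooth function are its classical derivatives. -/
theorem dl_apply_eq_integral {u : L2 N} {f : Space N → ℂ} (hf : ContDiff ℝ (⊤ : ℕ∞) f)
    (huf : u =ᵐ[volume] f) {j : ℕ}
    (hb : ∀ l : List (Fin N), l.length ≤ j → MemLp (cd l f) 2 volume)
    (l : List (Fin N)) (hl : l.length ≤ j) (ψ : 𝓢(Space N, ℂ)) :
    dl l (u : 𝓢'(Space N, ℂ)) ψ = ∫ x, ψ x * cd l f x := by
  have hint : ∀ (l : List (Fin N)), l.length ≤ j → ∀ ψ : 𝓢(Space N, ℂ),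
      Integrable (fun x => ψ x * cd l f x) volume := fun l hl ψ =>
    (ψ.memLp 2 volume).integrable_mul (hb l hl)
  induction l generalizing ψ with
  | nil =>
    rw [dl_nil, Lp.toTemperedDistribution_apply]
    refine integral_congr_ae ?_
    filter_upwards [huf] with x hx
    simp [hx]
  | cons i l ih =>
    have hl' : l.length ≤ j := by simp at hl; omega
    have hcons : ∀ x, cd (i :: l) f x = fderiv ℝ (cd l f) x (e i) := cd_cons hf i l
    rw [dl_cons, TemperedDistribution.lineDerivOp_apply_apply, ih hl']
    have key := integral_mul_fderiv_eq_neg_fderiv_mul_of_integrable (μ := (volume : Measure (Space N)))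
      (f := cd l f) (g := ψ) (v := e i) (𝕜 := ℂ) ?_ ?_ ?_ (fun x _ => differentiableAt_cd hf l x)
      (fun x _ => ψ.differentiable x)
    · have e1 : ∀ x, (-∂_{e i} ψ : 𝓢(Space N, ℂ)) x * cd l f x = -(cd l f x * fderiv ℝ ψ x (e i)) := by
        intro x
        rw [_root_.neg_apply, SchwartzMap.lineDerivOp_apply_eq_fderiv]; ring
      simp only [e1, integral_neg, key, neg_neg]
      refine integral_congr_ae (Eventually.of_forall fun x => ?_)
      simp only [hcons]; ring
    · refine (hint (i :: l) hl ψ).congr (Eventually.of_forall fun x => ?_)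
      simp only [hcons]; ring
    · refine (hint l hl' (∂_{e i} ψ)).congr (Eventually.of_forall fun x => ?_)
      simp only [SchwartzMap.lineDerivOp_apply_eq_fderiv]; ring
    · exact (hint l hl' ψ).congr (Eventually.of_forall fun x => mul_comm _ _)

/-- Weighted norms of smooth functions can be computed with their classical derivatives. -/
theorem weightedNorm_dl_of_smooth {u : L2 N} {f : Space N → ℂ} (hf : ContDiff ℝ (⊤ : ℕ∞) f)
    (huf : u =ᵐ[volume] f) {j : ℕ}
    (hb : ∀ l : List (Fin N), l.length ≤ j → MemLp (cd l f) 2 volume)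
    {l : List (Fin N)} (hl : l.length ≤ j) (p : ℝ≥0∞) (a : ℕ) :
    weightedNorm p a (dl l (u : 𝓢'(Space N, ℂ))) =
      eLpNorm (fun x => ((bracket x ^ a : ℝ) : ℂ) * cd l f x) p volume := by
  have h : dl l (u : 𝓢'(Space N, ℂ)) = (((hb l hl).toLp _ : L2 N) : 𝓢'(Space N, ℂ)) := by
    ext ψ
    rw [dl_apply_eq_integral hf huf hb l hl, toTD_apply_toLp]
    rfl
  rw [h, weightedNorm_coe]
  refine eLpNorm_congr_ae ?_
  filter_upwards [(hb l hl).coeFn_toLp] with x hx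
  rw [hx]

end NLS

end

noncomputable section

namespace NLS

open LineDeriv FourierTransform

variable {N : ℕ}

/-! ### Mollification -/

/-- Mollification by a normalized bump function. -/
def moll (ρ : ContDiffBump (0 : Space N)) (g : Space N → ℂ) : Space N → ℂ :=
  convolution (ρ.normed volume) g (ContinuousLinearMap.lsmul ℝ ℝ) volume

variable (ρ : ContDiffBump (0 : Space N))

theorem moll_apply (g : Space N → ℂ) (x : Space N) :
    moll ρ g x = ∫ t, ρ.normed volume t • g (x - t) := rfl

theorem moll_eq_swap (g : Space N → ℂ) (x : Space N) :
    moll ρ g x = ∫ y, ρ.normed volume (x - y) • g y := by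
  rw [moll, convolution_eq_swap]
  rfl

theorem locallyIntegrable_coe (g : L2 N) : LocallyIntegrable g volume :=
  (Lp.memLp g).locallyIntegrable (by norm_num)

theorem contDiff_moll (g : L2 N) : ContDiff ℝ (⊤ : ℕ∞) (moll ρ g) :=
  ρ.hasCompactSupport_normed.contDiff_convolution_left _ ρ.contDiff_normed (locallyIntegrable_coe g)

theorem hasCompactSupport_bump (x : Space N) :
    HasCompactSupport fun y => ((ρ.normed volume (x - y) : ℝ) : ℂ) := by
  have h1 := ρ.hasCompactSupport_normed (μ := (volume : Measure (Space N)))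
  have h2 := h1.comp_homeomorph (Homeomorph.subLeft x)
  exact h2.comp_left (g := fun r : ℝ => (r : ℂ)) (by simp)

theorem contDiff_bump (x : Space N) :
    ContDiff ℝ (⊤ : ℕ∞) fun y => ((ρ.normed volume (x - y) : ℝ) : ℂ) :=
  Complex.ofRealCLM.contDiff.comp (ρ.contDiff_normed.comp (contDiff_const.sub contDiff_id))

/-- The test function `y ↦ ρ (x - y)`. -/
def bumpTest (x : Space N) : 𝓢(Space N, ℂ) :=
  (hasCompactSupport_bump ρ x).toSchwartzMap (contDiff_bump ρ x)

/-- Seeing mollification as a pairing with a test function transfers distributional derivatives of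
`g` to classical derivatives of its mollification. -/
theorem toTD_bumpTest (g : L2 N) (x : Space N) :
    (g : 𝓢'(Space N, ℂ)) (bumpTest ρ x) = moll ρ g x := by
  rw [Lp.toTemperedDistribution_apply, moll_eq_swap]
  rfl

theorem lineDeriv_bumpTest (x v y : Space N) :
    (∂_{v} (bumpTest ρ x)) y = -((fderiv ℝ (ρ.normed volume) (x - y) v : ℝ) : ℂ) := by
  rw [SchwartzMap.lineDerivOp_apply_eq_fderiv]
  have h1 : HasFDerivAt (ρ.normed volume) (fderiv ℝ (ρ.normed volume) (x - y)) (x - y) :=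
    (ρ.contDiff_normed (n := 1).differentiable (by norm_num) _).hasFDerivAt
  have h2 := (Complex.ofRealCLM.hasFDerivAt.comp y
    (h1.comp y ((hasFDerivAt_const x y).sub (hasFDerivAt_id y)))).fderiv
  have h3 : (bumpTest ρ x : Space N → ℂ) =
      Complex.ofRealCLM ∘ (ρ.normed volume ∘ HSub.hSub x) := by
    ext y; rfl
  rw [h3, h2]
  simp

theorem fderiv_moll (g : L2 N) (x v : Space N) :
    fderiv ℝ (moll ρ g) x v = ∫ y, fderiv ℝ (ρ.normed volume) (x - y) v • g y := by
  have hc := ρ.hasCompactSupport_normed (μ := (volume : Measure (Space N)))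
  have h1 := hc.hasFDerivAt_convolution_left (ContinuousLinearMap.lsmul ℝ ℝ)
    (ρ.contDiff_normed (n := 1)) (locallyIntegrable_coe g) x
  have h2 : fderiv ℝ (moll ρ g) x = _ := h1.fderiv
  have hex : ConvolutionExistsAt (fderiv ℝ (ρ.normed volume)) g x
      ((ContinuousLinearMap.lsmul ℝ ℝ).precompL (Space N)) volume :=
    (hc.fderiv ℝ).convolutionExists_left _
      (ρ.contDiff_normed (n := 1).continuous_fderiv (by norm_num)) (locallyIntegrable_coe g) x
  rw [h2, convolution_eq_swap, ContinuousLinearMap.integral_apply]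
  · rfl
  · exact hex.integrable_swap

theorem fderiv_moll_of_eq {g h : L2 N} {v : Space N}
    (hh : (h : 𝓢'(Space N, ℂ)) = ∂_{v} (g : 𝓢'(Space N, ℂ))) (x : Space N) :
    fderiv ℝ (moll ρ g) x v = moll ρ h x := by
  rw [← toTD_bumpTest, hh, TemperedDistribution.lineDerivOp_apply_apply,
    Lp.toTemperedDistribution_apply, fderiv_moll]
  refine integral_congr_ae (Eventually.of_forall fun y => ?_)
  simp only [_root_.neg_apply, lineDeriv_bumpTest, neg_neg, Complex.real_smul, smul_eq_mul]

/-- Mollification commutes with derivatives. -/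
theorem cd_moll {u : L2 N} {j : ℕ} (hex : ∀ l : List (Fin N), l.length ≤ j →
      ∃ g : L2 N, (g : 𝓢'(Space N, ℂ)) = dl l (u : 𝓢'(Space N, ℂ)))
    {l : List (Fin N)} (hl : l.length ≤ j) {g : L2 N}
    (hg : (g : 𝓢'(Space N, ℂ)) = dl l (u : 𝓢'(Space N, ℂ))) : cd l (moll ρ u) = moll ρ g := by
  induction l generalizing g with
  | nil =>
    rw [dl_nil] at hg
    rw [cd_nil, toTD_inj hg]
  | cons i l ih =>
    have hl' : l.length ≤ j := by simp at hl; omega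
    obtain ⟨h, hh⟩ := hex l hl'
    ext x
    rw [cd_cons (contDiff_moll ρ u), ih hl' hh]
    exact fderiv_moll_of_eq ρ (by rw [hg, hh, dl_cons]) x

theorem bracket_le_two_mul {x t : Space N} (ht : ‖t‖ ≤ 1) : bracket x ≤ 2 * bracket (x - t) := by
  have h1 := bracket_sq x
  have h2 := bracket_sq (x - t)
  have h3 : ‖x‖ ≤ ‖x - t‖ + 1 := by
    have := norm_add_le (x - t) t
    rw [sub_add_cancel] at this
    linarith
  have h4 := bracket_pos (x - t)
  have h5 : ‖x‖ ^ 2 ≤ (‖x - t‖ + 1) ^ 2 := by gcongr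
  have h6 : bracket x ^ 2 ≤ (2 * bracket (x - t)) ^ 2 := by
    nlinarith [sq_nonneg (‖x - t‖ - 1)]
  exact le_of_sq_le_sq h6 (by positivity)

/-- The probability measure with density `ρ`. -/
def bumpMeasure : Measure (Space N) :=
  volume.withDensity fun t => ENNReal.ofReal (ρ.normed volume t)

theorem measurable_ofReal_normed :
    Measurable fun t => ENNReal.ofReal (ρ.normed (volume : Measure (Space N)) t) :=
  (ρ.continuous_normed.measurable).ennreal_ofReal

instance : IsProbabilityMeasure (bumpMeasure ρ) where
  measure_univ := by
    rw [bumpMeasure, withDensity_apply _ MeasurableSet.univ, Measure.restrict_univ,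
      ← ofReal_integral_eq_lintegral_ofReal ρ.integrable_normed
        (Eventually.of_forall ρ.nonneg_normed), ρ.integral_normed, ENNReal.ofReal_one]

theorem normed_eq_zero {t : Space N} (h1 : ρ.rOut ≤ 1) (ht : ¬‖t‖ ≤ 1) : ρ.normed volume t = 0 := by
  have : t ∉ Function.support (ρ.normed volume) := by
    rw [ρ.support_normed_eq]
    simp only [Metric.mem_ball, dist_zero_right]
    linarith
  simpa using this

/-- On the support of the bump ⟨x⟩ ≤ 2⟨x - t⟩, so the weight can be taken under the average. -/
theorem enorm_weight_moll_le (h1 : ρ.rOut ≤ 1) (a : ℕ) (g : Space N → ℂ) (x : Space N) :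
    ‖((bracket x ^ a : ℝ) : ℂ) * moll ρ g x‖ₑ ≤
      2 ^ a * ∫⁻ t, ‖((bracket (x - t) ^ a : ℝ) : ℂ) * g (x - t)‖ₑ ∂bumpMeasure ρ := by
  rw [enorm_mul, moll_apply]
  have hb : ∀ y : Space N, ‖((bracket y ^ a : ℝ) : ℂ)‖ₑ = ENNReal.ofReal (bracket y ^ a) := fun y => by
    rw [← ofReal_norm, Complex.norm_real, Real.norm_of_nonneg (pow_nonneg (bracket_pos y).le a)]
  have h2 := enorm_integral_le_lintegral_enorm (μ := volume)
    (f := fun t => ρ.normed volume t • g (x - t))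
  refine (mul_le_mul' le_rfl h2).trans ?_
  rw [hb, ← lintegral_const_mul' _ _ ENNReal.ofReal_ne_top,
    ← lintegral_const_mul' _ _ (by simp)]
  rw [bumpMeasure, lintegral_withDensity_eq_lintegral_mul_non_measurable _
    (measurable_ofReal_normed ρ) (Eventually.of_forall fun _ => ENNReal.ofReal_lt_top)]
  refine lintegral_mono fun t => ?_
  simp only [Pi.mul_apply]
  rw [enorm_smul, enorm_mul, hb, Real.enorm_of_nonneg (ρ.nonneg_normed t)]
  by_cases ht : ‖t‖ ≤ 1
  · have h3 : ENNReal.ofReal (bracket x ^ a) ≤ 2 ^ a * ENNReal.ofReal (bracket (x - t) ^ a) := by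
      rw [show (2 : ℝ≥0∞) ^ a = ENNReal.ofReal (2 ^ a) by
        rw [ENNReal.ofReal_pow (by norm_num)]; norm_num, ← ENNReal.ofReal_mul (by positivity),
        ← mul_pow]
      refine ENNReal.ofReal_le_ofReal ?_
      have := bracket_pos x
      gcongr
      exact bracket_le_two_mul ht
    calc _ ≤ (2 ^ a * ENNReal.ofReal (bracket (x - t) ^ a)) *
          (ENNReal.ofReal (ρ.normed volume t) * ‖g (x - t)‖ₑ) := by gcongr
      _ = _ := by ring
  · simp [normed_eq_zero ρ h1 ht]

theorem bracket_pow_mul_norm_moll_le (h1 : ρ.rOut ≤ 1) {a : ℕ} {g : Space N → ℂ} {B : ℝ} (hB : 0 ≤ B)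
    (hg : ∀ᵐ x, bracket x ^ a * ‖g x‖ ≤ B) (x : Space N) :
    bracket x ^ a * ‖moll ρ g x‖ ≤ 2 ^ a * B := by
  have h2 := enorm_weight_moll_le ρ h1 a g x
  have hw : ∀ (y : Space N) (z : ℂ), ‖((bracket y ^ a : ℝ) : ℂ) * z‖ₑ =
      ENNReal.ofReal (bracket y ^ a * ‖z‖) := fun y z => by
    rw [← ofReal_norm, norm_mul, Complex.norm_real,
      Real.norm_of_nonneg (pow_nonneg (bracket_pos y).le a)]
  have h3 : ∫⁻ t, ‖((bracket (x - t) ^ a : ℝ) : ℂ) * g (x - t)‖ₑ ∂bumpMeasure ρ ≤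
      ENNReal.ofReal B := by
    have h4 : ∀ᵐ t ∂bumpMeasure ρ, ‖((bracket (x - t) ^ a : ℝ) : ℂ) * g (x - t)‖ₑ ≤
        ENNReal.ofReal B := by
      refine (withDensity_absolutelyContinuous _ _).ae_le ?_
      filter_upwards [(Measure.measurePreserving_sub_left (volume : Measure (Space N)) x).quasiMeasurePreserving.ae hg] with t ht
      rw [hw]
      exact ENNReal.ofReal_le_ofReal ht
    refine (lintegral_mono_ae h4).trans (le_of_eq ?_)
    rw [lintegral_const, measure_univ, mul_one]
  have h5 := h2.trans (mul_le_mul' le_rfl h3)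
  rw [hw, show (2 : ℝ≥0∞) ^ a = ENNReal.ofReal (2 ^ a) by
    rw [ENNReal.ofReal_pow (by norm_num)]; norm_num, ← ENNReal.ofReal_mul (by positivity),
    ENNReal.ofReal_le_ofReal_iff (by positivity)] at h5
  exact h5

theorem lintegral_sq_le {Ω : Type*} [MeasurableSpace Ω] (μ : Measure Ω) [IsProbabilityMeasure μ]
    {h : Ω → ℝ≥0∞} (hh : AEMeasurable h μ) : (∫⁻ t, h t ∂μ) ^ 2 ≤ ∫⁻ t, h t ^ 2 ∂μ := by
  have h1 := ENNReal.lintegral_mul_le_Lp_mul_Lq μ Real.HolderConjugate.two_two hh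
    (aemeasurable_const (b := (1 : ℝ≥0∞)))
  simp only [Pi.mul_apply, mul_one, ENNReal.one_rpow, lintegral_const, measure_univ] at h1
  have h2 := ENNReal.rpow_le_rpow h1 (z := 2) (by norm_num)
  rw [← ENNReal.rpow_mul] at h2
  norm_num at h2
  exact h2

/-- Jensen's inequality for the probability measure `bumpMeasure ρ`, then Tonelli and translation
invariance. -/
theorem eLpNorm_weight_moll_le (h1 : ρ.rOut ≤ 1) (a : ℕ) (g : L2 N) :
    eLpNorm (fun x => ((bracket x ^ a : ℝ) : ℂ) * moll ρ g x) 2 volume ≤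
      2 ^ a * eLpNorm (fun x => ((bracket x ^ a : ℝ) : ℂ) * g x) 2 volume := by
  set h : Space N → ℝ≥0∞ := fun x => ‖((bracket x ^ a : ℝ) : ℂ) * g x‖ₑ with hh
  have hmeas : Measurable h := by
    have : Measurable fun x => ((bracket x ^ a : ℝ) : ℂ) * g x :=
      (by fun_prop : Continuous fun x : Space N => ((bracket x ^ a : ℝ) : ℂ)).measurable.mul
        (Lp.stronglyMeasurable g).measurable
    exact this.enorm
  have key : ∫⁻ x, (∫⁻ t, h (x - t) ∂bumpMeasure ρ) ^ 2 ≤ ∫⁻ x, h x ^ 2 := by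
    calc ∫⁻ x, (∫⁻ t, h (x - t) ∂bumpMeasure ρ) ^ 2
        ≤ ∫⁻ x, ∫⁻ t, h (x - t) ^ 2 ∂bumpMeasure ρ :=
          lintegral_mono fun x => lintegral_sq_le _ (by fun_prop)
      _ = ∫⁻ t, ∫⁻ x, h (x - t) ^ 2 ∂volume ∂bumpMeasure ρ :=
          lintegral_lintegral_swap (by fun_prop)
      _ = ∫⁻ t, ∫⁻ x, h x ^ 2 ∂volume ∂bumpMeasure ρ := by
          refine lintegral_congr fun t => ?_
          exact lintegral_sub_right_eq_self (fun x => h x ^ 2) t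
      _ = ∫⁻ x, h x ^ 2 := by rw [lintegral_const, measure_univ, mul_one]
  have hp : ∀ f : Space N → ℂ, eLpNorm f 2 volume = (∫⁻ x, ‖f x‖ₑ ^ 2) ^ (1 / 2 : ℝ) := fun f => by
    rw [eLpNorm_eq_lintegral_rpow_enorm_toReal (by norm_num) (by norm_num)]
    norm_num
  rw [hp, hp]
  have h2 : ∫⁻ x, ‖((bracket x ^ a : ℝ) : ℂ) * moll ρ g x‖ₑ ^ 2 ≤ (2 ^ a) ^ 2 * ∫⁻ x, h x ^ 2 := by
    refine le_trans ?_ (mul_le_mul' le_rfl key)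
    rw [← lintegral_const_mul' _ _ (by simp)]
    refine lintegral_mono fun x => ?_
    dsimp only
    rw [← mul_pow]
    gcongr
    exact enorm_weight_moll_le ρ h1 a g x
  refine (ENNReal.rpow_le_rpow h2 (by norm_num)).trans ?_
  rw [ENNReal.mul_rpow_of_nonneg _ _ (by norm_num)]
  gcongr
  rw [← ENNReal.rpow_natCast, ← ENNReal.rpow_mul]
  norm_num

end NLS

end

/-! ### Mollification in X: uniform bounds, lower bounds, convergence -/

noncomputable section

namespace NLS

open LineDeriv FourierTransform

variable {N k m n : ℕ}

theorem XBound.exists_toTD {K : ℝ} {u : L2 N} (h : XBound k m n (ENNReal.ofReal K) u)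
    (l : List (Fin N)) (hl : l.length ≤ J k m n) :
    ∃ g : L2 N, (g : 𝓢'(Space N, ℂ)) = dl l (u : 𝓢'(Space N, ℂ)) :=
  exists_toTD_of_xBound h ENNReal.ofReal_lt_top hl

theorem XBound.norm_cd_moll_le {K : ℝ} (hK : 0 ≤ K) {u : L2 N}
    (h : XBound k m n (ENNReal.ofReal K) u) {ρ : ContDiffBump (0 : Space N)} (hρ : ρ.rOut ≤ 1)
    {l : List (Fin N)} (hl : l.length ≤ 2 * m) (x : Space N) :
    bracket x ^ n * ‖cd l (moll ρ u) x‖ ≤ 2 ^ n * K := by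
  have hlJ : l.length ≤ J k m n := by unfold J; omega
  obtain ⟨g, hg⟩ := h.exists_toTD l hlJ
  rw [cd_moll ρ h.exists_toTD hlJ hg]
  have h1 := h.low l hl
  rw [← hg] at h1
  exact bracket_pow_mul_norm_moll_le ρ hρ hK (ae_le_of_weightedNorm_top hK h1) x

theorem XBound.eLpNorm_cd_moll_le {M : ℝ≥0∞} (hM : M < ∞) {u : L2 N}
    (h : XBound k m n M u) {ρ : ContDiffBump (0 : Space N)} (hρ : ρ.rOut ≤ 1)
    {l : List (Fin N)} (h1 : 2 * m < l.length) (h2 : l.length ≤ J k m n) :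
    eLpNorm (fun x => ((bracket x ^ wt k m n l.length : ℝ) : ℂ) * cd l (moll ρ u) x) 2 volume ≤
      2 ^ n * M := by
  have hex : ∀ l : List (Fin N), l.length ≤ J k m n →
      ∃ g : L2 N, (g : 𝓢'(Space N, ℂ)) = dl l (u : 𝓢'(Space N, ℂ)) :=
    fun l hl => exists_toTD_of_xBound h hM hl
  obtain ⟨g, hg⟩ := hex l h2
  rw [cd_moll ρ hex h2 hg]
  refine (eLpNorm_weight_moll_le ρ hρ _ g).trans ?_
  rw [← weightedNorm_coe, hg]
  refine mul_le_mul' ?_ (h.high l h1 h2)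
  exact pow_le_pow_right₀ (by norm_num) (min_le_left _ _)

theorem XBound.norm_iteratedFDeriv_moll_le {K : ℝ} (hK : 0 ≤ K) {u : L2 N}
    (h : XBound k m n (ENNReal.ofReal K) u) {ρ : ContDiffBump (0 : Space N)} (hρ : ρ.rOut ≤ 1)
    {j : ℕ} (hj : j ≤ 2 * m) (x : Space N) :
    ‖iteratedFDeriv ℝ j (moll ρ u) x‖ ≤ (N : ℝ) ^ j * (2 ^ n * K) * (bracket x ^ n)⁻¹ := by
  have hb : 0 < bracket x ^ n := pow_pos (bracket_pos x) n
  refine (norm_iteratedFDeriv_le_sum j _ x).trans ?_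
  refine (Finset.sum_le_sum (g := fun _ => (2 ^ n * K) * (bracket x ^ n)⁻¹) fun s _ => ?_).trans
    (le_of_eq (by simp; ring))
  rw [← div_eq_mul_inv, le_div_iff₀ hb, mul_comm]
  exact h.norm_cd_moll_le hK hρ (by simpa using hj) x

/-- A bump function of radius `r`. -/
def bump (N : ℕ) (r : ℝ) (hr : 0 < r) : ContDiffBump (0 : Space N) where
  rIn := r / 2
  rOut := r
  rIn_pos := by positivity
  rIn_lt_rOut := by linarith

theorem ae_tendsto_moll_bump (u : L2 N) : ∀ᵐ x, Tendsto
    (fun i : ℕ => moll (bump N (1 / ((i : ℝ) + 1)) Nat.one_div_pos_of_nat) u x) atTop (𝓝 (u x)) :=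
  ContDiffBump.ae_convolution_tendsto_right_of_locallyIntegrable (K := 2)
    (φ := fun i : ℕ => bump N (1 / ((i : ℝ) + 1)) Nat.one_div_pos_of_nat)
    tendsto_one_div_add_atTop_nhds_zero_nat
    (Eventually.of_forall fun i => by simp only [bump]; linarith) (locallyIntegrable_coe u)

/-- Mean value inequality on the unit ball around `x`, where weights at different points are
comparable; first derivatives are among the weighted sup norms since m ≥ 1. -/
theorem XBound.norm_moll_sub_le_dist {K : ℝ} (hK : 0 ≤ K) (hm : 1 ≤ m) {u : L2 N}
    (h : XBound k m n (ENNReal.ofReal K) u) {ρ : ContDiffBump (0 : Space N)} (hρ : ρ.rOut ≤ 1)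
    {x y : Space N} (hxy : ‖y - x‖ ≤ 1) :
    ‖moll ρ u y - moll ρ u x‖ ≤ (N * (2 ^ n * K) * 2 ^ n) * (bracket x ^ n)⁻¹ * ‖y - x‖ := by
  refine (convex_closedBall x 1).norm_image_sub_le_of_norm_fderiv_le (𝕜 := ℝ) (f := moll ρ u)
    (fun z _ => (contDiff_moll ρ u).differentiable (by simp) z) (fun z hz => ?_)
    (by simp) (by simpa [dist_eq_norm] using hxy)
  have h1 := h.norm_iteratedFDeriv_moll_le hK hρ (j := 1) (by omega) z
  rw [norm_iteratedFDeriv_one, pow_one] at h1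
  refine h1.trans ?_
  rw [mul_assoc (N * (2 ^ n * K))]
  refine mul_le_mul_of_nonneg_left ?_ (by positivity)
  have hbx : 0 < bracket x ^ n := pow_pos (bracket_pos x) n
  have hbz : 0 < bracket z ^ n := pow_pos (bracket_pos z) n
  rw [← div_eq_mul_inv, inv_le_comm₀ hbz (by positivity), inv_div, div_le_iff₀ (by positivity),
    mul_comm, ← mul_pow]
  have hb := bracket_le_two_mul (x := x) (t := x - z) (by
    simpa [dist_eq_norm, norm_sub_rev] using hz)
  rw [sub_sub_cancel] at hb
  have := bracket_pos x
  gcongr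

/-- The Lipschitz bound for mollifications is uniform in the radius, so it passes to `u` at the
points where they converge. Averaging it over the bump gives an error proportional to the radius
with the decay ⟨x⟩^{-n}, the rate of the lower bound to be preserved. -/
theorem XBound.ae_norm_moll_sub_le {K : ℝ} (hK : 0 ≤ K) (hm : 1 ≤ m) {u : L2 N}
    (h : XBound k m n (ENNReal.ofReal K) u) {ρ : ContDiffBump (0 : Space N)} (hρ : ρ.rOut ≤ 1) :
    ∀ᵐ x, ‖moll ρ u x - u x‖ ≤ (N * (2 ^ n * K) * 2 ^ n) * ρ.rOut * (bracket x ^ n)⁻¹ := by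
  have hS := ae_tendsto_moll_bump u
  set L : ℝ := N * (2 ^ n * K) * 2 ^ n with hL
  have hL0 : 0 ≤ L := by positivity
  filter_upwards [hS] with x hx
  have hlip : ∀ᵐ t, ‖ρ.normed volume t • (u (x - t) - u x)‖ ≤
      ρ.normed volume t * (L * ρ.rOut * (bracket x ^ n)⁻¹) := by
    filter_upwards [(Measure.measurePreserving_sub_left (volume : Measure (Space N)) x
      ).quasiMeasurePreserving.ae hS] with t ht
    rw [norm_smul, Real.norm_of_nonneg (ρ.nonneg_normed t)]
    by_cases h0 : ‖t‖ < ρ.rOut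
    · refine mul_le_mul_of_nonneg_left ?_ (ρ.nonneg_normed t)
      have h1 : ‖u (x - t) - u x‖ ≤ L * (bracket x ^ n)⁻¹ * ‖t‖ := by
        refine le_of_tendsto (ht.sub hx).norm (Eventually.of_forall fun i => ?_)
        have := h.norm_moll_sub_le_dist hK hm
          (ρ := bump N (1 / ((i : ℝ) + 1)) Nat.one_div_pos_of_nat) (by
            simp only [bump]
            rw [div_le_one (by positivity)]
            linarith [(Nat.cast_nonneg i : (0 : ℝ) ≤ i)]) (x := x) (y := x - t)
            (by rw [sub_sub_cancel_left, norm_neg]; linarith)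
        rwa [sub_sub_cancel_left, norm_neg] at this
      have hb : 0 < bracket x ^ n := pow_pos (bracket_pos x) n
      calc _ ≤ L * (bracket x ^ n)⁻¹ * ‖t‖ := h1
        _ ≤ L * (bracket x ^ n)⁻¹ * ρ.rOut := by gcongr
        _ = _ := by ring
    · have : ρ.normed volume t = 0 := by
        have : t ∉ Function.support (ρ.normed volume) := by
          rw [ρ.support_normed_eq]
          simpa using h0
        simpa using this
      simp [this]
  have hconv : Integrable (fun t => ρ.normed volume t • u (x - t)) volume :=
    ρ.hasCompactSupport_normed.convolutionExists_left (ContinuousLinearMap.lsmul ℝ ℝ)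
      ρ.continuous_normed (locallyIntegrable_coe u) x
  have e1 : moll ρ u x - u x = ∫ t, ρ.normed volume t • (u (x - t) - u x) := by
    simp only [smul_sub]
    rw [integral_sub hconv (ρ.integrable_normed.smul_const _), integral_smul_const,
      ρ.integral_normed, one_smul, moll_apply]
  rw [e1]
  refine (norm_integral_le_of_norm_le (ρ.integrable_normed.mul_const _) hlip).trans (le_of_eq ?_)
  rw [integral_mul_const, ρ.integral_normed, one_mul]

theorem forall_of_ae_of_isClosed {p : Space N → Prop} (hp : IsClosed {x | p x}) (h : ∀ᵐ x, p x) :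
    ∀ x, p x := by
  have h1 : {x | p x}ᶜ = ∅ := hp.isOpen_compl.eq_empty_of_measure_zero h
  intro x
  by_contra hx
  have : x ∈ {x | p x}ᶜ := hx
  rw [h1] at this
  exact this

theorem XBound.le_norm_moll {K : ℝ} (hK : 0 ≤ K) (hm : 1 ≤ m) {u : L2 N}
    (h : XBound k m n (ENNReal.ofReal K) u) {ρ : ContDiffBump (0 : Space N)} (hρ : ρ.rOut ≤ 1)
    {η : ℝ} (hη : ∀ᵐ x, η ≤ bracket x ^ n * ‖u x‖)
    (hρη : (N * (2 ^ n * K) * 2 ^ n) * ρ.rOut ≤ η / 2) (x : Space N) :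
    η / 2 ≤ bracket x ^ n * ‖moll ρ u x‖ := by
  refine forall_of_ae_of_isClosed (p := fun x => η / 2 ≤ bracket x ^ n * ‖moll ρ u x‖) ?_ ?_ x
  · have := (contDiff_moll ρ u).continuous
    exact isClosed_le continuous_const (by fun_prop)
  · filter_upwards [hη, h.ae_norm_moll_sub_le hK hm hρ] with x h1 h2
    have hb : 0 < bracket x ^ n := pow_pos (bracket_pos x) n
    have h3 : ‖u x‖ ≤ ‖moll ρ u x‖ + ‖moll ρ u x - u x‖ := by
      have := norm_sub_norm_le (u x) (moll ρ u x)
      rw [norm_sub_rev] at this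
      linarith
    have h4 : bracket x ^ n * ‖moll ρ u x - u x‖ ≤ η / 2 := by
      refine le_trans ?_ hρη
      calc _ ≤ bracket x ^ n * ((N * (2 ^ n * K) * 2 ^ n) * ρ.rOut * (bracket x ^ n)⁻¹) := by gcongr
        _ = _ := by field_simp
    nlinarith

theorem memLp_of_weight_bound (hn : (N : ℝ) < 2 * n) {f : Space N → ℂ} (hf : Continuous f) {C : ℝ}
    (h : ∀ x, bracket x ^ n * ‖f x‖ ≤ C) : MemLp f 2 volume := by
  refine MemLp.of_le_mul (c := C) (memLp_bracket_rpow (r := n) hn) hf.aestronglyMeasurable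
    (Eventually.of_forall fun x => ?_)
  have hb : 0 < bracket x ^ n := pow_pos (bracket_pos x) n
  rw [bracket_rpow_neg_natCast, Real.norm_of_nonneg (by positivity), ← div_eq_mul_inv,
    le_div_iff₀ hb, mul_comm]
  exact h x

theorem memLp_moll (ρ : ContDiffBump (0 : Space N)) (hρ : ρ.rOut ≤ 1) (u : L2 N) :
    MemLp (moll ρ u) 2 volume := by
  refine ⟨(contDiff_moll ρ u).continuous.aestronglyMeasurable, ?_⟩
  have := eLpNorm_weight_moll_le ρ hρ 0 u
  simp only [pow_zero, Complex.ofReal_one, one_mul] at this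
  exact this.trans_lt (Lp.memLp u).2

theorem XBound.tendsto_moll (hn : (N : ℝ) < 2 * n) {K : ℝ} (hK : 0 ≤ K) (hm : 1 ≤ m) {u : L2 N}
    (h : XBound k m n (ENNReal.ofReal K) u) {ρ : ℕ → ContDiffBump (0 : Space N)}
    (hρ : ∀ i, (ρ i).rOut ≤ 1) (hlim : Tendsto (fun i => (ρ i).rOut) atTop (𝓝 0)) :
    Tendsto (fun i => (memLp_moll (ρ i) (hρ i) u).toLp) atTop (𝓝 u) := by
  set L : ℝ := N * (2 ^ n * K) * 2 ^ n with hL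
  have hL0 : 0 ≤ L := by positivity
  set b : Lp ℝ 2 (volume : Measure (Space N)) := (memLp_bracket_rpow (r := n) hn).toLp with hb
  rw [tendsto_iff_norm_sub_tendsto_zero]
  have h0 : Tendsto (fun i => L * (ρ i).rOut * ‖b‖) atTop (𝓝 0) := by
    simpa using (hlim.const_mul L).mul_const ‖b‖
  refine squeeze_zero (fun _ => norm_nonneg _) (fun i => ?_) h0
  refine Lp.norm_le_mul_norm_of_ae_le_mul ?_
  filter_upwards [h.ae_norm_moll_sub_le hK hm (hρ i), (memLp_moll (ρ i) (hρ i) u).coeFn_toLp,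
    Lp.coeFn_sub (memLp_moll (ρ i) (hρ i) u).toLp u, (memLp_bracket_rpow (r := n) hn).coeFn_toLp]
    with x h1 h2 h3 h4
  rw [h3, Pi.sub_apply, h2, h4, bracket_rpow_neg_natCast, norm_inv,
    Real.norm_of_nonneg (pow_nonneg (bracket_pos x).le n)]
  exact h1

end NLS

end

noncomputable section

namespace NLS

open LineDeriv FourierTransform

variable {N k m n : ℕ}

/-! ### The nonlinearity on `X` -/

theorem wt_antitone (k m n : ℕ) {i j : ℕ} (h : i ≤ j) : wt k m n j ≤ wt k m n i := by
  unfold wt; omega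

theorem inv_bracket_pow_rpow (n : ℕ) (α : ℝ) (x : Space N) :
    ((bracket x ^ n)⁻¹) ^ α = bracket x ^ (-(n * α)) := by
  have hb := bracket_pos x
  rw [← Real.rpow_natCast, ← Real.rpow_neg hb.le, ← Real.rpow_mul hb.le]
  congr 1; ring

theorem contDiff_power_comp (α : ℝ) {f : Space N → ℂ} (hf : ContDiff ℝ (⊤ : ℕ∞) f)
    (h0 : ∀ x, f x ≠ 0) : ContDiff ℝ (⊤ : ℕ∞) fun y => power α (f y) :=
  contDiff_iff_contDiffAt.mpr fun x => (contDiffAt_power α (h0 x)).comp x hf.contDiffAt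

/-- Pointwise bounds for the derivatives of `|f|^α f` imply a bound in `X`. -/
theorem weight_mul_le {α : ℝ} (hα : 0 < α) {A : ℝ} (hA : 0 ≤ A) {f : Space N → ℂ}
    {l : List (Fin N)} {x : Space N}
    (h : ‖cd l (fun y => power α (f y)) x‖ ≤ A * (((bracket x ^ n)⁻¹) ^ α * ((bracket x ^ n)⁻¹ +
      ∑ i ∈ Finset.Ioc (2 * m) l.length, ‖iteratedFDeriv ℝ i f x‖))) :
    ‖((bracket x ^ wt k m n l.length : ℝ) : ℂ) * cd l (fun y => power α (f y)) x‖ ≤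
      A * (bracket x ^ (-(n * α)) + ∑ i ∈ Finset.Ioc (2 * m) l.length, ∑ s : Fin i → Fin N,
        ‖((bracket x ^ wt k m n i : ℝ) : ℂ) * cd (List.ofFn s) f x‖) := by
  have hb1 := one_le_bracket x
  have hb := bracket_pos x
  have hnw : ∀ (w : ℕ) (z : ℂ), ‖((bracket x ^ w : ℝ) : ℂ) * z‖ = bracket x ^ w * ‖z‖ := fun w z => by
    rw [norm_mul, Complex.norm_real, Real.norm_of_nonneg (pow_nonneg hb.le w)]
  simp only [hnw]
  set r := (bracket x ^ n)⁻¹ with hr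
  have hr0 : 0 < r := by positivity
  have hr1 : r ≤ 1 := inv_le_one_of_one_le₀ (one_le_pow₀ hb1)
  have hrα1 : r ^ α ≤ 1 := Real.rpow_le_one hr0.le hr1 hα.le
  have hrα : 0 < r ^ α := Real.rpow_pos_of_pos hr0 α
  rw [← inv_bracket_pow_rpow, ← hr]
  have h1 : bracket x ^ wt k m n l.length * r ≤ 1 := by
    rw [hr, ← div_eq_mul_inv, div_le_one (by positivity)]
    exact pow_le_pow_right₀ hb1 (min_le_left _ _)
  have h2 : bracket x ^ wt k m n l.length *
      ∑ i ∈ Finset.Ioc (2 * m) l.length, ‖iteratedFDeriv ℝ i f x‖ ≤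
      ∑ i ∈ Finset.Ioc (2 * m) l.length, ∑ s : Fin i → Fin N,
        bracket x ^ wt k m n i * ‖cd (List.ofFn s) f x‖ := by
    rw [Finset.mul_sum]
    refine Finset.sum_le_sum fun i hi => ?_
    rw [← Finset.mul_sum]
    refine mul_le_mul (pow_le_pow_right₀ hb1 (wt_antitone k m n (Finset.mem_Ioc.mp hi).2))
      (norm_iteratedFDeriv_le_sum i f x) (norm_nonneg _) (by positivity)
  have h3 : 0 ≤ ∑ i ∈ Finset.Ioc (2 * m) l.length, ∑ s : Fin i → Fin N,
        bracket x ^ wt k m n i * ‖cd (List.ofFn s) f x‖ :=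
    Finset.sum_nonneg fun i _ => Finset.sum_nonneg fun s _ => by positivity
  calc bracket x ^ wt k m n l.length * ‖cd l (fun y => power α (f y)) x‖
      ≤ bracket x ^ wt k m n l.length * (A * (r ^ α * (r +
      ∑ i ∈ Finset.Ioc (2 * m) l.length, ‖iteratedFDeriv ℝ i f x‖))) := by gcongr
    _ = A * (r ^ α * (bracket x ^ wt k m n l.length * r) + r ^ α * (bracket x ^ wt k m n l.length *
      ∑ i ∈ Finset.Ioc (2 * m) l.length, ‖iteratedFDeriv ℝ i f x‖)) := by ring
    _ ≤ A * (r ^ α * 1 + 1 * ∑ i ∈ Finset.Ioc (2 * m) l.length, ∑ s : Fin i → Fin N,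
        bracket x ^ wt k m n i * ‖cd (List.ofFn s) f x‖) := by
        refine mul_le_mul_of_nonneg_left (add_le_add (by gcongr) ?_) hA
        exact mul_le_mul hrα1 h2 (mul_nonneg (by positivity)
          (Finset.sum_nonneg fun _ _ => norm_nonneg _)) zero_le_one
    _ = _ := by ring

/-- The pointwise chain rule bound is applied with r = ⟨x⟩^{-n}, the lower constant being η/2
because of `XBound.le_norm_moll`. The result does not depend on the mollifier, as the limit argument
requires. -/
theorem exists_xBound_power_moll (hn : (N : ℝ) < 2 * n) {α : ℝ} (hα : 0 < α)
    (hnα : (N : ℝ) < 2 * (n * α)) (hm : k + n + 1 ≤ 2 * m) {K : ℝ} (hK : 0 ≤ K) {η : ℝ} (hη : 0 < η) :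
    ∃ C : ℝ≥0∞, C < ∞ ∧ ∀ u : L2 N, XBound k m n (ENNReal.ofReal K) u →
      (∀ᵐ x, η ≤ bracket x ^ n * ‖u x‖) → ∀ (ρ : ContDiffBump (0 : Space N)) (hρ : ρ.rOut ≤ 1),
      (N * (2 ^ n * K) * 2 ^ n) * ρ.rOut ≤ η / 2 →
      XBound k m n C (powerL2 α (memLp_moll ρ hρ u).toLp) := by
  -- One constant for all derivatives up to order 2m; the base N + 1 makes powers monotone in the
  -- exponent, and the leading 1 secures K' ≥ 1.
  set K' : ℝ := 1 + (N + 1 : ℝ) ^ (2 * m) * (2 ^ n * K) with hK'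
  have hK'1 : 1 ≤ K' := by
    have : 0 ≤ (N + 1 : ℝ) ^ (2 * m) * (2 ^ n * K) := by positivity
    linarith
  obtain ⟨A, hA0, hA⟩ := exists_norm_iteratedFDeriv_power_comp_le N α (half_pos hη) hK'1 m
  set B : ℝ≥0∞ := eLpNorm (fun x : Space N => bracket x ^ (-(n * α))) 2 volume with hB
  have hBtop : B < ∞ := (memLp_bracket_rpow hnα).2
  set S : ℝ≥0∞ := ∑ i ∈ Finset.Ioc (2 * m) (J k m n), ∑ _s : Fin i → Fin N,
    2 ^ n * ENNReal.ofReal K with hS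
  have hStop : S < ∞ := ENNReal.sum_lt_top.mpr fun i _ => ENNReal.sum_lt_top.mpr fun s _ =>
    ENNReal.mul_lt_top (by simp) ENNReal.ofReal_lt_top
  refine ⟨ENNReal.ofReal A + ENNReal.ofReal A * (B + S), ENNReal.add_lt_top.mpr
    ⟨ENNReal.ofReal_lt_top, ENNReal.mul_lt_top ENNReal.ofReal_lt_top
      (ENNReal.add_lt_top.mpr ⟨hBtop, hStop⟩)⟩, fun u hu hlow ρ hρ hρη => ?_⟩
  -- The role of 2m ≥ k+n+1: derivatives up to order J contain at most one factor of order above 2m.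
  have hJ : J k m n ≤ 4 * m + 1 := by unfold J; omega
  set f := moll ρ u with hf
  have hfs : ContDiff ℝ (⊤ : ℕ∞) f := contDiff_moll ρ u
  have hflow := hu.le_norm_moll hK (by omega) hρ hlow hρη
  have hf0 : ∀ x, f x ≠ 0 := fun x hx => by
    have := hflow x
    rw [← hf, hx, norm_zero, mul_zero] at this
    linarith
  have hGs := contDiff_power_comp α hfs hf0
  have hpt : ∀ (l : List (Fin N)), l.length ≤ J k m n → ∀ x,
      ‖cd l (fun y => power α (f y)) x‖ ≤ A * (((bracket x ^ n)⁻¹) ^ α * ((bracket x ^ n)⁻¹ +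
      ∑ i ∈ Finset.Ioc (2 * m) l.length, ‖iteratedFDeriv ℝ i f x‖)) := by
    intro l hl x
    have hb : 0 < bracket x ^ n := pow_pos (bracket_pos x) n
    refine (norm_cd_le l _ x).trans (hA f x _ hfs (by positivity) ?_ (fun i hi => ?_) _ (hl.trans hJ))
    · rw [← div_eq_mul_inv, div_le_iff₀ hb, mul_comm]
      exact hflow x
    · refine (hu.norm_iteratedFDeriv_moll_le hK hρ hi x).trans ?_
      gcongr
      have h1 : (N : ℝ) ^ i ≤ (N + 1 : ℝ) ^ (2 * m) :=
        (pow_le_pow_left₀ (by positivity) (by linarith) i).trans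
          (pow_le_pow_right₀ (by linarith [(Nat.cast_nonneg N : (0 : ℝ) ≤ N)]) hi)
      have h2 : (N : ℝ) ^ i * (2 ^ n * K) ≤ (N + 1 : ℝ) ^ (2 * m) * (2 ^ n * K) := by gcongr
      linarith
  -- Up to order 2m the sum of high derivatives is empty, and what remains is r^{α+1}.
  have hsmall : ∀ (l : List (Fin N)), l.length ≤ 2 * m → ∀ x,
      bracket x ^ n * ‖cd l (fun y => power α (f y)) x‖ ≤ A := by
    intro l hl x
    have hb : 0 < bracket x ^ n := pow_pos (bracket_pos x) n
    have h1 := hpt l (by unfold J; omega) x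
    rw [Finset.Ioc_eq_empty (by omega), Finset.sum_empty, add_zero] at h1
    have h2 : ((bracket x ^ n)⁻¹) ^ α ≤ 1 :=
      Real.rpow_le_one (by positivity) (inv_le_one_of_one_le₀ (one_le_pow₀ (one_le_bracket x))) hα.le
    calc _ ≤ bracket x ^ n * (A * (((bracket x ^ n)⁻¹) ^ α * (bracket x ^ n)⁻¹)) := by gcongr
      _ = A * ((bracket x ^ n)⁻¹) ^ α := by field_simp
      _ ≤ A * 1 := by gcongr
      _ = A := mul_one A
  have hlarge : ∀ (l : List (Fin N)), 2 * m < l.length → l.length ≤ J k m n →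
      eLpNorm (fun x => ((bracket x ^ wt k m n l.length : ℝ) : ℂ) *
        cd l (fun y => power α (f y)) x) 2 volume ≤ ENNReal.ofReal A * (B + S) := by
    intro l h1 h2
    have hmeas : ∀ (i : ℕ) (s : Fin i → Fin N), AEStronglyMeasurable (fun x =>
        ‖((bracket x ^ wt k m n i : ℝ) : ℂ) * cd (List.ofFn s) f x‖) volume := fun i s => by
      have := (contDiff_cd hfs (List.ofFn s)).continuous
      exact Continuous.aestronglyMeasurable (by fun_prop)
    refine (eLpNorm_mono_real fun x => weight_mul_le hα hA0 (hpt l h2 x)).trans ?_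
    have h3 := eLpNorm_const_smul_le (c := A) (p := 2) (μ := (volume : Measure (Space N)))
      (f := fun x => bracket x ^ (-(n * α)) + ∑ i ∈ Finset.Ioc (2 * m) l.length, ∑ s : Fin i → Fin N,
        ‖((bracket x ^ wt k m n i : ℝ) : ℂ) * cd (List.ofFn s) f x‖)
    rw [Real.enorm_of_nonneg hA0] at h3
    refine h3.trans (mul_le_mul' le_rfl ?_)
    have hm2 : ∀ i, AEStronglyMeasurable (fun x => ∑ s : Fin i → Fin N,
        ‖((bracket x ^ wt k m n i : ℝ) : ℂ) * cd (List.ofFn s) f x‖) volume := fun i =>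
      Finset.aestronglyMeasurable_fun_sum _ fun s _ => hmeas i s
    refine (eLpNorm_add_le (memLp_bracket_rpow hnα).1
      (Finset.aestronglyMeasurable_fun_sum _ fun i _ => hm2 i) (by norm_num)).trans
      (add_le_add le_rfl ?_)
    have h4 := eLpNorm_sum_le (p := 2) (μ := (volume : Measure (Space N)))
      (s := Finset.Ioc (2 * m) l.length) (f := fun i x => ∑ s : Fin i → Fin N,
        ‖((bracket x ^ wt k m n i : ℝ) : ℂ) * cd (List.ofFn s) f x‖) (fun i _ => hm2 i) (by norm_num)
    have e4 : (fun x => ∑ i ∈ Finset.Ioc (2 * m) l.length, ∑ s : Fin i → Fin N,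
        ‖((bracket x ^ wt k m n i : ℝ) : ℂ) * cd (List.ofFn s) f x‖) =
        ∑ i ∈ Finset.Ioc (2 * m) l.length, fun x => ∑ s : Fin i → Fin N,
        ‖((bracket x ^ wt k m n i : ℝ) : ℂ) * cd (List.ofFn s) f x‖ := by
      ext x; simp [Finset.sum_apply]
    rw [e4]
    refine h4.trans ((Finset.sum_le_sum fun i hi => ?_).trans
      (Finset.sum_le_sum_of_subset (Finset.Ioc_subset_Ioc_right h2)))
    have h5 := eLpNorm_sum_le (p := 2) (μ := (volume : Measure (Space N)))
      (s := (Finset.univ : Finset (Fin i → Fin N))) (f := fun s x =>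
        ‖((bracket x ^ wt k m n i : ℝ) : ℂ) * cd (List.ofFn s) f x‖) (fun s _ => hmeas i s) (by norm_num)
    have e5 : (fun x => ∑ s : Fin i → Fin N,
        ‖((bracket x ^ wt k m n i : ℝ) : ℂ) * cd (List.ofFn s) f x‖) =
        ∑ s : Fin i → Fin N, fun x =>
        ‖((bracket x ^ wt k m n i : ℝ) : ℂ) * cd (List.ofFn s) f x‖ := by
      ext x; simp [Finset.sum_apply]
    rw [e5]
    refine h5.trans (Finset.sum_le_sum fun s _ => ?_)
    rw [eLpNorm_norm]
    have h6 := hu.eLpNorm_cd_moll_le ENNReal.ofReal_lt_top hρ (l := List.ofFn s)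
      (by simpa using (Finset.mem_Ioc.mp hi).1) (by simpa using (Finset.mem_Ioc.mp hi).2.trans h2)
    rwa [List.length_ofFn] at h6
  have hmem : ∀ l : List (Fin N), l.length ≤ J k m n →
      MemLp (cd l fun y => power α (f y)) 2 volume := by
    intro l hl
    by_cases h2 : l.length ≤ 2 * m
    · exact memLp_of_weight_bound hn (contDiff_cd hGs l).continuous (hsmall l h2)
    · refine ⟨(contDiff_cd hGs l).continuous.aestronglyMeasurable, ?_⟩
      refine lt_of_le_of_lt (eLpNorm_mono fun x => ?_) ((hlarge l (by omega) hl).trans_lt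
        (ENNReal.mul_lt_top ENNReal.ofReal_lt_top (ENNReal.add_lt_top.mpr ⟨hBtop, hStop⟩)))
      rw [norm_mul, Complex.norm_real, Real.norm_of_nonneg (pow_nonneg (bracket_pos x).le _)]
      exact le_mul_of_one_le_left (norm_nonneg _) (one_le_pow₀ (one_le_bracket x))
  have hcoe : powerL2 α (memLp_moll ρ hρ u).toLp =ᵐ[volume] fun y => power α (f y) := by
    have h1 : ∀ᵐ x, ‖(memLp_moll ρ hρ u).toLp _ x‖ ≤ 2 ^ n * K := by
      filter_upwards [(memLp_moll ρ hρ u).coeFn_toLp] with x hx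
      rw [hx]
      have h2 := hu.norm_cd_moll_le hK hρ (l := []) (by simp) x
      rw [cd_nil] at h2
      exact (le_mul_of_one_le_left (norm_nonneg _) (one_le_pow₀ (one_le_bracket x))).trans h2
    filter_upwards [powerL2_coe hα h1, (memLp_moll ρ hρ u).coeFn_toLp] with x hx h3
    rw [hx, h3]
  refine ⟨fun l hl => ?_, fun l h1 h2 => ?_⟩
  · rw [weightedNorm_dl_of_smooth hGs hcoe hmem (by unfold J; omega)]
    refine le_trans ?_ le_self_add
    refine (eLpNorm_le_of_ae_bound (Eventually.of_forall fun x => ?_) (C := A)).trans (by simp)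
    rw [norm_mul, Complex.norm_real, Real.norm_of_nonneg (pow_nonneg (bracket_pos x).le _)]
    exact hsmall l hl x
  · rw [weightedNorm_dl_of_smooth hGs hcoe hmem h2]
    exact (hlarge l h1 h2).trans le_add_self

theorem XBound.ae_norm_le {K : ℝ} (hK : 0 ≤ K) {u : L2 N} (h : XBound k m n (ENNReal.ofReal K) u) :
    ∀ᵐ x, bracket x ^ n * ‖u x‖ ≤ K :=
  ae_le_of_weightedNorm_top hK (h.low [] (by simp))

theorem ae_norm_le_of_weight {K : ℝ} {u : Space N → ℂ} (h : ∀ᵐ x, bracket x ^ n * ‖u x‖ ≤ K) :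
    ∀ᵐ x, ‖u x‖ ≤ K := by
  filter_upwards [h] with x hx
  exact (le_mul_of_one_le_left (norm_nonneg _) (one_le_pow₀ (one_le_bracket x))).trans hx

/-- The nonlinearity is bounded on subsets of `X` of functions bounded from below. -/
theorem exists_xBound_power (hn : (N : ℝ) < 2 * n) {α : ℝ} (hα : 0 < α)
    (hnα : (N : ℝ) < 2 * (n * α)) (hm : k + n + 1 ≤ 2 * m) {K : ℝ} (hK : 0 ≤ K) {η : ℝ} (hη : 0 < η) :
    ∃ C : ℝ≥0∞, C < ∞ ∧ ∀ u : L2 N, XBound k m n (ENNReal.ofReal K) u →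
      (∀ᵐ x, η ≤ bracket x ^ n * ‖u x‖) → XBound k m n C (powerL2 α u) := by
  obtain ⟨C, hC, h⟩ := exists_xBound_power_moll hn hα hnα hm hK hη
  refine ⟨C, hC, fun u hu hlow => ?_⟩
  set ρ : ℕ → ContDiffBump (0 : Space N) :=
    fun i => bump N (1 / ((i : ℝ) + 1)) Nat.one_div_pos_of_nat with hρdef
  have hρ : ∀ i, (ρ i).rOut ≤ 1 := fun i => by
    simp only [hρdef, bump]
    rw [div_le_one (by positivity)]
    linarith [(Nat.cast_nonneg i : (0 : ℝ) ≤ i)]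
  have hlim : Tendsto (fun i => (ρ i).rOut) atTop (𝓝 0) := tendsto_one_div_add_atTop_nhds_zero_nat
  have hu_lim := hu.tendsto_moll hn hK (by omega) hρ hlim
  have hbd : ∀ i, ∀ᵐ x, ‖(memLp_moll (ρ i) (hρ i) u).toLp _ x‖ ≤ 2 ^ n * K := fun i => by
    filter_upwards [(memLp_moll (ρ i) (hρ i) u).coeFn_toLp] with x hx
    rw [hx]
    have h2 := hu.norm_cd_moll_le hK (hρ i) (l := []) (by simp) x
    rw [cd_nil] at h2
    exact (le_mul_of_one_le_left (norm_nonneg _) (one_le_pow₀ (one_le_bracket x))).trans h2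
  have hubd : ∀ᵐ x, ‖u x‖ ≤ 2 ^ n * K := by
    filter_upwards [ae_norm_le_of_weight (hu.ae_norm_le hK)] with x hx
    exact hx.trans (le_mul_of_one_le_left hK (one_le_pow₀ (by norm_num)))
  have hp_lim : Tendsto (fun i => powerL2 α (memLp_moll (ρ i) (hρ i) u).toLp) atTop
      (𝓝 (powerL2 α u)) := by
    rw [tendsto_iff_norm_sub_tendsto_zero] at hu_lim ⊢
    refine squeeze_zero (fun _ => norm_nonneg _)
      (fun i => norm_powerL2_sub_le hα (hbd i) hubd) ?_
    simpa using hu_lim.const_mul ((2 + α) * (2 ^ n * K) ^ α)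
  refine XBound.of_tendsto hn hp_lim ?_
  have hev : ∀ᶠ i in atTop, (N * (2 ^ n * K) * 2 ^ n) * (ρ i).rOut ≤ η / 2 := by
    have h1 : Tendsto (fun i => (N * (2 ^ n * K) * 2 ^ n) * (ρ i).rOut) atTop (𝓝 0) := by
      simpa using hlim.const_mul (N * (2 ^ n * K) * 2 ^ n)
    exact (h1.eventually_lt_const (half_pos hη)).mono fun _ h => h.le
  exact hev.mono fun i hi => h u hu hlow (ρ i) (hρ i) hi

end NLS

end

noncomputable section

namespace NLS

open LineDeriv FourierTransform

variable {N k m n : ℕ}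

/-! ### An integral equation -/

/-- Banach's fixed point theorem for continuous curves in the closed set `S`. Curves on [0, δ] are
extended by constants to the line, so the hypotheses can speak of globally defined functions. -/
theorem exists_integral_equation {E : Type*} [NormedAddCommGroup E] [NormedSpace ℝ E]
    [CompleteSpace E] {S : Set E} (hS : IsClosed S) {φ : E} (hφ : φ ∈ S) {G : ℝ → E → E} {L δ : ℝ}
    (hδ : 0 ≤ δ) (hL : δ * L ≤ 1 / 2)
    (hLip : ∀ s, ∀ z ∈ S, ∀ w ∈ S, ‖G s z - G s w‖ ≤ L * ‖z - w‖)
    (hcont : ∀ z : ℝ → E, Continuous z → (∀ s, z s ∈ S) → Continuous fun s => G s (z s))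
    (hmaps : ∀ z : ℝ → E, Continuous z → (∀ s, z s ∈ S) → ∀ t ∈ Set.Icc 0 δ,
      φ + ∫ s in (0 : ℝ)..t, G s (z s) ∈ S) :
    ∃ z : ℝ → E, Continuous z ∧ (∀ s, z s ∈ S) ∧
      ∀ t ∈ Set.Icc 0 δ, z t = φ + ∫ s in (0 : ℝ)..t, G s (z s) := by
  let X := {f : C(Set.Icc 0 δ, E) // ∀ t, f t ∈ S}
  have hX : IsClosed {f : C(Set.Icc 0 δ, E) | ∀ t, f t ∈ S} := by
    simp only [Set.ofPred_forall]
    exact isClosed_iInter fun t => hS.preimage (continuous_eval_const t)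
  have : CompleteSpace X := hX.completeSpace_coe
  have : Nonempty X := ⟨⟨ContinuousMap.const _ φ, fun _ => hφ⟩⟩
  let ext : X → ℝ → E := fun f => Set.IccExtend hδ f.1
  have hext : ∀ f : X, Continuous (ext f) := fun f => f.1.continuous.Icc_extend'
  have hextS : ∀ (f : X) s, ext f s ∈ S := fun f s => f.2 _
  have hG : ∀ f : X, Continuous fun s => G s (ext f s) := fun f => hcont _ (hext f) (hextS f)
  let Φ : X → X := fun f => ⟨⟨fun t => φ + ∫ s in (0 : ℝ)..t, G s (ext f s),
    continuous_const.add ((intervalIntegral.continuous_primitive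
      (fun a b => (hG f).intervalIntegrable a b) 0).comp continuous_subtype_val)⟩,
    fun t => hmaps _ (hext f) (hextS f) t t.2⟩
  have hcontr : ContractingWith (1 / 2) Φ := by
    refine ⟨NNReal.half_lt_self one_ne_zero, LipschitzWith.of_dist_le_mul fun f g => ?_⟩
    rw [Subtype.dist_eq, ContinuousMap.dist_le (by positivity)]
    intro t
    have e1 : (Φ f).1 t - (Φ g).1 t = ∫ s in (0 : ℝ)..t, (G s (ext f s) - G s (ext g s)) := by
      rw [intervalIntegral.integral_sub ((hG f).intervalIntegrable _ _)
        ((hG g).intervalIntegrable _ _)]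
      change (φ + _) - (φ + _) = _
      rw [add_sub_add_left_eq_sub]
    rw [dist_eq_norm, e1]
    by_cases hL0 : 0 ≤ L
    · refine (intervalIntegral.norm_integral_le_of_norm_le_const (C := L * dist f g)
        fun s _ => ?_).trans ?_
      · refine (hLip s _ (hextS f s) _ (hextS g s)).trans ?_
        gcongr
        rw [← dist_eq_norm]
        exact ContinuousMap.dist_apply_le_dist _
      · rw [sub_zero, abs_of_nonneg t.2.1]
        have h1 : L * (t : ℝ) ≤ 1 / 2 := by
          refine le_trans ?_ hL
          rw [mul_comm]
          exact mul_le_mul_of_nonneg_right t.2.2 hL0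
        calc L * dist f g * t = (L * t) * dist f g := by ring
          _ ≤ (1 / 2) * dist f g := by gcongr
          _ = _ := by simp
    · have h2 : ∀ s, G s (ext f s) - G s (ext g s) = 0 := fun s => by
        have := hLip s _ (hextS f s) _ (hextS g s)
        have h3 : L * ‖ext f s - ext g s‖ ≤ 0 :=
          mul_nonpos_of_nonpos_of_nonneg (le_of_not_ge hL0) (norm_nonneg _)
        exact norm_le_zero_iff.mp (this.trans h3)
      simp only [h2, intervalIntegral.integral_zero, norm_zero]
      positivity
  have hfix := hcontr.fixedPoint_isFixedPt
  set f := ContractingWith.fixedPoint Φ hcontr with hf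
  refine ⟨ext f, hext f, hextS f, fun t ht => ?_⟩
  have h1 : ext f t = f.1 ⟨t, ht⟩ := Set.IccExtend_of_mem hδ f.1 ht
  rw [h1]
  have h2 : (Φ f).1 ⟨t, ht⟩ = f.1 ⟨t, ht⟩ := by rw [hfix]
  rw [← h2]
  rfl

/-! ### Solutions on time intervals -/

/-- `v ∈ C(I, X)` solves `i v_t + Δ v = c(t) |v|^α v` on `I`. -/
structure FlowOn (k m n : ℕ) (α : ℝ) (c : ℝ → ℂ) (I : Set ℝ) (v : ℝ → L2 N) : Prop where
  cont : ContinuousOnX k m n I v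
  eqn : ∀ t ∈ I, ∃ lap : L2 N, (lap : 𝓢'(Space N, ℂ)) = Δ (v t : 𝓢'(Space N, ℂ)) ∧
    HasDerivWithinAt v (Complex.I • lap - (Complex.I * c t) • powerL2 α (v t)) I t

theorem le_weightedInf_iff {u : L2 N} {η : ℝ} :
    ENNReal.ofReal η ≤ weightedInf n u ↔ ∀ᵐ x, η ≤ bracket x ^ n * ‖u x‖ := by
  have h0 : ∀ x, 0 ≤ bracket x ^ n * ‖u x‖ := fun x =>
    mul_nonneg (pow_nonneg (bracket_pos x).le n) (norm_nonneg _)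
  constructor
  · intro h
    have h1 : ∀ᵐ x, weightedInf n u ≤ ENNReal.ofReal (bracket x ^ n * ‖u x‖) := ae_essInf_le
    filter_upwards [h1] with x hx
    exact (ENNReal.ofReal_le_ofReal_iff (h0 x)).mp (h.trans hx)
  · intro h
    refine le_essInf_of_ae_le _ ?_
    filter_upwards [h] with x hx
    exact ENNReal.ofReal_le_ofReal hx

/-- Lower bounds are stable under small perturbations in weighted L^∞; this is used for the distance
from the data and for the motion under the group. -/
theorem ae_le_weight_of_weightedNorm_sub_le {u w : L2 N} {η ε : ℝ} (hε : 0 ≤ ε)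
    (hu : ∀ᵐ x, η ≤ bracket x ^ n * ‖u x‖)
    (h : weightedNorm ∞ n ((w - u : L2 N) : 𝓢'(Space N, ℂ)) ≤ ENNReal.ofReal ε) :
    ∀ᵐ x, η - ε ≤ bracket x ^ n * ‖w x‖ := by
  filter_upwards [hu, ae_le_of_weightedNorm_top hε h, Lp.coeFn_sub w u] with x h1 h2 h3
  rw [h3, Pi.sub_apply] at h2
  have hb := pow_pos (bracket_pos x) n
  have h4 : ‖u x‖ ≤ ‖w x‖ + ‖w x - u x‖ := by
    have := norm_sub_norm_le (u x) (w x)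
    rw [norm_sub_rev] at this
    linarith
  nlinarith

theorem normX_add_le (u v : L2 N) :
    normX k m n (u + v) ≤ ((2 * m + 1) + (k + 2) * (n + 1) : ℕ) * (normX k m n u + normX k m n v) :=
  ((XBound.of_normX u).add (XBound.of_normX v)).normX_le

/-- `z` solves the equation in the interaction picture; then `U t (z t)` solves the equation. -/
theorem flowOn_of_integral_equation (hn : (N : ℝ) < 2 * n) (hk : (N : ℝ) < 2 * k) {α : ℝ}
    {c : ℝ → ℂ} {δ : ℝ} (hδ1 : δ ≤ 1) {φ : L2 N} {z g : ℝ → L2 N} {M M' : ℝ≥0∞} (hM : M < ∞)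
    (hM' : M' < ∞) (hz : ∀ t, XBound k m n M (z t)) (hg : Continuous g)
    (hgX : ∀ t, XBound k m n M' (g t))
    (hzg : ∀ t ∈ Set.Icc 0 δ, z t = φ + ∫ s in (0 : ℝ)..t, g s)
    (hgeq : ∀ t ∈ Set.Icc 0 δ, U t (g t) = -(Complex.I * c t) • powerL2 α (U t (z t))) :
    FlowOn k m n α c (Set.Icc 0 δ) fun t => U t (z t) := by
  obtain ⟨A, hA, hAU⟩ := exists_xBound_U hn hk m
  have hUz : ∀ t ∈ Set.Icc 0 δ, XBound k m n (A * M) (U t (z t)) := fun t ht =>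
    (hAU M (z t) t (by rw [abs_of_nonneg ht.1]; exact ht.2.trans hδ1) hM (hz t)).1
  have hAM : A * M < ∞ := ENNReal.mul_lt_top hA hM
  refine ⟨⟨fun t ht => (hUz t ht).memX hn hAM, fun t ht => ?_⟩, fun t ht => ?_⟩
  · set Q : ℝ≥0∞ := (((2 * m + 1) + (k + 2) * (n + 1) : ℕ) : ℝ≥0∞) with hQ
    have hQtop : Q < ∞ := ENNReal.natCast_lt_top _
    have h1 := (tendsto_normX_U_sub hn hk hAM (hUz t ht))
    have hst : Tendsto (fun s : ℝ => s - t) (𝓝[Set.Icc 0 δ] t) (𝓝 0) := by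
      have : Tendsto (fun s : ℝ => s - t) (𝓝 t) (𝓝 (t - t)) := (continuous_id.sub continuous_const).tendsto t
      rw [sub_self] at this
      exact this.mono_left nhdsWithin_le_nhds
    have h2 := h1.comp hst
    have h3 : Tendsto (fun s : ℝ => Q * (A * (ENNReal.ofReal |s - t| * M'))) (𝓝[Set.Icc 0 δ] t) (𝓝 0) := by
      have h4 : Tendsto (fun s : ℝ => ENNReal.ofReal |s - t|) (𝓝[Set.Icc 0 δ] t) (𝓝 0) := by
        have : Continuous (fun h : ℝ => ENNReal.ofReal |h|) :=
          ENNReal.continuous_ofReal.comp continuous_abs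
        have h5 := (this.tendsto 0).comp hst
        simpa [Function.comp_def] using h5
      have h5 := ENNReal.Tendsto.const_mul (a := Q * A) (ENNReal.Tendsto.mul_const h4 (Or.inr hM'.ne))
        (Or.inr (ENNReal.mul_lt_top hQtop hA).ne)
      simp only [zero_mul, mul_zero] at h5
      exact h5.congr fun s => by ring
    have h6 := ENNReal.Tendsto.const_mul (a := Q) (h3.add h2) (Or.inr hQtop.ne)
    simp only [add_zero, mul_zero] at h6
    refine tendsto_of_tendsto_of_tendsto_of_le_of_le' tendsto_const_nhds h6
      (Eventually.of_forall fun _ => zero_le) ?_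
    filter_upwards [self_mem_nhdsWithin] with s hs
    -- The first term is Lipschitz in X because `g` is bounded there; the second is strong
    -- continuity at a fixed vector.
    have e1 : U s (z s) - U t (z t) = U s (z s - z t) + (U (s - t) (U t (z t)) - U t (z t)) := by
      rw [U_U, sub_add_cancel, map_sub]; abel
    rw [e1]
    refine (normX_add_le _ _).trans (mul_le_mul' le_rfl (add_le_add ?_ le_rfl))
    have e2 : z s - z t = ∫ τ in t..s, g τ := by
      rw [hzg s hs, hzg t ht, add_sub_add_left_eq_sub,
        intervalIntegral.integral_interval_sub_left (hg.intervalIntegrable _ _)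
          (hg.intervalIntegrable _ _)]
    have h7 : XBound k m n (ENNReal.ofReal |s - t| * M') (z s - z t) := by
      rw [e2]
      exact XBound.integral hn hg fun τ _ => hgX τ
    exact (hAU _ _ s (by rw [abs_of_nonneg hs.1]; exact hs.2.trans hδ1)
      (ENNReal.mul_lt_top ENNReal.ofReal_lt_top hM') h7).1.normX_le
  · obtain ⟨lap, hlap⟩ := exists_laplacian_of_xBound (hz t) hM (l := []) (by simp)
    rw [dl_nil] at hlap
    have hderiv : HasDerivWithinAt z (g t) (Set.Icc 0 δ) t := by
      have h1 : HasDerivAt (fun t => φ + ∫ s in (0 : ℝ)..t, g s) (g t) t :=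
        (hg.integral_hasStrictDerivAt 0 t).hasDerivAt.const_add φ
      exact h1.hasDerivWithinAt.congr (fun s hs => hzg s hs) (hzg t ht)
    refine ⟨U t lap, ?_, ?_⟩
    · rw [U_toTD, hlap, U_toTD, UV_laplacian]
    · have := HasDerivWithinAt.U_apply hderiv hlap
      rw [hgeq t ht] at this
      convert this using 1
      rw [neg_smul]; abel

/-- Local existence, on a time interval whose length depends only on bounds of the data. -/
theorem exists_flowOn (hn : (N : ℝ) < 2 * n) (hk : (N : ℝ) < 2 * k) {α : ℝ} (hα : 0 < α)
    (hnα : (N : ℝ) < 2 * (n * α)) (hm : k + n + 1 ≤ 2 * m) {K : ℝ} (hK : 0 ≤ K) {η : ℝ} (hη : 0 < η)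
    {B : ℝ} (hB : 0 ≤ B) :
    ∃ δ > 0, ∀ (φ : L2 N) (c : ℝ → ℂ), XBound k m n (ENNReal.ofReal K) φ →
      (∀ᵐ x, η ≤ bracket x ^ n * ‖φ x‖) → Continuous c → (∀ t, ‖c t‖ ≤ B) →
      ∃ v : ℝ → L2 N, v 0 = φ ∧ FlowOn k m n α c (Set.Icc 0 δ) v ∧
        ∀ t ∈ Set.Icc 0 δ, ENNReal.ofReal (η / 2) ≤ weightedInf n (v t) := by
  obtain ⟨A, hA, hAU⟩ := exists_xBound_U (N := N) hn hk m
  obtain ⟨a, ha⟩ : ∃ a : ℝ, A = ENNReal.ofReal a ∧ 0 ≤ a :=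
    ⟨A.toReal, (ENNReal.ofReal_toReal hA.ne).symm, ENNReal.toReal_nonneg⟩
  obtain ⟨rfl, ha0⟩ := ha
  set K₁ : ℝ := K + η / 4 with hK₁
  have hK₁0 : 0 ≤ K₁ := by positivity
  obtain ⟨C, hC, hpow⟩ := exists_xBound_power (N := N) hn hα hnα hm (K := a * K₁) (by positivity)
    (η := η / 2) (by positivity)
  obtain ⟨C₀, hC₀⟩ : ∃ C₀ : ℝ, C = ENNReal.ofReal C₀ ∧ 0 ≤ C₀ :=
    ⟨C.toReal, (ENNReal.ofReal_toReal hC.ne).symm, ENNReal.toReal_nonneg⟩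
  obtain ⟨rfl, hC₀0⟩ := hC₀
  set L : ℝ := B * ((2 + α) * (a * K₁) ^ α) with hL
  have hL0 : 0 ≤ L := by positivity
  set P : ℝ := B * (a * C₀) with hP
  have hP0 : 0 ≤ P := by positivity
  -- The time is δ = 1/T. The four terms give, in order: δ ≤ 1 for the group estimates, contraction,
  -- integrals staying within η/4 of the data, and a displacement of at most η/4 under the group.
  -- The last two leave η/2 of the lower bound.
  set T : ℝ := 1 + 2 * L + 4 * P / η + 4 * (a * K₁) / η with hT
  have hT1 : 1 ≤ T := by
    have h1 : 0 ≤ 4 * P / η := by positivity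
    have h2 : 0 ≤ 4 * (a * K₁) / η := by positivity
    linarith
  have hT0 : 0 < T := by linarith
  have h4P : 0 ≤ 4 * P / η := by positivity
  have h4K : 0 ≤ 4 * (a * K₁) / η := by positivity
  have hδL : T⁻¹ * L ≤ 1 / 2 := by
    rw [inv_mul_le_iff₀ hT0]; linarith
  have hδP : T⁻¹ * P ≤ η / 4 := by
    rw [inv_mul_le_iff₀ hT0]
    have h1 : 4 * P / η ≤ T := by linarith
    rw [div_le_iff₀ hη] at h1
    linarith
  have hδK : T⁻¹ * (a * K₁) ≤ η / 4 := by
    rw [inv_mul_le_iff₀ hT0]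
    have h1 : 4 * (a * K₁) / η ≤ T := by linarith
    rw [div_le_iff₀ hη] at h1
    linarith
  have hδ1 : T⁻¹ ≤ 1 := inv_le_one_of_one_le₀ hT1
  have hδ0 : 0 < T⁻¹ := inv_pos.mpr hT0
  set δ := T⁻¹ with hδ
  refine ⟨δ, hδ0, fun φ c hφ hlow hc hcB => ?_⟩
  -- time truncated to `[0, δ]`
  set p : ℝ → ℝ := fun s => max 0 (min s δ) with hp
  have hpc : Continuous p := by fun_prop
  have hp0 : ∀ s, 0 ≤ p s := fun s => le_max_left _ _
  have hpδ : ∀ s, p s ≤ δ := fun s => max_le hδ0.le (min_le_right _ _)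
  have hpabs : ∀ s, |p s| ≤ 1 := fun s => by rw [abs_of_nonneg (hp0 s)]; exact (hpδ s).trans hδ1
  have hpid : ∀ s ∈ Set.Icc 0 δ, p s = s := fun s hs => by
    simp only [hp]; rw [min_eq_left hs.2, max_eq_right hs.1]
  -- A ball of X around the data, used as a closed subset of L².
  set S : Set (L2 N) := {z | XBound k m n (ENNReal.ofReal (η / 4)) (z - φ)} with hS
  have hSb : ∀ z ∈ S, XBound k m n (ENNReal.ofReal K₁) z := fun z hz => by
    have h1 := hφ.add hz
    rw [add_sub_cancel, ← ENNReal.ofReal_add hK (by positivity)] at h1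
    exact h1
  have hUb : ∀ s, ∀ z ∈ S, XBound k m n (ENNReal.ofReal (a * K₁)) (U (p s) z) ∧
      ∀ᵐ x, η / 2 ≤ bracket x ^ n * ‖U (p s) z x‖ := by
    intro s z hz
    have h1 := hAU _ z (p s) (hpabs s) ENNReal.ofReal_lt_top (hSb z hz)
    rw [← ENNReal.ofReal_mul ha0] at h1
    refine ⟨h1.1, ?_⟩
    have h2 := h1.2 [] (by simp)
    rw [dl_nil, abs_of_nonneg (hp0 s), ← ENNReal.ofReal_mul (hp0 s)] at h2
    have h3 : weightedNorm ∞ n ((z - φ : L2 N) : 𝓢'(Space N, ℂ)) ≤ ENNReal.ofReal (η / 4) := by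
      simpa using hz.low [] (by simp)
    have h4 := ae_le_weight_of_weightedNorm_sub_le (by positivity) hlow h3
    have h5 := ae_le_weight_of_weightedNorm_sub_le (ε := η / 4) (by positivity) h4
      (h2.trans (ENNReal.ofReal_le_ofReal
        ((mul_le_mul_of_nonneg_right (hpδ s) (by positivity)).trans hδK)))
    filter_upwards [h5] with x hx
    linarith
  have hUae : ∀ s, ∀ z ∈ S, ∀ᵐ x, ‖U (p s) z x‖ ≤ a * K₁ := fun s z hz =>
    ae_norm_le_of_weight ((hUb s z hz).1.ae_norm_le (by positivity))
  set G : ℝ → L2 N → L2 N := fun s z =>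
    (-(Complex.I * c (p s))) • U (-p s) (powerL2 α (U (p s) z)) with hG
  have hcn : ∀ s, ‖-(Complex.I * c (p s))‖ ≤ B := fun s => by simpa using hcB (p s)
  have hGX : ∀ s, ∀ z ∈ S, XBound k m n (ENNReal.ofReal P) (G s z) := by
    intro s z hz
    have h1 := hpow _ (hUb s z hz).1 (hUb s z hz).2
    have h2 := (hAU _ _ (-p s) (by rw [abs_neg]; exact hpabs s) ENNReal.ofReal_lt_top h1).1.smul
      (-(Complex.I * c (p s)))
    refine h2.mono ?_
    rw [← ofReal_norm, ← ENNReal.ofReal_mul ha0, ← ENNReal.ofReal_mul (norm_nonneg _)]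
    exact ENNReal.ofReal_le_ofReal (mul_le_mul_of_nonneg_right (hcn s) (by positivity))
  have hGcont : ∀ z : ℝ → L2 N, Continuous z → (∀ s, z s ∈ S) → Continuous fun s => G s (z s) := by
    intro z hz hzS
    have h1 : Continuous fun s => U (p s) (z s) := continuous_U_apply hpc hz
    have h2 : Continuous fun s => powerL2 α (U (p s) (z s)) := by
      rw [continuous_iff_continuousAt]
      intro t
      rw [ContinuousAt, tendsto_iff_norm_sub_tendsto_zero]
      have h3 := tendsto_iff_norm_sub_tendsto_zero.mp (h1.tendsto t)
      refine squeeze_zero (fun _ => norm_nonneg _) (fun s => norm_powerL2_sub_le hα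
        (hUae s _ (hzS s)) (hUae t _ (hzS t))) ?_
      simpa using h3.const_mul ((2 + α) * (a * K₁) ^ α)
    exact (continuous_const.mul (hc.comp hpc)).neg.smul (continuous_U_apply hpc.neg h2)
  obtain ⟨z, hz, hzS, hzeq⟩ := exists_integral_equation (S := S) (φ := φ) (G := G) (L := L) (δ := δ)
    (by
      rw [← isSeqClosed_iff_isClosed]
      intro w w₀ hw hlim
      exact XBound.of_tendsto hn (hlim.sub_const φ) (Eventually.of_forall hw))
    (by
      have h0 := hφ.smul 0
      simp only [hS, Set.mem_ofPred_eq, sub_self]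
      rw [zero_smul] at h0
      exact h0.mono (by simp))
    hδ0.le hδL
    (fun s z hz w hw => by
      have e1 : G s z - G s w = (-(Complex.I * c (p s))) •
          U (-p s) (powerL2 α (U (p s) z) - powerL2 α (U (p s) w)) := by
        simp only [hG, map_sub, smul_sub]
      rw [e1, norm_smul, LinearIsometry.norm_map]
      have h1 := norm_powerL2_sub_le hα (hUae s z hz) (hUae s w hw)
      rw [← map_sub, LinearIsometry.norm_map] at h1
      refine (mul_le_mul (hcn s) h1 (norm_nonneg _) hB).trans (le_of_eq ?_)
      rw [hL]; ring)
    hGcont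
    (fun z hz hzS t ht => by
      have h1 := XBound.integral hn (hGcont z hz hzS) (s := 0) (t := t)
        fun τ _ => hGX τ (z τ) (hzS τ)
      simp only [hS, Set.mem_ofPred_eq, add_sub_cancel_left]
      refine h1.mono ?_
      rw [← ENNReal.ofReal_mul (abs_nonneg _), sub_zero, abs_of_nonneg ht.1]
      exact ENNReal.ofReal_le_ofReal ((mul_le_mul_of_nonneg_right ht.2 hP0).trans hδP))
  refine ⟨fun t => U t (z t), ?_, ?_, fun t ht => ?_⟩
  · have h0 := hzeq 0 ⟨le_rfl, hδ0.le⟩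
    rw [intervalIntegral.integral_same, add_zero] at h0
    dsimp only
    rw [U_zero, h0]
  · refine flowOn_of_integral_equation hn hk hδ1 (φ := φ) (g := fun s => G s (z s))
      ENNReal.ofReal_lt_top ENNReal.ofReal_lt_top (fun t => hSb _ (hzS t)) (hGcont z hz hzS)
      (fun t => hGX t _ (hzS t)) hzeq (fun t ht => ?_)
    simp only [hG, hpid t ht]
    rw [map_smul, U_U, add_neg_cancel, U_zero]
  · have h1 := (hUb t _ (hzS t)).2
    rw [hpid t ht] at h1
    exact le_weightedInf_iff.mpr h1

/-! ### Uniqueness -/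

theorem ContinuousOnX.exists_bound {a b : ℝ} {v : ℝ → L2 N}
    (hv : ContinuousOnX k m n (Set.Icc a b) v) :
    ∃ M : ℝ, 0 ≤ M ∧ ∀ t ∈ Set.Icc a b, XBound k m n (ENNReal.ofReal M) (v t) := by
  have key : ∃ M : ℝ≥0∞, M < ∞ ∧ ∀ t ∈ Set.Icc a b, XBound k m n M (v t) := by
    refine (isCompact_Icc (a := a) (b := b)).induction_on
      (p := fun S => ∃ M : ℝ≥0∞, M < ∞ ∧ ∀ t ∈ S, XBound k m n M (v t)) ⟨0, by simp, by simp⟩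
      (fun S T hST ⟨M, hM, h⟩ => ⟨M, hM, fun t ht => h t (hST ht)⟩)
      (fun S T ⟨M, hM, h⟩ ⟨M', hM', h'⟩ => ⟨M + M', ENNReal.add_lt_top.mpr ⟨hM, hM'⟩, fun t ht => ?_⟩)
      (fun t ht => ?_)
    · rcases ht with ht | ht
      · exact (h t ht).mono le_self_add
      · exact (h' t ht).mono le_add_self
    · have h1 := (hv.2 t ht).eventually_lt_const (u := 1) (by simp)
      refine ⟨_, h1, 1 + normX k m n (v t),
        ENNReal.add_lt_top.mpr ⟨by simp, (hv.1 t ht).normX_lt_top⟩, fun s hs => ?_⟩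
      have h2 := (XBound.of_normX (k := k) (m := m) (n := n) (v s - v t)).add (XBound.of_normX (v t))
      rw [sub_add_cancel] at h2
      exact h2.mono (add_le_add (le_of_lt hs) le_rfl)
  obtain ⟨M, hM, h⟩ := key
  exact ⟨M.toReal, ENNReal.toReal_nonneg, fun t ht => by
    rw [ENNReal.ofReal_toReal hM.ne]; exact h t ht⟩

/-- Obtained from `HasDerivWithinAt.U_apply` by reversing time twice. -/
theorem HasDerivWithinAt.U_neg_apply {z : ℝ → L2 N} {z' lap : L2 N} {s : Set ℝ} {t : ℝ}
    (hz : HasDerivWithinAt z z' s t)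
    (hlap : (lap : 𝓢'(Space N, ℂ)) = Δ (z t : 𝓢'(Space N, ℂ))) :
    HasDerivWithinAt (fun τ => U (-τ) (z τ)) (U (-t) (z' - Complex.I • lap)) s t := by
  have hneg : HasDerivWithinAt (fun τ : ℝ => -τ) (-1) (-s) (-t) := (hasDerivAt_neg (-t)).hasDerivWithinAt
  have h1 : HasDerivWithinAt (fun τ => z (-τ)) (-z') (-s) (-t) := by
    have hz2 : HasDerivWithinAt z z' s (-(-t)) := by rwa [neg_neg]
    have := hz2.scomp (-t) hneg (fun τ hτ => by simpa using hτ)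
    simpa [Function.comp_def] using this
  have h2 := HasDerivWithinAt.U_apply h1 (lap := lap) (by rw [neg_neg]; exact hlap)
  have hneg' : HasDerivWithinAt (fun τ : ℝ => -τ) (-1) s t := (hasDerivAt_neg t).hasDerivWithinAt
  have h3 := h2.scomp t hneg' (fun τ hτ => by simpa using hτ)
  simp only [Function.comp_def, neg_neg] at h3
  have e1 : (-1 : ℝ) • (U (-t) (-z') + Complex.I • U (-t) lap) = U (-t) (z' - Complex.I • lap) := by
    rw [map_sub, map_smul, map_neg, neg_one_smul]
    abel
  rwa [e1] at h3

/-- For U(-t)(v - w) the Laplacians cancel, and Gronwall's inequality in L² applies. The sup bounds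
for the Lipschitz constant come from continuity in X on a compact interval; the lower bound on the
modulus plays no role. -/
theorem FlowOn.unique {α : ℝ} (hα : 0 < α) {c : ℝ → ℂ} {T : ℝ} {B : ℝ}
    (hB : ∀ t ∈ Set.Icc 0 T, ‖c t‖ ≤ B) {v w : ℝ → L2 N} (hv : FlowOn k m n α c (Set.Icc 0 T) v)
    (hw : FlowOn k m n α c (Set.Icc 0 T) w) (h0 : v 0 = w 0) : Set.EqOn v w (Set.Icc 0 T) := by
  obtain ⟨M₁, hM₁, hv1⟩ := hv.cont.exists_bound
  obtain ⟨M₂, hM₂, hw1⟩ := hw.cont.exists_bound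
  set M := max M₁ M₂ with hM
  have hvM : ∀ t ∈ Set.Icc 0 T, ∀ᵐ x, ‖v t x‖ ≤ M := fun t ht => by
    filter_upwards [ae_norm_le_of_weight ((hv1 t ht).ae_norm_le hM₁)] with x hx
    exact hx.trans (le_max_left _ _)
  have hwM : ∀ t ∈ Set.Icc 0 T, ∀ᵐ x, ‖w t x‖ ≤ M := fun t ht => by
    filter_upwards [ae_norm_le_of_weight ((hw1 t ht).ae_norm_le hM₂)] with x hx
    exact hx.trans (le_max_right _ _)
  set y : ℝ → L2 N := fun t => U (-t) (v t - w t) with hy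
  set y' : ℝ → L2 N := fun t =>
    U (-t) (-((Complex.I * c t) • (powerL2 α (v t) - powerL2 α (w t)))) with hy'
  have hderiv : ∀ t ∈ Set.Icc 0 T, HasDerivWithinAt y (y' t) (Set.Icc 0 T) t := by
    intro t ht
    obtain ⟨lv, hlv, hdv⟩ := hv.eqn t ht
    obtain ⟨lw, hlw, hdw⟩ := hw.eqn t ht
    have h1 := HasDerivWithinAt.U_neg_apply (hdv.sub hdw) (lap := lv - lw) (by
      rw [toTD_sub, hlv, hlw]
      change _ = Δ ((v t - w t : L2 N) : 𝓢'(Space N, ℂ))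
      rw [toTD_sub]
      have hL : ∀ f : 𝓢'(Space N, ℂ), Δ f = ∑ i, dl [i, i] f := laplacian_eq_sum_e
      simp only [hL, map_sub, Finset.sum_sub_distrib])
    have e1 : Complex.I • lv - (Complex.I * c t) • powerL2 α (v t) -
        (Complex.I • lw - (Complex.I * c t) • powerL2 α (w t)) - Complex.I • (lv - lw) =
        -((Complex.I * c t) • (powerL2 α (v t) - powerL2 α (w t))) := by
      rw [smul_sub, smul_sub]
      abel
    rw [e1] at h1
    exact h1
  have hgr := norm_le_gronwallBound_of_norm_deriv_right_le (f := y) (f' := y') (a := 0) (b := T)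
    (δ := 0) (K := B * ((2 + α) * M ^ α)) (ε := 0)
    (fun t ht => (hderiv t ht).continuousWithinAt)
    (fun t ht => (hderiv t ⟨ht.1, ht.2.le⟩).mono_of_mem_nhdsWithin
      (Icc_mem_nhdsGE_of_mem ht))
    (by simp [hy, h0])
    (fun t ht => by
      have ht' : t ∈ Set.Icc 0 T := ⟨ht.1, ht.2.le⟩
      simp only [hy, hy', LinearIsometry.norm_map, norm_neg, norm_smul, add_zero]
      have h1 := norm_powerL2_sub_le hα (hvM t ht') (hwM t ht')
      have h2 : ‖Complex.I * c t‖ ≤ B := by simpa using hB t ht'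
      refine (mul_le_mul h2 h1 (norm_nonneg _) ((norm_nonneg _).trans h2)).trans (le_of_eq ?_)
      ring)
  intro t ht
  have h1 := hgr t ht
  rw [gronwallBound_ε0_δ0] at h1
  have h2 : ‖v t - w t‖ ≤ 0 := by
    simpa only [hy, LinearIsometry.norm_map] using h1
  exact sub_eq_zero.mp (norm_le_zero_iff.mp h2)

end NLS

end

noncomputable section

namespace NLS

open LineDeriv FourierTransform

variable {N k m n : ℕ}

/-! ### Restriction, translation and gluing of solutions -/

theorem FlowOn.of_local {α : ℝ} {c : ℝ → ℂ} {I : Set ℝ} {v : ℝ → L2 N}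
    (h : ∀ t ∈ I, ∃ S, t ∈ S ∧ S ∈ 𝓝[I] t ∧ FlowOn k m n α c S v) : FlowOn k m n α c I v := by
  refine ⟨⟨fun t ht => ?_, fun t ht => ?_⟩, fun t ht => ?_⟩ <;> obtain ⟨S, htS, hS, hv⟩ := h t ht
  · exact hv.cont.1 t htS
  · exact (hv.cont.2 t htS).mono_left (nhdsWithin_le_iff.mpr hS)
  · obtain ⟨lap, h1, h2⟩ := hv.eqn t htS
    exact ⟨lap, h1, h2.mono_of_mem_nhdsWithin hS⟩

theorem FlowOn.mono {α : ℝ} {c : ℝ → ℂ} {I I' : Set ℝ} {v : ℝ → L2 N} (h : FlowOn k m n α c I v)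
    (hI : I' ⊆ I) : FlowOn k m n α c I' v :=
  .of_local fun _ ht => ⟨I, hI ht, mem_of_superset self_mem_nhdsWithin hI, h⟩

theorem FlowOn.congr {α : ℝ} {c c' : ℝ → ℂ} {I : Set ℝ} {v w : ℝ → L2 N} (h : FlowOn k m n α c I v)
    (hc : Set.EqOn c c' I) (hvw : Set.EqOn w v I) : FlowOn k m n α c' I w := by
  refine ⟨⟨fun t ht => ?_, fun t ht => ?_⟩, fun t ht => ?_⟩
  · rw [hvw ht]; exact h.cont.1 t ht
  · refine (h.cont.2 t ht).congr' ?_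
    filter_upwards [self_mem_nhdsWithin] with s hs
    rw [hvw hs, hvw ht]
  · obtain ⟨lap, h1, h2⟩ := h.eqn t ht
    refine ⟨lap, by rw [hvw ht]; exact h1, ?_⟩
    rw [hvw ht, ← hc ht]
    exact h2.congr hvw (hvw ht)

theorem FlowOn.shift {α : ℝ} {c : ℝ → ℂ} {a d : ℝ} {v : ℝ → L2 N} (s : ℝ)
    (h : FlowOn k m n α (fun t => c (s + t)) (Set.Icc a d) v) :
    FlowOn k m n α c (Set.Icc (s + a) (s + d)) fun t => v (t - s) := by
  have hmem : ∀ t ∈ Set.Icc (s + a) (s + d), t - s ∈ Set.Icc a d := fun t ht =>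
    ⟨by linarith [ht.1], by linarith [ht.2]⟩
  refine ⟨⟨fun t ht => h.cont.1 _ (hmem t ht), fun t ht => ?_⟩, fun t ht => ?_⟩
  · refine (h.cont.2 _ (hmem t ht)).comp (f := fun τ => τ - s) ?_
    exact (continuous_id.sub continuous_const).continuousWithinAt.tendsto_nhdsWithin hmem
  · obtain ⟨lap, h1, h2⟩ := h.eqn _ (hmem t ht)
    refine ⟨lap, h1, ?_⟩
    rw [add_sub_cancel] at h2
    have hs : HasDerivWithinAt (fun τ : ℝ => τ - s) 1 (Set.Icc (s + a) (s + d)) t :=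
      ((hasDerivAt_id t).sub_const s).hasDerivWithinAt
    have := h2.scomp t hs hmem
    rwa [one_smul] at this

theorem FlowOn.union {α : ℝ} {c : ℝ → ℂ} {a b d : ℝ} (hab : a ≤ b) (hbd : b ≤ d) {v : ℝ → L2 N}
    (h1 : FlowOn k m n α c (Set.Icc a b) v) (h2 : FlowOn k m n α c (Set.Icc b d) v) :
    FlowOn k m n α c (Set.Icc a d) v := by
  have hunion : Set.Icc a d = Set.Icc a b ∪ Set.Icc b d := (Set.Icc_union_Icc_eq_Icc hab hbd).symm
  have hloc : ∀ t ∈ Set.Icc a d, t ≠ b →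
      ∃ S, t ∈ S ∧ S ∈ 𝓝[Set.Icc a d] t ∧ FlowOn k m n α c S v := by
    intro t ht htb
    rcases lt_or_gt_of_ne htb with h | h
    · refine ⟨Set.Icc a b, ⟨ht.1, h.le⟩, ?_, h1⟩
      filter_upwards [self_mem_nhdsWithin, nhdsWithin_le_nhds (Iio_mem_nhds h)] with s hs hs'
      exact ⟨hs.1, le_of_lt hs'⟩
    · refine ⟨Set.Icc b d, ⟨h.le, ht.2⟩, ?_, h2⟩
      filter_upwards [self_mem_nhdsWithin, nhdsWithin_le_nhds (Ioi_mem_nhds h)] with s hs hs'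
      exact ⟨le_of_lt hs', hs.2⟩
  have hb1 : b ∈ Set.Icc a b := ⟨hab, le_rfl⟩
  have hb2 : b ∈ Set.Icc b d := ⟨le_rfl, hbd⟩
  refine ⟨⟨fun t ht => ?_, fun t ht => ?_⟩, fun t ht => ?_⟩
  · rw [hunion] at ht
    exact ht.elim (h1.cont.1 t) (h2.cont.1 t)
  · by_cases htb : t = b
    · subst htb
      rw [hunion, nhdsWithin_union]
      exact (h1.cont.2 _ hb1).sup (h2.cont.2 _ hb2)
    · obtain ⟨S, htS, hS, hv⟩ := hloc t ht htb
      exact (hv.cont.2 t htS).mono_left (nhdsWithin_le_iff.mpr hS)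
  · by_cases htb : t = b
    · subst htb
      obtain ⟨lap, hl, hd⟩ := h1.eqn t hb1
      obtain ⟨lap', hl', hd'⟩ := h2.eqn t hb2
      -- Both Laplacians represent the same distribution, so the equation gives equal left and right
      -- derivatives at the junction.
      obtain rfl : lap = lap' := toTD_inj (hl.trans hl'.symm)
      refine ⟨lap, hl, ?_⟩
      rw [hunion]
      exact hd.union hd'
    · obtain ⟨S, htS, hS, hv⟩ := hloc t ht htb
      obtain ⟨lap, hl, hd⟩ := hv.eqn t htS
      exact ⟨lap, hl, hd.mono_of_mem_nhdsWithin hS⟩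

theorem FlowOn.glue {α : ℝ} {c : ℝ → ℂ} {a b d : ℝ} (hab : a ≤ b) (hbd : b ≤ d) {v w : ℝ → L2 N}
    (h1 : FlowOn k m n α c (Set.Icc a b) v) (h2 : FlowOn k m n α c (Set.Icc b d) w)
    (hvw : w b = v b) : FlowOn k m n α c (Set.Icc a d) fun t => if t ≤ b then v t else w t := by
  refine .union hab hbd (h1.congr (fun _ _ => rfl) fun t ht => if_pos ht.2)
    (h2.congr (fun _ _ => rfl) fun t ht => ?_)
  rcases ht.1.eq_or_lt with rfl | h
  · simp [hvw]
  · exact if_neg (not_le.mpr h)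

/-! ### The Cauchy problem -/

/-- The coefficient `λ (1 - bt)⁻¹`. -/
def coeff (lam : ℂ) (b t : ℝ) : ℂ := lam * ((1 - b * t : ℝ) : ℂ)⁻¹

theorem MemX.exists_ae_norm_le {u : L2 N} (h : MemX k m n u) : ∃ M : ℝ, ∀ᵐ x, ‖u x‖ ≤ M :=
  ⟨_, ae_norm_le_of_weight (h.xBound.ae_norm_le ENNReal.toReal_nonneg)⟩

theorem isSolution_iff (hN : 1 ≤ N) {lam : ℂ} {b : ℝ} {φ : L2 N} {I : Set ℝ} {v : ℝ → L2 N} :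
    IsSolution k m n lam b φ I v ↔
      FlowOn k m n (2 / (N : ℝ)) (coeff lam b) I v ∧ v 0 = φ := by
  have hα : 0 < 2 / (N : ℝ) := by
    have : (0 : ℝ) < N := by exact_mod_cast hN
    positivity
  constructor
  · intro h
    refine ⟨⟨h.cont, fun t ht => ?_⟩, h.init⟩
    obtain ⟨vt, lap, Nv, hd, hlap, hNv, heq⟩ := h.eqn t ht
    obtain ⟨M, hM⟩ := (h.cont.1 t ht).exists_ae_norm_le
    have hN : Nv = powerL2 (2 / (N : ℝ)) (v t) := by
      ext1
      filter_upwards [hNv, powerL2_coe hα hM] with x h1 h2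
      rw [h1, h2, power]
    refine ⟨lap, hlap, ?_⟩
    have e1 : vt = Complex.I • lap - (Complex.I * coeff lam b t) • powerL2 (2 / (N : ℝ)) (v t) := by
      rw [← hN, coeff, mul_smul, ← heq, smul_add, smul_smul, Complex.I_mul_I, neg_one_smul]
      abel
    rwa [← e1]
  · rintro ⟨h, h0⟩
    refine ⟨h.cont, h0, fun t ht => ?_⟩
    obtain ⟨lap, hlap, hd⟩ := h.eqn t ht
    obtain ⟨M, hM⟩ := (h.cont.1 t ht).exists_ae_norm_le
    refine ⟨_, lap, powerL2 (2 / (N : ℝ)) (v t), hd, hlap, powerL2_coe hα hM, ?_⟩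
    rw [smul_sub, smul_smul, smul_smul, ← mul_assoc, Complex.I_mul_I, neg_one_mul, neg_smul,
      neg_smul, one_smul, coeff]
    abel

theorem norm_coeff_le (lam : ℂ) {b t T : ℝ} (hb : 0 ≤ b) (hT : b * T < 1) (htT : t ≤ T) :
    ‖coeff lam b t‖ ≤ ‖lam‖ * (1 - b * T)⁻¹ := by
  have h1 : b * t ≤ b * T := mul_le_mul_of_nonneg_left htT hb
  rw [coeff, norm_mul, norm_inv, Complex.norm_real, Real.norm_of_nonneg (by linarith)]
  have : 0 < 1 - b * T := by linarith
  gcongr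

/-- Solutions on `[s, s + δ]`, where `δ` depends only on bounds of the data. -/
theorem exists_flowOn_coeff (hn : (N : ℝ) < 2 * n) (hk : (N : ℝ) < 2 * k) {α : ℝ} (hα : 0 < α)
    (hnα : (N : ℝ) < 2 * (n * α)) (hm : k + n + 1 ≤ 2 * m) {K : ℝ} (hK : 0 ≤ K) {η : ℝ} (hη : 0 < η)
    (lam : ℂ) {b T : ℝ} (hb : 0 ≤ b) (hT : b * T < 1) :
    ∃ δ > 0, ∀ (φ : L2 N) (s : ℝ), XBound k m n (ENNReal.ofReal K) φ →
      ENNReal.ofReal η ≤ weightedInf n φ → ∀ T' ≤ s + δ, T' ≤ T →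
      ∃ v : ℝ → L2 N, v s = φ ∧ FlowOn k m n α (coeff lam b) (Set.Icc s T') v ∧
        ∀ t ∈ Set.Icc s T', ENNReal.ofReal (η / 2) ≤ weightedInf n (v t) := by
  obtain ⟨δ, hδ, h⟩ := exists_flowOn (N := N) hn hk hα hnα hm hK hη (B := ‖lam‖ * (1 - b * T)⁻¹)
    (mul_nonneg (norm_nonneg _) (inv_nonneg.mpr (by linarith)))
  refine ⟨δ, hδ, fun φ s hφ hlow T' hT' hT'T => ?_⟩
  -- The coefficient is frozen after time `T`, before its singularity, so that it is continuous on
  -- the whole line with a bound independent of `s`.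
  have hc : Continuous fun t => coeff lam b (min (s + t) T) := by
    unfold coeff
    refine continuous_const.mul (Continuous.inv₀ (by fun_prop) fun t => ?_)
    have h1 : b * min (s + t) T ≤ b * T := mul_le_mul_of_nonneg_left (min_le_right _ _) hb
    have h2 : 1 - b * min (s + t) T ≠ 0 := by linarith
    exact_mod_cast h2
  obtain ⟨v, hv0, hv, hvlow⟩ := h φ (fun t => coeff lam b (min (s + t) T)) hφ
    (le_weightedInf_iff.mp hlow) hc fun t => norm_coeff_le lam hb hT (min_le_right _ _)
  have h1 := FlowOn.shift (c := fun t => coeff lam b (min t T)) s hv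
  rw [add_zero] at h1
  refine ⟨fun t => v (t - s), by simp [hv0], ?_, fun t ht => hvlow _ ⟨by linarith [ht.1], by linarith [ht.2]⟩⟩
  refine (h1.mono (Set.Icc_subset_Icc_right hT')).congr (fun t ht => ?_) fun _ _ => rfl
  simp only [min_eq_left (ht.2.trans hT'T)]

theorem exists_ofReal_le {a : ℝ≥0∞} (ha : 0 < a) : ∃ η : ℝ, 0 < η ∧ ENNReal.ofReal η ≤ a := by
  obtain ⟨r, hr0, hra⟩ := ENNReal.lt_iff_exists_nnreal_btwn.mp ha
  exact ⟨r, by exact_mod_cast hr0, by simpa using hra.le⟩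

theorem isPosSolution_iff (hN : 1 ≤ N) {lam : ℂ} {b : ℝ} {φ : L2 N} {T : ℝ} {v : ℝ → L2 N} :
    IsPosSolution k m n lam b φ T v ↔
      (FlowOn k m n (2 / (N : ℝ)) (coeff lam b) (Set.Icc 0 T) v ∧ v 0 = φ) ∧
      ∃ η : ℝ, 0 < η ∧ ∀ t ∈ Set.Icc 0 T, ENNReal.ofReal η ≤ weightedInf n (v t) := by
  rw [IsPosSolution, isSolution_iff hN]
  refine and_congr_right fun _ => ⟨fun h => ?_, fun ⟨η, hη, h⟩ => ?_⟩
  · obtain ⟨η, hη, hle⟩ := exists_ofReal_le h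
    exact ⟨η, hη, fun t ht => hle.trans (iInf₂_le t ht)⟩
  · exact (ENNReal.ofReal_pos.mpr hη).trans_le (le_iInf₂ h)

theorem IsPosSolution.mono (hN : 1 ≤ N) {lam : ℂ} {b : ℝ} {φ : L2 N} {T T' : ℝ} {v : ℝ → L2 N}
    (h : IsPosSolution k m n lam b φ T v) (hT : T' ≤ T) : IsPosSolution k m n lam b φ T' v := by
  rw [isPosSolution_iff hN] at h ⊢
  obtain ⟨⟨h1, h2⟩, η, hη, h3⟩ := h
  exact ⟨⟨h1.mono (Set.Icc_subset_Icc_right hT), h2⟩, η, hη,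
    fun t ht => h3 t ⟨ht.1, ht.2.trans hT⟩⟩

theorem IsPosSolution.congr (hN : 1 ≤ N) {lam : ℂ} {b : ℝ} {φ : L2 N} {T : ℝ} (hT : 0 ≤ T)
    {v w : ℝ → L2 N} (h : IsPosSolution k m n lam b φ T v) (hvw : Set.EqOn w v (Set.Icc 0 T)) :
    IsPosSolution k m n lam b φ T w := by
  rw [isPosSolution_iff hN] at h ⊢
  obtain ⟨⟨h1, h2⟩, η, hη, h3⟩ := h
  refine ⟨⟨h1.congr (fun _ _ => rfl) hvw, (hvw ⟨le_rfl, hT⟩).trans h2⟩, η, hη, fun t ht => ?_⟩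
  rw [hvw ht]
  exact h3 t ht

theorem IsPosSolution.unique (hN : 1 ≤ N) {lam : ℂ} {b : ℝ} (hb : 0 ≤ b) {φ : L2 N} {T : ℝ}
    (hT : b * T < 1) {v w : ℝ → L2 N} (hv : IsPosSolution k m n lam b φ T v)
    (hw : IsPosSolution k m n lam b φ T w) : Set.EqOn v w (Set.Icc 0 T) := by
  have hα : 0 < 2 / (N : ℝ) := by
    have : (0 : ℝ) < N := by exact_mod_cast hN
    positivity
  rw [isPosSolution_iff hN] at hv hw
  exact hv.1.1.unique hα (fun t ht => norm_coeff_le lam hb hT ht.2) hw.1.1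
    (hv.1.2.trans hw.1.2.symm)

theorem IsPosSolution.glue (hN : 1 ≤ N) {lam : ℂ} {b : ℝ} {φ : L2 N} {s T : ℝ} (hs : 0 ≤ s)
    (hsT : s ≤ T) {v w : ℝ → L2 N} (hv : IsPosSolution k m n lam b φ s v)
    (hw : FlowOn k m n (2 / (N : ℝ)) (coeff lam b) (Set.Icc s T) w) (hws : w s = v s) {η : ℝ}
    (hη : 0 < η) (hwlow : ∀ t ∈ Set.Icc s T, ENNReal.ofReal η ≤ weightedInf n (w t)) :
    ∃ z, IsPosSolution k m n lam b φ T z := by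
  refine ⟨fun t => if t ≤ s then v t else w t, ?_⟩
  rw [isPosSolution_iff hN] at hv ⊢
  obtain ⟨⟨h1, h2⟩, ε, hε, h3⟩ := hv
  refine ⟨⟨h1.glue hs hsT hw hws, by simp [hs, h2]⟩, min ε η, lt_min hε hη, fun t ht => ?_⟩
  by_cases hts : t ≤ s
  · rw [if_pos hts]
    exact (ENNReal.ofReal_le_ofReal (min_le_left _ _)).trans (h3 t ⟨ht.1, hts⟩)
  · rw [if_neg hts]
    exact (ENNReal.ofReal_le_ofReal (min_le_right _ _)).trans (hwlow t ⟨(not_le.mp hts).le, ht.2⟩)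

/-- A positive solution can be continued by a time depending only on bounds at its final time. -/
theorem exists_continuation (hN : 1 ≤ N) (hn : (N : ℝ) < 2 * n) (hk : (N : ℝ) < 2 * k)
    (hnα : (N : ℝ) < 2 * (n * (2 / (N : ℝ)))) (hm : k + n + 1 ≤ 2 * m) {K : ℝ} (hK : 0 ≤ K) {η : ℝ}
    (hη : 0 < η) (lam : ℂ) {b T : ℝ} (hb : 0 ≤ b) (hT : b * T < 1) (φ : L2 N) :
    ∃ δ > 0, ∀ (v : ℝ → L2 N) (s : ℝ), 0 ≤ s → IsPosSolution k m n lam b φ s v →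
      normX k m n (v s) ≤ ENNReal.ofReal K → ENNReal.ofReal η ≤ weightedInf n (v s) →
      ∀ T', s ≤ T' → T' ≤ s + δ → T' ≤ T → ∃ w, IsPosSolution k m n lam b φ T' w := by
  have hα : 0 < 2 / (N : ℝ) := by
    have : (0 : ℝ) < N := by exact_mod_cast hN
    positivity
  obtain ⟨δ, hδ, h⟩ := exists_flowOn_coeff (N := N) hn hk hα hnα hm hK hη lam hb hT
  refine ⟨δ, hδ, fun v s hs hv hvK hvη T' hsT' hT' hT'T => ?_⟩
  obtain ⟨w, hw0, hw, hwlow⟩ := h (v s) s ((XBound.of_normX _).mono hvK) hvη T' hT' hT'T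
  exact hv.glue hN hs hsT' hw hw0 (half_pos hη) hwlow

theorem exists_between_time {b T : ℝ} (hb : 0 ≤ b) (hT : b * T < 1) : ∃ T' > T, b * T' < 1 := by
  refine ⟨T + (1 - b * T) / (b + 1), ?_, ?_⟩
  · have : 0 < (1 - b * T) / (b + 1) := div_pos (by linarith) (by linarith)
    linarith
  · have h1 : b * ((1 - b * T) / (b + 1)) < 1 - b * T := by
      rw [mul_div_assoc', div_lt_iff₀ (by linarith)]
      nlinarith
    linarith

theorem IsPosSolution.exists_extension (hN : 1 ≤ N) (hn : (N : ℝ) < 2 * n) (hk : (N : ℝ) < 2 * k)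
    (hnα : (N : ℝ) < 2 * (n * (2 / (N : ℝ)))) (hm : k + n + 1 ≤ 2 * m) {lam : ℂ} {b T : ℝ}
    (hb : 0 ≤ b) (hT : b * T < 1) (hT0 : 0 ≤ T) {φ : L2 N} {v : ℝ → L2 N}
    (hv : IsPosSolution k m n lam b φ T v) :
    ∃ T' > T, b * T' < 1 ∧ ∃ w, IsPosSolution k m n lam b φ T' w := by
  obtain ⟨T₁, hT₁, hbT₁⟩ := exists_between_time hb hT
  have hTmem : T ∈ Set.Icc 0 T := ⟨hT0, le_rfl⟩
  obtain ⟨⟨h1, h2⟩, η, hη, h3⟩ := (isPosSolution_iff hN).mp hv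
  obtain ⟨δ, hδ, h⟩ := exists_continuation hN hn hk hnα hm
    (ENNReal.toReal_nonneg (a := normX k m n (v T))) hη lam hb hbT₁ φ
  refine ⟨min (T + δ) T₁, lt_min (by linarith) hT₁, ?_, h v T hT0 hv ?_ (h3 T hTmem) _
    (le_min (by linarith) hT₁.le) (min_le_left _ _) (min_le_right _ _)⟩
  · exact (mul_le_mul_of_nonneg_left (min_le_right _ _) hb).trans_lt hbT₁
  · rw [ENNReal.ofReal_toReal (h1.cont.1 T hTmem).normX_lt_top.ne]

theorem exists_isPosSolution (hN : 1 ≤ N) (hn : (N : ℝ) < 2 * n) (hk : (N : ℝ) < 2 * k)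
    (hnα : (N : ℝ) < 2 * (n * (2 / (N : ℝ)))) (hm : k + n + 1 ≤ 2 * m) (lam : ℂ) {b : ℝ}
    (hb : 0 ≤ b) {φ : L2 N} (hφ : MemX k m n φ) (hφ_inf : 0 < weightedInf n φ) :
    ∃ T > 0, b * T < 1 ∧ ∃ v, IsPosSolution k m n lam b φ T v := by
  have hα : 0 < 2 / (N : ℝ) := by
    have : (0 : ℝ) < N := by exact_mod_cast hN
    positivity
  obtain ⟨T₁, hT₁, hbT₁⟩ := exists_between_time hb (T := 0) (by simp)
  obtain ⟨η, hη, hle⟩ := exists_ofReal_le hφ_inf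
  obtain ⟨δ, hδ, h⟩ := exists_flowOn_coeff (N := N) hn hk hα hnα hm
    (ENNReal.toReal_nonneg (a := normX k m n φ)) hη lam hb hbT₁
  obtain ⟨v, hv0, hv, hvlow⟩ := h φ 0 hφ.xBound hle (min δ T₁) (by simp) (min_le_right _ _)
  exact ⟨min δ T₁, lt_min hδ hT₁,
    (mul_le_mul_of_nonneg_left (min_le_right _ _) hb).trans_lt hbT₁, v,
    (isPosSolution_iff hN).mpr ⟨⟨hv, hv0⟩, η / 2, half_pos hη, hvlow⟩⟩

end NLS

end

noncomputable section

namespace NLS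

open LineDeriv FourierTransform

variable {N k m n : ℕ}

/-! ### The maximal solution -/

theorem ofReal_lt_inv_ofReal_iff {b T : ℝ} (hb : 0 ≤ b) :
    ENNReal.ofReal T < (ENNReal.ofReal b)⁻¹ ↔ b * T < 1 := by
  rw [ENNReal.lt_inv_iff_lt_inv, ← one_div, ENNReal.lt_div_iff_mul_lt (by simp) (by simp),
    ← ENNReal.ofReal_mul hb, ENNReal.ofReal_lt_one]

/-- The existence times have no largest element, since any solution can be continued; so each lies
strictly below their supremum. Uniqueness makes the solutions on different intervals fit together.
-/
theorem exists_maximal (hN : 1 ≤ N) (hn : (N : ℝ) < 2 * n) (hk : (N : ℝ) < 2 * k)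
    (hnα : (N : ℝ) < 2 * (n * (2 / (N : ℝ)))) (hm : k + n + 1 ≤ 2 * m) (lam : ℂ) {b : ℝ}
    (hb : 0 ≤ b) {φ : L2 N}
    (hex : ∃ T > 0, b * T < 1 ∧ ∃ v, IsPosSolution k m n lam b φ T v) :
    ∃ (Tmax : ℝ≥0∞) (v : ℝ → L2 N), 0 < Tmax ∧ Tmax ≤ (ENNReal.ofReal b)⁻¹ ∧
      IsSolution k m n lam b φ {t : ℝ | 0 ≤ t ∧ ENNReal.ofReal t < Tmax} v ∧
      (∀ T : ℝ, 0 < T → ENNReal.ofReal T < Tmax → IsPosSolution k m n lam b φ T v) ∧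
      (∀ (T : ℝ) (w : ℝ → L2 N), 0 < T → b * T < 1 → IsPosSolution k m n lam b φ T w →
        ENNReal.ofReal T < Tmax ∧ Set.EqOn w v (Set.Icc 0 T)) ∧
      (Tmax < (ENNReal.ofReal b)⁻¹ →
        Tendsto (fun t : ℝ => normX k m n (v t) + (weightedInf n (v t))⁻¹)
          (𝓝[<] Tmax.toReal) (𝓝 ∞)) := by
  classical
  set S : Set ℝ := {T | 0 < T ∧ b * T < 1 ∧ ∃ v, IsPosSolution k m n lam b φ T v} with hS
  set Tmax : ℝ≥0∞ := ⨆ T ∈ S, ENNReal.ofReal T with hTmax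
  have hle : ∀ T ∈ S, ENNReal.ofReal T ≤ Tmax := fun T hT =>
    le_iSup₂ (f := fun T (_ : T ∈ S) => ENNReal.ofReal T) T hT
  have hext : ∀ T ∈ S, ∃ T' ∈ S, T < T' := by
    rintro T ⟨hT0, hbT, v, hv⟩
    obtain ⟨T', hTT', hbT', w, hw⟩ := hv.exists_extension hN hn hk hnα hm hb hbT hT0.le
    exact ⟨T', ⟨hT0.trans hTT', hbT', w, hw⟩, hTT'⟩
  have hlt : ∀ T ∈ S, ENNReal.ofReal T < Tmax := by
    intro T hT
    obtain ⟨T', hT', h⟩ := hext T hT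
    exact ((ENNReal.ofReal_lt_ofReal_iff hT'.1).mpr h).trans_le (hle T' hT')
  have hlt' : ∀ t : ℝ, ENNReal.ofReal t < Tmax → ∃ T ∈ S, t < T := by
    intro t ht
    obtain ⟨T, hT⟩ := lt_iSup_iff.mp ht
    obtain ⟨hTS, h⟩ := lt_iSup_iff.mp hT
    exact ⟨T, hTS, (ENNReal.ofReal_lt_ofReal_iff hTS.1).mp h⟩
  obtain ⟨T₀, hT₀⟩ : ∃ T, T ∈ S := by
    obtain ⟨T, hT, hbT, v, hv⟩ := hex
    exact ⟨T, hT, hbT, v, hv⟩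
  have hTmax_le : Tmax ≤ (ENNReal.ofReal b)⁻¹ := iSup₂_le fun T hT =>
    ((ofReal_lt_inv_ofReal_iff hb).mpr hT.2.1).le
  -- the solution on `[0, T]`
  have hsol : ∀ T : S, ∃ v, IsPosSolution k m n lam b φ T v := fun T => T.2.2.2
  choose sol hsol using hsol
  -- At each time any solution living beyond it may be used; uniqueness makes the choice immaterial.
  set v : ℝ → L2 N := fun t => if h : ∃ T : S, t < T then sol h.choose t else 0 with hv
  have hveq : ∀ (T : ℝ) (w : ℝ → L2 N), T ∈ S → IsPosSolution k m n lam b φ T w →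
      Set.EqOn w v (Set.Icc 0 T) := by
    intro T w hT hw t ht
    obtain ⟨T', hT', h⟩ := hext T hT
    have hex : ∃ T : S, t < T := ⟨⟨T', hT'⟩, ht.2.trans_lt h⟩
    simp only [hv, dif_pos hex]
    have h1 := hex.choose_spec
    set T₁ := hex.choose
    refine (hw.mono hN (T' := t) ht.2).unique hN hb ?_ ((hsol T₁).mono hN h1.le) ⟨ht.1, le_rfl⟩
    exact (mul_le_mul_of_nonneg_left ht.2 hb).trans_lt hT.2.1
  have hvS : ∀ T ∈ S, IsPosSolution k m n lam b φ T v := fun T hT =>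
    (hsol ⟨T, hT⟩).congr hN hT.1.le (hveq T _ hT (hsol ⟨T, hT⟩)).symm
  have hpos : ∀ T : ℝ, ENNReal.ofReal T < Tmax → IsPosSolution k m n lam b φ T v := by
    intro T hT
    obtain ⟨T', hT', h⟩ := hlt' T hT
    exact (hvS T' hT').mono hN h.le
  refine ⟨Tmax, v, (ENNReal.ofReal_pos.mpr hT₀.1).trans (hlt T₀ hT₀), hTmax_le, ?_,
    fun T _ hT => hpos T hT, fun T w hT hbT hw => ?_, fun hblow => ?_⟩
  · rw [isSolution_iff hN]
    refine ⟨.of_local fun t ht => ?_, ((isPosSolution_iff hN).mp (hvS T₀ hT₀)).1.2⟩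
    obtain ⟨T, hT, h⟩ := hlt' t ht.2
    refine ⟨Set.Icc 0 T, ⟨ht.1, h.le⟩, ?_, ((isPosSolution_iff hN).mp (hvS T hT)).1.1⟩
    filter_upwards [self_mem_nhdsWithin, nhdsWithin_le_nhds (Iio_mem_nhds h)] with s hs hs'
    exact ⟨hs.1, le_of_lt hs'⟩
  · have hTS : T ∈ S := ⟨hT, hbT, w, hw⟩
    exact ⟨hlt T hTS, hveq T w hTS hw⟩
  · have hfin : Tmax < ∞ := hblow.trans_le le_top
    set Ts := Tmax.toReal with hTs
    have hTsr : ENNReal.ofReal Ts = Tmax := ENNReal.ofReal_toReal hfin.ne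
    have hTs0 : 0 < Ts := by
      rw [← ENNReal.ofReal_pos, hTsr]
      exact (ENNReal.ofReal_pos.mpr hT₀.1).trans (hlt T₀ hT₀)
    have hbTs : b * Ts < 1 := by
      rw [← ofReal_lt_inv_ofReal_iff hb, hTsr]
      exact hblow
    -- Otherwise the quantity stays below some `M` at times arbitrarily close to the end. Continuing
    -- by the uniform time δ from a time within δ/2 of the end goes past the supremum.
    by_contra hnot
    rw [ENNReal.tendsto_nhds_top_iff_nnreal] at hnot
    push Not at hnot
    obtain ⟨M, hM⟩ := hnot
    obtain ⟨T₁, hT₁, hbT₁⟩ := exists_between_time hb hbTs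
    -- The lower bound is 1/(M+1) rather than 1/M, so that M = 0 needs no separate treatment.
    obtain ⟨δ, hδ, hcont⟩ := exists_continuation hN hn hk hnα hm (K := M) M.2
      (η := (M + 1 : ℝ)⁻¹) (by positivity) lam hb hbT₁ φ
    have hev : ∀ᶠ t in 𝓝[<] Ts, t ∈ Set.Ioo (max 0 (Ts - δ / 2)) Ts :=
      Ioo_mem_nhdsLT (max_lt hTs0 (by linarith))
    obtain ⟨t, htM, ht⟩ := (hM.and_eventually hev).exists
    have ht0 : 0 < t := (le_max_left _ _).trans_lt ht.1
    have htδ : Ts - δ / 2 < t := (le_max_right _ _).trans_lt ht.1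
    have htpos : IsPosSolution k m n lam b φ t v := hpos t (by
      rw [← hTsr]
      exact (ENNReal.ofReal_lt_ofReal_iff hTs0).mpr ht.2)
    have hK : normX k m n (v t) ≤ ENNReal.ofReal M := by
      rw [ENNReal.ofReal_coe_nnreal]
      exact le_self_add.trans htM
    have hη : ENNReal.ofReal (M + 1 : ℝ)⁻¹ ≤ weightedInf n (v t) := by
      have h1 : (weightedInf n (v t))⁻¹ ≤ M := le_add_self.trans htM
      rw [ENNReal.ofReal_inv_of_pos (by positivity), ENNReal.inv_le_iff_inv_le]
      refine h1.trans ?_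
      rw [← ENNReal.ofReal_coe_nnreal]
      exact ENNReal.ofReal_le_ofReal (by linarith)
    set T' := min (t + δ) T₁ with hT'
    have hTsT' : Ts < T' := lt_min (by linarith) hT₁
    obtain ⟨w, hw⟩ := hcont v t ht0.le htpos hK hη T' (ht.2.le.trans hTsT'.le) (min_le_left _ _)
      (min_le_right _ _)
    have hT'S : T' ∈ S := ⟨hTs0.trans hTsT',
      (mul_le_mul_of_nonneg_left (min_le_right _ _) hb).trans_lt hbT₁, w, hw⟩
    have h2 := hle T' hT'S
    rw [← hTsr, ENNReal.ofReal_le_ofReal_iff hTs0.le] at h2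
    linarith

end NLS

end

theorem proposition4p1 (N : ℕ) (hN : 1 ≤ N) (k m n : ℕ)
    (hk : (N : ℝ) / 2 < k)
    (hn : max ((N : ℝ) / 2 + 1) ((N : ℝ) / (2 * (2 / (N : ℝ)))) < n)
    (hm : k + n + 1 ≤ 2 * m)
    (lam : ℂ) (b : ℝ) (hb : 0 ≤ b)
    (φ : NLS.L2 N) (hφ : NLS.MemX k m n φ) (hφ_inf : 0 < NLS.weightedInf n φ) :
    -- local existence and uniqueness; `b * T < 1` means `T < 1 / b` (no condition if `b = 0`)
    (∃ T : ℝ, 0 < T ∧ b * T < 1 ∧ ∃ v : ℝ → NLS.L2 N,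
      NLS.IsPosSolution k m n lam b φ T v ∧
      ∀ w : ℝ → NLS.L2 N, NLS.IsPosSolution k m n lam b φ T w → Set.EqOn w v (Set.Icc 0 T)) ∧
    -- the maximal solution; `(ENNReal.ofReal b)⁻¹` is `1 / b` (`∞` if `b = 0`)
    ∃ (Tmax : ℝ≥0∞) (v : ℝ → NLS.L2 N), 0 < Tmax ∧ Tmax ≤ (ENNReal.ofReal b)⁻¹ ∧
      NLS.IsSolution k m n lam b φ {t : ℝ | 0 ≤ t ∧ ENNReal.ofReal t < Tmax} v ∧
      (∀ T : ℝ, 0 < T → ENNReal.ofReal T < Tmax → NLS.IsPosSolution k m n lam b φ T v) ∧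
      -- maximality and uniqueness: every solution on some `[0, T]` is a restriction of `v`
      (∀ (T : ℝ) (w : ℝ → NLS.L2 N), 0 < T → b * T < 1 → NLS.IsPosSolution k m n lam b φ T w →
        ENNReal.ofReal T < Tmax ∧ Set.EqOn w v (Set.Icc 0 T)) ∧
      -- blowup alternative
      (Tmax < (ENNReal.ofReal b)⁻¹ →
        Tendsto (fun t : ℝ => NLS.normX k m n (v t) + (NLS.weightedInf n (v t))⁻¹)
          (𝓝[<] Tmax.toReal) (𝓝 ∞)) := by
  have hN0 : (0 : ℝ) < N := by exact_mod_cast hN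
  obtain ⟨hn1, hn2⟩ := max_lt_iff.mp hn
  have hn' : (N : ℝ) < 2 * n := by linarith
  have hk' : (N : ℝ) < 2 * k := by linarith
  -- This is n > N/(2α) with α = 2/N, the integrability of ⟨x⟩^{-2nα}.
  have hnα : (N : ℝ) < 2 * (n * (2 / (N : ℝ))) := by
    rw [div_lt_iff₀ (by positivity)] at hn2
    linarith
  obtain ⟨T₀, hT₀, hbT₀, v₀, hv₀⟩ := NLS.exists_isPosSolution hN hn' hk' hnα hm lam hb hφ hφ_inf
  refine ⟨⟨T₀, hT₀, hbT₀, v₀, hv₀, fun w hw => hw.unique hN hb hbT₀ hv₀⟩, ?_⟩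
  exact NLS.exists_maximal hN hn' hk' hnα hm lam hb ⟨T₀, hT₀, hbT₀, v₀, hv₀⟩
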